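/- **Setting.** Let $-\infty\le x_l<0<x_r\le\infty$, and let $\Pi$ be an atomless measure on $(x_l,x_r)$ with $\Pi(x_l,x_r)=\infty$ and $0<Q(x):=\Pi(x,x_r)<\infty$ for every $x\in(x_l,x_r)$. Let $N$ be a Poisson random measure on $[0,\infty)\times(x_l,x_r)$ with mean measure $\mathrm{Leb}\times\Pi$. For $r\in\mathbb N=\{1,2,\dots\}$ the $r$-th order extremal process is $$Y^{(r)}(t)=\inf\{x>x_l:\ N([0,t]\times(x,x_r))<r\},\qquad t>0,$$ its range is $\mathcal R_r=\{Y^{(r)}(t):t>0\}$, and $\mathcal R_r^+=\mathcal R_r\cap(0,\infty)$, $\mathcal R_r^-=\mathcal R_r\cap(-\infty,0)$. A random set of points is identified with its counting measure $\sum_{x}\varepsilon_x$. Let $S$ also denote the Lebesgue–Stieltjes measure on $(x_l,x_r)$ of the nondecreasing function $S(x)=-\log Q(x)$, extended to $\mathbb R$ by giving no mass to the complement of $(x_l,x_r)$, and let $S^{\pm}$ be the measures on $(0,\infty)$ with distribution functions $$S^+(x)=S(0,x],\qquad S^-(x)=S[-x,0),\qquad x>0,$$ where $S^\pm(x)=0$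 for $x\le 0$, and these functions may take the value $\infty$ (this is the case for $S^+(x)$ if $x\ge x_r$, and for $S^-(x)$ if $x\ge -x_l$). **Theorem.** (i) For every $r\in\mathbb N$, almost surely $\mathcal R_r=\mathcal R_r^+\cup\mathcal R_r^-$; $\mathcal R_r^+$ is a Poisson process with mean measure $rS^+$; $-\mathcal R_r^-$ is a Poisson process with mean measure $rS^-$; and $\mathcal R_r^+$ and $\mathcal R_r^-$ are independent. (ii) Let $a^\pm(t)>0$ and $b^\pm(t)\in\mathbb R$ for $t>0$, and let $S_\infty^\pm$ be infinite Radon measures on $\mathbb R_+=[0,\infty)$ with no mass at $0$; write $S_\infty^\pm(x)=S_\infty^\pm(0,x]$. Suppose that for every $x>0$, as $t\to\infty$, $$t\,S^+(a^+(t)x-b^+(t))\to S^+_\infty(x),\qquad t\,S^-(a^-(t)x-b^-(t))\to S^-_\infty(x).$$ Then there are, on some probability space, independent Poisson processes $\mathcal R_\infty^+$ and $\mathcal P_\infty^-$ on $\mathbb R_+$ with mean measures $S_\infty^+$ and $S_\infty^-$ respectively, such that, as $r\to\infty$ through the integers, $$\Bigl(\frac{\mathcal R_r^++b^+(r)}{a^+(r)},\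 \frac{-\mathcal R_r^-+b^-(r)}{a^-(r)}\Bigr)\Rightarrow\bigl(\mathcal R_\infty^+,\ \mathcal P_\infty^-\bigr)$$ jointly in distribution, as pairs of random measures on $\mathbb R$, with respect to the product of the vague topologies. (Here the vague topology on measures on $\mathbb R$ is the coarsest one making $m\mapsto\int f\,dm\in[0,\infty]$ continuous for each continuous compactly supported $f\ge0$, and convergence in distribution means convergence of expectations of bounded continuous measurable functions of the pair.) -/

import Mathlib

open MeasureTheory ProbabilityTheory Set Filter Topology
open scoped ENNReal NNReal CompactlySupported

noncomputable section

namespace ExtremalRange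

/-! ### Poisson random measures -/

/-- `N` is a Poisson random measure with mean measure `μ` on the probability space `(Ω, P)`:
a random, almost surely integer-valued purely atomic measure (a countable sum of unit point
masses, repetitions allowed) such that `N(B)` is Poisson distributed with mean `μ(B)`
(almost surely infinite if `μ(B) = ∞`) and `N(B₁), …, N(Bₙ)` are independent for disjoint
measurable sets. The σ-algebra on measures is the one generated by the maps `m ↦ m(B)`. -/
structure IsPoissonRandomMeasure {Ω E : Type*} [MeasurableSpace Ω] [MeasurableSpace E]
    (N : Ω → Measure E) (μ : Measure E) (P : Measure Ω) : Prop where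
  aemeasurable : AEMeasurable N P
  isPointMeasure : ∀ᵐ ω ∂P, ∃ (I : Set ℕ) (z : I → E),
    N ω = Measure.sum fun k : I => Measure.dirac (z k)
  hasLaw : ∀ B : Set E, MeasurableSet B → μ B ≠ ∞ →
    HasLaw (fun ω => N ω B)
      ((poissonMeasure (μ B).toNNReal).map (fun n : ℕ => (n : ℝ≥0∞))) P
  eq_top : ∀ B : Set E, MeasurableSet B → μ B = ∞ → ∀ᵐ ω ∂P, N ω B = ∞
  indep : ∀ (n : ℕ) (B : Fin n → Set E), (∀ i, MeasurableSet (B i)) →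
    Pairwise (fun i j => Disjoint (B i) (B j)) → iIndepFun (fun i ω => N ω (B i)) P

/-- The counting measure of a set of real numbers: `∑_{x ∈ A} ε_x`. -/
def pointMeasure (A : Set ℝ) : Measure ℝ :=
  Measure.sum fun x : A => Measure.dirac (x : ℝ)

/-! ### Weak convergence of pairs of random measures in the vague topology -/

/-- The vague topology: the coarsest topology for which `m ↦ ∫ f dm` is continuous for every
nonnegative continuous compactly supported `f`. It is put on all measures, with values of the
integrals in `[0, ∞]`; on the Radon measures it restricts to the usual vague topology. -/
@[reducible] def vagueTopology (E : Type*) [TopologicalSpace E] [MeasurableSpace E] :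
    TopologicalSpace (Measure E) :=
  ⨅ f : C_c(E, ℝ≥0),
    TopologicalSpace.induced (fun m : Measure E => ∫⁻ x, (f x : ℝ≥0∞) ∂m) inferInstance

/-- The product of two copies of the vague topology. -/
@[reducible] def vagueTopologyProd (E : Type*) [TopologicalSpace E] [MeasurableSpace E] :
    TopologicalSpace (Measure E × Measure E) :=
  @instTopologicalSpaceProd _ _ (vagueTopology E) (vagueTopology E)

/-- Convergence in distribution `ξ_n ⇒ ζ` of pairs of random measures on the line, with respect
to the product of the vague topologies: `E F(ξ_n) → E F(ζ)` for all bounded continuous `F`.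
(Measurability of `F`, which makes the expectations meaningful on the space of all measures, is
automatic on pairs of Radon measures, where the Borel σ-algebra is generated by evaluations.) -/
structure VagueTendstoInDistribution {Ω Ω' : Type*} [MeasurableSpace Ω] [MeasurableSpace Ω']
    (ξ : ℕ → Ω → Measure ℝ × Measure ℝ) (P : Measure Ω)
    (ζ : Ω' → Measure ℝ × Measure ℝ) (P' : Measure Ω') : Prop where
  aemeasurable : ∀ n, AEMeasurable (ξ n) P
  aemeasurable_limit : AEMeasurable ζ P'
  tendsto : ∀ F : Measure ℝ × Measure ℝ → ℝ, Measurable F →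
    Continuous[vagueTopologyProd ℝ, inferInstance] F → (∃ C : ℝ, ∀ m, |F m| ≤ C) →
    Tendsto (fun n => ∫ ω, F (ξ n ω) ∂P) atTop (𝓝 (∫ ω, F (ζ ω) ∂P'))

/-! ### The intensity and the function `S` -/

/-- The open interval `(xl, xr)` of real numbers, with possibly infinite endpoints. -/
def window (xl xr : EReal) : Set ℝ := {x : ℝ | xl < (x : EReal) ∧ (x : EReal) < xr}

/-- The assumptions on the jump intensity `Pi`: an atomless infinite measure on `(xl, xr)` such
that `Q(x) = Pi(x, xr)` is finite and positive for every `x ∈ (xl, xr)`. -/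
structure IsJumpIntensity (Pi : Measure ℝ) (xl xr : EReal) : Prop where
  concentrated : Pi (window xl xr)ᶜ = 0
  atomless : ∀ x : ℝ, Pi {x} = 0
  infinite : Pi (window xl xr) = ∞
  tail_lt_top : ∀ x ∈ window xl xr, Pi (Ioi x ∩ window xl xr) < ∞
  tail_pos : ∀ x ∈ window xl xr, 0 < Pi (Ioi x ∩ window xl xr)

/-- `S(x) = -log Q(x)` where `Q(x) = Pi(x, xr)`. -/
def logTail (Pi : Measure ℝ) (xl xr : EReal) (x : ℝ) : ℝ :=
  -Real.log (Pi (Ioi x ∩ window xl xr)).toReal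

theorem measurableSet_window (xl xr : EReal) : MeasurableSet (window xl xr) :=
  (measurableSet_Ioo (a := xl) (b := xr)).preimage measurable_coe_real_ereal

instance ordConnected_window (xl xr : EReal) : OrdConnected (window xl xr) :=
  ⟨fun _ ha _ hb _ hc => ⟨ha.1.trans_le (EReal.coe_le_coe_iff.2 hc.1),
    (EReal.coe_le_coe_iff.2 hc.2).trans_lt hb.2⟩⟩

instance compactIccSpace_window (xl xr : EReal) : CompactIccSpace (window xl xr) := by
  refine ⟨fun {a b} => ?_⟩
  rw [Subtype.isCompact_iff]
  have : ((↑) : window xl xr → ℝ) '' Icc a b = Icc (a : ℝ) (b : ℝ) := by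
    ext x
    constructor
    · rintro ⟨y, hy, rfl⟩
      exact hy
    · intro hx
      exact ⟨⟨x, (ordConnected_window xl xr).out a.2 b.2 hx⟩, hx, rfl⟩
  rw [this]
  exact isCompact_Icc

/-- `S = -log Q` as a nondecreasing right-continuous function on `(xl, xr)`. -/
def logTailStieltjes {Pi : Measure ℝ} {xl xr : EReal} (h : IsJumpIntensity Pi xl xr) :
    StieltjesFunction (window xl xr) where
  toFun x := logTail Pi xl xr x
  mono' := by
    intro x y hxy
    have hy : 0 < (Pi (Ioi (y : ℝ) ∩ window xl xr)).toReal :=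
      ENNReal.toReal_pos (h.tail_pos y y.2).ne' (h.tail_lt_top y y.2).ne
    refine neg_le_neg (Real.log_le_log hy (ENNReal.toReal_mono (h.tail_lt_top x x.2).ne ?_))
    exact measure_mono (inter_subset_inter_left _ (Ioi_subset_Ioi hxy))
  right_continuous' := by
    intro x
    have hx : (Pi (Ioi (x : ℝ) ∩ window xl xr)).toReal ≠ 0 :=
      (ENNReal.toReal_pos (h.tail_pos x x.2).ne' (h.tail_lt_top x x.2).ne).ne'
    refine (Tendsto.log ?_ hx).neg
    refine (ENNReal.tendsto_toReal (h.tail_lt_top x x.2).ne).comp ?_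
    have key : Tendsto (fun y : ℝ => Pi (Ioi y ∩ window xl xr)) (𝓝[≥] (x : ℝ))
        (𝓝 (Pi (Ioi (x : ℝ) ∩ window xl xr))) := by
      refine tendsto_order.2 ⟨fun c hc => ?_, fun c hc => ?_⟩
      · have hU : (⋃ n : ℕ, Ioi ((x : ℝ) + 1 / ((n : ℝ) + 1)) ∩ window xl xr)
            = Ioi (x : ℝ) ∩ window xl xr := by
          rw [← iUnion_inter]
          congr 1
          ext z
          simp only [mem_iUnion, mem_Ioi]
          constructor
          · rintro ⟨n, hn⟩
            have : (0 : ℝ) < 1 / ((n : ℝ) + 1) := by positivity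
            linarith
          · intro hz
            obtain ⟨n, hn⟩ := exists_nat_one_div_lt (sub_pos.2 hz)
            exact ⟨n, by linarith⟩
        have hm : Monotone fun n : ℕ => Ioi ((x : ℝ) + 1 / ((n : ℝ) + 1)) ∩ window xl xr := by
          intro n m hnm
          refine inter_subset_inter_left _ (Ioi_subset_Ioi ?_)
          have : 1 / ((m : ℝ) + 1) ≤ 1 / ((n : ℝ) + 1) := Nat.one_div_le_one_div hnm
          linarith
        have ht := tendsto_measure_iUnion_atTop (μ := Pi) hm
        rw [hU] at ht
        obtain ⟨n, hn⟩ := (ht.eventually (lt_mem_nhds hc)).exists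
        have hpos : (0 : ℝ) < 1 / ((n : ℝ) + 1) := by positivity
        have hlt : ∀ᶠ y in 𝓝[≥] (x : ℝ), y < (x : ℝ) + 1 / ((n : ℝ) + 1) :=
          mem_nhdsWithin_of_mem_nhds (Iio_mem_nhds (by linarith))
        filter_upwards [hlt] with y hy
        exact hn.trans_le (measure_mono (inter_subset_inter_left _ (Ioi_subset_Ioi hy.le)))
      · filter_upwards [self_mem_nhdsWithin] with y hy
        exact (measure_mono (inter_subset_inter_left _ (Ioi_subset_Ioi hy))).trans_lt hc
    have hc : Tendsto ((↑) : window xl xr → ℝ) (𝓝[≥] x) (𝓝[≥] (x : ℝ)) :=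
      tendsto_nhdsWithin_of_tendsto_nhds_of_eventually_within _
        (continuous_subtype_val.continuousAt.tendsto.mono_left nhdsWithin_le_nhds)
        (by filter_upwards [self_mem_nhdsWithin] with y hy using hy)
    exact key.comp hc

/-- The measure `S` on the line: the Lebesgue–Stieltjes measure on `(xl, xr)` determined by the
monotone function `S(x) = -log Q(x)`, giving no mass to the complement of `(xl, xr)`. -/
def recordMeasure {Pi : Measure ℝ} {xl xr : EReal} (h : IsJumpIntensity Pi xl xr) :
    Measure ℝ :=
  (logTailStieltjes h).measure.map ((↑) : window xl xr → ℝ)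

theorem recordMeasure_Ioc {Pi : Measure ℝ} {xl xr : EReal} (h : IsJumpIntensity Pi xl xr)
    {a b : ℝ} (ha : a ∈ window xl xr) (hb : b ∈ window xl xr) :
    recordMeasure h (Ioc a b)
      = ENNReal.ofReal (logTail Pi xl xr b - logTail Pi xl xr a) := by
  rw [recordMeasure, Measure.map_apply measurable_subtype_coe measurableSet_Ioc]
  exact (logTailStieltjes h).measure_Ioc ⟨a, ha⟩ ⟨b, hb⟩

theorem recordMeasure_compl {Pi : Measure ℝ} {xl xr : EReal} (h : IsJumpIntensity Pi xl xr) :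
    recordMeasure h (window xl xr)ᶜ = 0 := by
  rw [recordMeasure, Measure.map_apply measurable_subtype_coe (measurableSet_window xl xr).compl]
  simp

/-- The measure `S⁺` on `(0, ∞)`, with distribution function `S⁺(x) = S(0, x]`. -/
def recordMeasurePos {Pi : Measure ℝ} {xl xr : EReal} (h : IsJumpIntensity Pi xl xr) :
    Measure ℝ :=
  (recordMeasure h).restrict (Ioi 0)

/-- The measure `S⁻` on `(0, ∞)`, with distribution function `S⁻(x) = S[-x, 0)`. -/
def recordMeasureNeg {Pi : Measure ℝ} {xl xr : EReal} (h : IsJumpIntensity Pi xl xr) :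
    Measure ℝ :=
  ((recordMeasure h).restrict (Iio 0)).map (fun x => -x)

theorem recordMeasurePos_Ioc {Pi : Measure ℝ} {xl xr : EReal} (h : IsJumpIntensity Pi xl xr)
    (x : ℝ) : recordMeasurePos h (Ioc 0 x) = recordMeasure h (Ioc 0 x) := by
  rw [recordMeasurePos, Measure.restrict_apply measurableSet_Ioc,
    inter_eq_left.2 Ioc_subset_Ioi_self]

theorem recordMeasureNeg_Ioc {Pi : Measure ℝ} {xl xr : EReal} (h : IsJumpIntensity Pi xl xr)
    (x : ℝ) : recordMeasureNeg h (Ioc 0 x) = recordMeasure h (Ico (-x) 0) := by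
  rw [recordMeasureNeg, Measure.map_apply measurable_neg measurableSet_Ioc,
    Measure.restrict_apply (measurable_neg measurableSet_Ioc)]
  congr 1
  ext y
  simp only [mem_inter_iff, mem_preimage, mem_Ioc, mem_Iio, mem_Ico]
  constructor
  · rintro ⟨⟨h1, h2⟩, h3⟩
    exact ⟨by linarith, h3⟩
  · rintro ⟨h1, h2⟩
    exact ⟨⟨by linarith, by linarith⟩, h2⟩

/-! ### The extremal process and its range -/

/-- The `r`-th order extremal process
`Y^{(r)}(t) = inf {x > xl : N([0,t] × (x, xr)) < r}` of the point measure `N`. -/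
def extremalProcess (xl xr : EReal) (N : Measure (ℝ × ℝ)) (r : ℕ) (t : ℝ) : EReal :=
  sInf {x : EReal | xl < x ∧
    N {p : ℝ × ℝ | p.1 ∈ Icc 0 t ∧ x < (p.2 : EReal) ∧ (p.2 : EReal) < xr} < (r : ℝ≥0∞)}

/-- The range `R_r = {Y^{(r)}(t) : t > 0}`. -/
def extremalRange (xl xr : EReal) (N : Measure (ℝ × ℝ)) (r : ℕ) : Set ℝ :=
  {x : ℝ | ∃ t : ℝ, 0 < t ∧ extremalProcess xl xr N r t = (x : EReal)}

/-- The positive points `R_r⁺` of the range. -/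
def extremalRangePos (xl xr : EReal) (N : Measure (ℝ × ℝ)) (r : ℕ) : Set ℝ :=
  extremalRange xl xr N r ∩ Ioi 0

/-- The negative points `R_r⁻` of the range. -/
def extremalRangeNeg (xl xr : EReal) (N : Measure (ℝ × ℝ)) (r : ℕ) : Set ℝ :=
  extremalRange xl xr N r ∩ Iio 0

/-! ### The limit conditions -/

/-- An infinite Radon measure on the half-line `ℝ₊` (as a measure on the line carried by
`(0, ∞)`, finite on bounded sets). -/
structure IsInfiniteRadonOnHalfLine (σ : Measure ℝ) : Prop where
  concentrated : σ (Iic 0) = 0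
  finite : ∀ x : ℝ, σ (Ioc 0 x) < ∞
  infinite : σ univ = ∞

/-- `t σ(a(t) x - b(t)) → σ∞(x)` as `t → ∞` for every `x > 0`, where a measure and its
distribution function `x ↦ σ(0, x]` are identified. -/
def TailCondition (σ σlim : Measure ℝ) (a b : ℝ → ℝ) : Prop :=
  ∀ x : ℝ, 0 < x →
    Tendsto (fun t : ℝ => ENNReal.ofReal t * σ (Ioc 0 (a t * x - b t))) atTop
      (𝓝 (σlim (Ioc 0 x)))

end ExtremalRange

end

namespace ExtremalRange

/-! The proof reduces every intensity to a single one. On the scale y = log (Q(0)/Q(x))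
(`levelScale`) the measure Π becomes c e^{-y} dy on the whole line with c = Q(0), and S becomes
Lebesgue measure. The generalized inverse `levelQuantile` is strictly increasing and transports both
back. Moreover, the range of the r-th extremal process is the image under `levelQuantile` of the
levels that were among the r highest when they arrived (`extremalRange_eq_image`): such a level
becomes the r-th highest at some later time, and conversely the r-th highest level at any time was
among the r highest on arrival.

So (i) amounts to showing that these record levels form a Poisson process of rate r. No record level
lies in (y, y'] exactly when the first r points above y are all above y'. This has probability
(e^{-y'}/e^{-y})^r = e^{-r(y'-y)}. The events for disjoint bands are independent, because knowing
which of the first r points above a level also lie above higher levels says nothing about when these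
r points arrive. To make this rigorous, time is cut into short slots, which turns the statement into
one about independent trials (`measure_biInter_firstHitsSubset`); the slot length then tends to 0
(`measure_recordLevels_avoid`).

By a Rényi type argument (`LocFinSet.map_eq_of_avoid`), the avoidance probabilities determine the
law of a random locally finite set. Hence the record levels of order r have the law of X/r, where X
is a unit rate Poisson process on the line. Such an X is built from N itself
(`exists_unit_poisson`). The Poisson property and the independence of the two halves are inherited
from X by restricting to the two half-lines and mapping.

For (ii) all orders are realized on one space through X/r. The normalized image of a point x > 0 of
X is a generalized inverse, at x, of the distribution function t ↦ r S⁺(a⁺(r) t - b⁺(r)). These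
functions converge to that of S∞⁺, so their inverses converge at all x outside a countable set,
which X almost surely avoids (`tendsto_of_isGenInverseAt`). The negative half is treated by
reflection. Almost surely the point measures converge vaguely to the image of X under the quantile
functions of S∞⁺ and S∞⁻. Dominated convergence gives convergence in distribution, and this image is
the required pair of Poisson processes. -/

theorem measurable_measure_restrict {E : Type*} [MeasurableSpace E] {D : Set E}
    (hD : MeasurableSet D) : Measurable fun m : Measure E => m.restrict D := by
  refine Measure.measurable_of_measurable_coe _ fun B hB => ?_
  simp only [Measure.restrict_apply hB]
  exact Measure.measurable_coe (hB.inter hD)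

/-- A countable sum of unit masses can be indexed by a set of natural numbers. -/
theorem exists_sum_dirac_eq {E ι : Type*} [MeasurableSpace E] [Countable ι] (z : ι → E) :
    ∃ (I : Set ℕ) (z' : I → E), (Measure.sum fun k => Measure.dirac (z k))
      = Measure.sum fun k : I => Measure.dirac (z' k) := by
  obtain ⟨e, he⟩ := exists_injective_nat ι
  let φ := Equiv.ofInjective e he
  refine ⟨range e, fun k => z (φ.symm k), ?_⟩
  ext B hB
  rw [Measure.sum_apply _ hB, Measure.sum_apply _ hB,
    ← φ.symm.tsum_eq fun k => Measure.dirac (z k) B]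

/-! ### Poisson random measures: images, restrictions and probabilities of small counts -/

namespace IsPoissonRandomMeasure

variable {Ω Ω' E F : Type*} [MeasurableSpace Ω] [MeasurableSpace Ω'] [MeasurableSpace E]
  [MeasurableSpace F] {N N' : Ω → Measure E} {μ : Measure E} {P : Measure Ω} {P' : Measure Ω'}

theorem congr (h : IsPoissonRandomMeasure N μ P) (hN : N =ᵐ[P] N') :
    IsPoissonRandomMeasure N' μ P where
  aemeasurable := h.aemeasurable.congr hN
  isPointMeasure := by
    filter_upwards [h.isPointMeasure, hN] with ω h1 h2
    rwa [← h2]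
  hasLaw B hB hμ := (h.hasLaw B hB hμ).congr (by filter_upwards [hN] with ω h2; rw [h2])
  eq_top B hB hμ := by
    filter_upwards [h.eq_top B hB hμ, hN] with ω h1 h2
    rwa [← h2]
  indep n B hB hd := (h.indep n B hB hd).congr fun i => by
    filter_upwards [hN] with ω h2
    rw [h2]

theorem map (h : IsPoissonRandomMeasure N μ P) {f : E → F} (hf : Measurable f) :
    IsPoissonRandomMeasure (fun ω => (N ω).map f) (μ.map f) P where
  aemeasurable := (Measure.measurable_map f hf).comp_aemeasurable h.aemeasurable
  isPointMeasure := by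
    filter_upwards [h.isPointMeasure] with ω ⟨I, z, hz⟩
    refine ⟨I, fun k => f (z k), ?_⟩
    rw [hz, Measure.map_sum hf.aemeasurable]
    simp only [Measure.map_dirac' hf]
  hasLaw B hB hμ := by
    rw [Measure.map_apply hf hB] at hμ ⊢
    simp only [Measure.map_apply hf hB]
    exact h.hasLaw _ (hf hB) hμ
  eq_top B hB hμ := by
    rw [Measure.map_apply hf hB] at hμ
    simp only [Measure.map_apply hf hB]
    exact h.eq_top _ (hf hB) hμ
  indep n B hB hd := by
    have e : ∀ i ω, (N ω).map f (B i) = N ω (f ⁻¹' B i) := fun i ω => Measure.map_apply hf (hB i)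
    simp only [e]
    exact h.indep n _ (fun i => hf (hB i)) fun i j hij => (hd hij).preimage f

theorem restrict (h : IsPoissonRandomMeasure N μ P) {D : Set E} (hD : MeasurableSet D) :
    IsPoissonRandomMeasure (fun ω => (N ω).restrict D) (μ.restrict D) P where
  aemeasurable := (measurable_measure_restrict hD).comp_aemeasurable h.aemeasurable
  isPointMeasure := by
    filter_upwards [h.isPointMeasure] with ω ⟨I, z, hz⟩
    obtain ⟨I', z', h'⟩ := exists_sum_dirac_eq fun k : {k : I // z k ∈ D} => z k
    refine ⟨I', z', ?_⟩
    rw [← h', hz]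
    ext B hB
    rw [Measure.restrict_apply hB, Measure.sum_apply _ (hB.inter hD), Measure.sum_apply _ hB,
      show (∑' i : {k : I // z k ∈ D}, Measure.dirac (z i) B)
        = ∑' i : I, {k | z k ∈ D}.indicator (fun i => Measure.dirac (z i) B) i from
        tsum_subtype {k | z k ∈ D} fun i : I => Measure.dirac (z i) B]
    congr 1
    ext k
    by_cases hk : z k ∈ D <;> by_cases hk' : z k ∈ B <;>
      simp [hk, hk', hB, hB.inter hD, indicator]
  hasLaw B hB hμ := by
    rw [Measure.restrict_apply hB] at hμ ⊢
    simp only [Measure.restrict_apply hB]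
    exact h.hasLaw _ (hB.inter hD) hμ
  eq_top B hB hμ := by
    rw [Measure.restrict_apply hB] at hμ
    simp only [Measure.restrict_apply hB]
    exact h.eq_top _ (hB.inter hD) hμ
  indep n B hB hd := by
    have e : ∀ i ω, (N ω).restrict D (B i) = N ω (B i ∩ D) :=
      fun i ω => Measure.restrict_apply (hB i)
    simp only [e]
    exact h.indep n _ (fun i => (hB i).inter hD) fun i j hij =>
      (hd hij).mono inter_subset_left inter_subset_left

/-- Being a Poisson random measure depends only on the law, up to the atomic structure. -/
theorem of_map_eq [IsProbabilityMeasure P] [IsProbabilityMeasure P']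
    (h : IsPoissonRandomMeasure N μ P) {M : Ω' → Measure E} (hM : AEMeasurable M P')
    (hlaw : P'.map M = P.map N)
    (hpt : ∀ᵐ ω ∂P', ∃ (I : Set ℕ) (z : I → E),
      M ω = Measure.sum fun k : I => Measure.dirac (z k)) :
    IsPoissonRandomMeasure M μ P' where
  aemeasurable := hM
  isPointMeasure := hpt
  hasLaw B hB hμ := by
    have hm := Measure.measurable_coe (α := E) hB
    refine ⟨hm.comp_aemeasurable hM, ?_⟩
    rw [← (h.hasLaw B hB hμ).map_eq]
    have e1 := AEMeasurable.map_map_of_aemeasurable hm.aemeasurable hM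
    have e2 := AEMeasurable.map_map_of_aemeasurable hm.aemeasurable h.aemeasurable
    rw [hlaw] at e1
    exact e1.symm.trans e2
  eq_top B hB hμ := by
    have hm : MeasurableSet {m : Measure E | m B = ∞} :=
      Measure.measurable_coe hB (measurableSet_singleton _)
    have := h.eq_top B hB hμ
    have h2 : ∀ᵐ m ∂(P.map N), m B = ∞ := (ae_map_iff h.aemeasurable hm).2 this
    rw [← hlaw] at h2
    exact (ae_map_iff hM hm).1 h2
  indep n B hB hd := by
    have hm := fun i => Measure.measurable_coe (α := E) (hB i)
    have := h.indep n B hB hd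
    refine (iIndepFun_iff_map_fun_eq_pi_map fun i => (hm i).comp_aemeasurable hM).2 ?_
    replace this :=
      (iIndepFun_iff_map_fun_eq_pi_map fun i => (hm i).comp_aemeasurable h.aemeasurable).1 this
    have hmm : Measurable fun (m : Measure E) (i : Fin n) => m (B i) :=
      measurable_pi_lambda _ fun i => hm i
    have e1 := AEMeasurable.map_map_of_aemeasurable hmm.aemeasurable hM
    have e2 := AEMeasurable.map_map_of_aemeasurable hmm.aemeasurable h.aemeasurable
    rw [hlaw] at e1
    refine (e1.symm.trans (e2.trans this)).trans ?_
    congr 1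
    funext i
    have e1 := AEMeasurable.map_map_of_aemeasurable (hm i).aemeasurable hM
    have e2 := AEMeasurable.map_map_of_aemeasurable (hm i).aemeasurable h.aemeasurable
    rw [hlaw] at e1
    exact e2.symm.trans e1

theorem nullMeasurable_coe (h : IsPoissonRandomMeasure N μ P) {B : Set E} (hB : MeasurableSet B) :
    AEMeasurable (fun ω => N ω B) P :=
  (Measure.measurable_coe hB).comp_aemeasurable h.aemeasurable

theorem measure_eq_zero (h : IsPoissonRandomMeasure N μ P) {B : Set E} (hB : MeasurableSet B)
    (hμ : μ B ≠ ∞) : P {ω | N ω B = 0} = ENNReal.ofReal (Real.exp (-(μ B).toReal)) := by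
  rw [(h.hasLaw B hB hμ).measure_eq (p := fun x => x = 0) (measurableSet_singleton _),
    Measure.map_apply (s := {x : ℝ≥0∞ | x = 0}) .of_discrete (measurableSet_singleton _)]
  have : (fun n : ℕ => (n : ℝ≥0∞)) ⁻¹' {x | x = 0} = {0} := by ext; simp
  rw [this, poissonMeasure_singleton]
  simp [ENNReal.coe_toNNReal_eq_toReal]

theorem ae_ne_top (h : IsPoissonRandomMeasure N μ P) {B : Set E} (hB : MeasurableSet B)
    (hμ : μ B ≠ ∞) : ∀ᵐ ω ∂P, N ω B ≠ ∞ := by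
  have := (h.hasLaw B hB hμ).ae_iff (p := fun x => x ≠ ∞)
    (measurableSet_setOfPred.1 (measurableSet_singleton _).compl)
  refine this.2 ((ae_map_iff (Measurable.of_discrete).aemeasurable
    (measurableSet_singleton _).compl).2 ?_)
  simp

theorem ae_eq_zero (h : IsPoissonRandomMeasure N μ P) [IsProbabilityMeasure P] {B : Set E}
    (hB : MeasurableSet B) (hμ : μ B = 0) : ∀ᵐ ω ∂P, N ω B = 0 := by
  have := h.measure_eq_zero hB (by simp [hμ])
  simp only [hμ] at this
  refine (mem_ae_iff_prob_eq_one₀ ?_).2 (this.trans (by simp))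
  exact (h.nullMeasurable_coe hB).nullMeasurableSet_preimage (measurableSet_singleton _)

/-- With q the mean, 1 - (1 + q) e^{-q} ≤ 1 - (1 + q)(1 - q) = q². Because the bound is quadratic,
it still tends to 0 after summing over the cells of a fine partition, which excludes multiple
points. -/
theorem measure_two_le (h : IsPoissonRandomMeasure N μ P) [IsProbabilityMeasure P] {B : Set E}
    (hB : MeasurableSet B) (hμ : μ B ≠ ∞) : P {ω | 2 ≤ N ω B} ≤ (μ B) ^ 2 := by
  rw [(h.hasLaw B hB hμ).measure_eq (p := fun x => 2 ≤ x) measurableSet_Ici,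
    Measure.map_apply (s := {x : ℝ≥0∞ | 2 ≤ x}) .of_discrete measurableSet_Ici]
  set q := (μ B).toNNReal
  have e : (fun n : ℕ => (n : ℝ≥0∞)) ⁻¹' {x | 2 ≤ x} = ({0, 1} : Set ℕ)ᶜ := by
    ext n
    simp only [mem_preimage, mem_ofPred_eq, mem_compl_iff, mem_insert_iff, mem_singleton_iff]
    norm_cast
    omega
  rw [e, prob_compl_eq_one_sub (by measurability), insert_eq,
    measure_union (by simp) (by measurability), poissonMeasure_singleton, poissonMeasure_singleton,
    ← ENNReal.ofReal_add (by positivity) (by positivity), ← ENNReal.ofReal_one,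
    ← ENNReal.ofReal_sub _ (by positivity)]
  have hq : μ B = ENNReal.ofReal q := by simp [q, hμ]
  rw [hq, ← ENNReal.ofReal_pow (by positivity)]
  refine ENNReal.ofReal_le_ofReal ?_
  have h1 : 1 - (q : ℝ) ≤ Real.exp (-q) := by linarith [Real.add_one_le_exp (-(q : ℝ))]
  have h2 : (0 : ℝ) ≤ q := q.2
  simp
  nlinarith

end IsPoissonRandomMeasure


/-! ### Trials and the pattern of their first successes -/

section Trials

variable {Ω : Type*} {U V : ℕ → ℕ → Set Ω} {r n : ℕ}

/-- The number of successes among the first `j` trials. -/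
noncomputable def hitCount (A : ℕ → Set Ω) (j : ℕ) (ω : Ω) : ℕ :=
  ∑ i ∈ Finset.range j, (A i).indicator (fun _ => 1) ω

theorem hitCount_eq_card (A : ℕ → Set Ω) (j : ℕ) (ω : Ω) {J : Finset ℕ}
    (hJ : ∀ i, i ∈ J ↔ i < j ∧ ω ∈ A i) : hitCount A j ω = J.card := by
  classical
  rw [hitCount, Finset.card_eq_sum_ones, ← Finset.sum_subset (s₁ := J)]
  · exact Finset.sum_congr rfl fun i hi => indicator_of_mem ((hJ i).1 hi).2 _
  · intro i hi
    exact Finset.mem_range.2 ((hJ i).1 hi).1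
  · intro i hi hi'
    refine indicator_of_notMem (fun h => hi' ((hJ i).2 ⟨Finset.mem_range.1 hi, h⟩)) _

/-- The first `r` successes of the trials `A` are successes of the trials `B`. -/
def firstHitsSubset (A B : ℕ → Set Ω) (r : ℕ) : Set Ω :=
  {ω | ∀ j, ω ∈ A j → hitCount A j ω < r → ω ∈ B j}

/-- The trials `A` up to the largest element of `J` succeed exactly on `J`. -/
def hitPattern (A : ℕ → Set Ω) (J : Finset ℕ) : Set Ω :=
  {ω | ∀ j ≤ J.sup id, ω ∈ A j ↔ j ∈ J}

theorem le_sup_id {J : Finset ℕ} {j : ℕ} (hj : j ∈ J) : j ≤ J.sup id :=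
  Finset.le_sup (f := id) hj

theorem hitPattern_subset {A B : ℕ → Set Ω} (hAB : ∀ j, A j ⊆ B j) {J J' : Finset ℕ} {ω : Ω}
    (h : ω ∈ hitPattern A J) (h' : ω ∈ hitPattern B J') (hs : J.sup id ≤ J'.sup id) : J ⊆ J' :=
  fun j hj => (h' j ((le_sup_id hj).trans hs)).1 (hAB j ((h j (le_sup_id hj)).2 hj))

/-- The pattern that ends later contains the one that ends earlier, and equal cardinality makes them
equal. So the patterns of a given size are disjoint events. -/
theorem hitPattern_eq {A : ℕ → Set Ω} {J J' : Finset ℕ} (hJ : J.card = J'.card) {ω : Ω}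
    (h : ω ∈ hitPattern A J) (h' : ω ∈ hitPattern A J') : J = J' := by
  rcases le_total (J.sup id) (J'.sup id) with hs | hs
  · exact Finset.eq_of_subset_of_card_le (hitPattern_subset (fun _ => le_rfl) h h' hs) hJ.ge
  · exact (Finset.eq_of_subset_of_card_le (hitPattern_subset (fun _ => le_rfl) h' h hs) hJ.le).symm

theorem exists_hitPattern {A : ℕ → Set Ω} {ω : Ω} (h : {j | ω ∈ A j}.Infinite) (hr : 1 ≤ r) :
    ∃ J : Finset ℕ, J.card = r ∧ ω ∈ hitPattern A J := by
  classical
  -- `Nat.nth` counts from zero, so exactly `r` successes precede the one with number `r`.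
  set J := (Finset.range (Nat.nth (fun j => ω ∈ A j) r)).filter fun j => ω ∈ A j with hJ
  have hcard : J.card = r := by
    rw [hJ, ← Nat.count_eq_card_filter_range, Nat.count_nth_of_infinite h]
  obtain ⟨k, hk, hk'⟩ := Finset.exists_mem_eq_sup J (Finset.card_pos.1 (by omega)) id
  refine ⟨J, hcard, fun j hj => ?_⟩
  rw [hk'] at hj
  have hlt := (Finset.mem_filter.1 hk).1
  simp only [hJ, Finset.mem_filter, Finset.mem_range, id] at hj hlt ⊢
  exact ⟨fun hA => ⟨by omega, hA⟩, fun hA => hA.2⟩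

/-- The right side splits into an event about `U n` and an event about the added trials `V n`, which
are independent later on. On `J` itself `V n` is unconstrained, since there `U n` already succeeds.
-/
theorem firstHitsSubset_inter_hitPattern (hUV : ∀ j, U (n + 1) j = U n j ∪ V n j)
    {J : Finset ℕ} (hJ : J.card = r) :
    firstHitsSubset (U (n + 1)) (U n) r ∩ hitPattern (U (n + 1)) J
      = hitPattern (U n) J ∩ ⋂ j ∈ Finset.range (J.sup id + 1) \ J, (V n j)ᶜ := by
  classical
  ext ω
  simp only [mem_inter_iff, mem_iInter, Finset.mem_sdiff, Finset.mem_range, mem_compl_iff]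
  constructor
  · rintro ⟨hE, hF⟩
    refine ⟨fun j hj => ⟨fun h => (hF j hj).1 (hUV j ▸ Or.inl h), fun h => ?_⟩, fun j hj hV => ?_⟩
    -- The successes before `j` form a proper subset of `J`, as `j` itself is missing; hence there
    -- are fewer than `r` of them.
    · refine hE j ((hF j hj).2 h) ?_
      rw [hitCount_eq_card (J := J.filter (· < j))]
      · rw [← hJ]
        refine Finset.card_lt_card ⟨Finset.filter_subset _ _, fun h' => ?_⟩
        exact lt_irrefl _ (Finset.mem_filter.1 (h' h)).2
      · intro i
        rw [Finset.mem_filter]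
        constructor
        · rintro ⟨h1, h2⟩
          exact ⟨h2, (hF i (h2.le.trans hj)).2 h1⟩
        · rintro ⟨h1, h2⟩
          exact ⟨(hF i (h1.le.trans hj)).1 h2, h1⟩
    · exact hj.2 ((hF j (by omega)).1 (hUV j ▸ Or.inr hV))
  · rintro ⟨hF, hV⟩
    have hF' : ω ∈ hitPattern (U (n + 1)) J := by
      intro j hj
      rw [hUV j, mem_union, hF j hj]
      refine ⟨fun h => ?_, Or.inl⟩
      by_contra hjJ
      exact hV j ⟨by omega, hjJ⟩ (h.resolve_left hjJ)
    refine ⟨fun j hj hc => ?_, hF'⟩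
    by_cases hjs : j ≤ J.sup id
    · exact (hF j hjs).2 ((hF' j hjs).1 hj)
    -- Beyond the largest element of `J` all `r` successes in `J` have already been counted.
    · refine absurd hc (not_lt.2 ?_)
      rw [hitCount_eq_card (J := ((Finset.range j).filter fun i => ω ∈ U (n + 1) i)) _ _ _
        (by simp), ← hJ]
      refine Finset.card_le_card fun i hi => ?_
      rw [Finset.mem_filter, Finset.mem_range]
      have := le_sup_id hi
      exact ⟨by omega, (hF' i this).2 hi⟩

/-- Once the pattern of `U n` is known, that of `U (n + 1)` is a matter of the independent trials `V
n` alone. Since `U (n + 1)` succeeds more often, it cannot collect its first successes later than `U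
n` does: if `J'` ended after `J`, it would contain `J` and so equal it. -/
theorem exists_hitPattern_inter_hitPattern (hUV : ∀ j, U (n + 1) j = U n j ∪ V n j)
    {J J' : Finset ℕ} (hJ : J.card = J'.card) :
    ∃ C : Set Ω, MeasurableSet[⨆ j, MeasurableSpace.generateFrom {V n j}] C ∧
      hitPattern (U n) J ∩ hitPattern (U (n + 1)) J' = hitPattern (U n) J ∩ C := by
  by_cases hs : J'.sup id ≤ J.sup id
  · refine ⟨⋂ j ∈ Finset.range (J'.sup id + 1), {ω | (j ∈ J ∨ ω ∈ V n j) ↔ j ∈ J'}, ?_, ?_⟩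
    · refine @Finset.measurableSet_biInter _ _ (⨆ j, MeasurableSpace.generateFrom {V n j}) _ _
        fun j _ => ?_
      have hV : MeasurableSet[⨆ j, MeasurableSpace.generateFrom {V n j}] (V n j) :=
        le_iSup (fun j => MeasurableSpace.generateFrom {V n j}) j _
          (MeasurableSpace.measurableSet_generateFrom (mem_singleton _))
      by_cases h1 : j ∈ J <;> by_cases h2 : j ∈ J' <;> simp only [h1, h2, true_or, false_or,
        iff_true, iff_false, not_true, ofPred_true, ofPred_false]
      · exact @MeasurableSet.univ _ (⨆ j, MeasurableSpace.generateFrom {V n j})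
      · exact @MeasurableSet.empty _ (⨆ j, MeasurableSpace.generateFrom {V n j})
      · exact hV
      · exact hV.compl
    · ext ω
      simp only [mem_inter_iff, mem_iInter, Finset.mem_range, mem_ofPred_eq]
      refine and_congr_right fun hF => ?_
      refine forall_congr' fun j => ?_
      rw [Nat.lt_succ_iff]
      refine forall_congr' fun hj => ?_
      rw [hUV j, mem_union, hF j (hj.trans hs)]
  · refine ⟨∅, @MeasurableSet.empty _ (⨆ j, MeasurableSpace.generateFrom {V n j}), ?_⟩
    rw [inter_empty, eq_empty_iff_forall_notMem]
    rintro ω ⟨h1, h2⟩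
    have : J ⊆ J' := hitPattern_subset (fun j => hUV j ▸ subset_union_left) h1 h2 (not_le.1 hs).le
    rw [Finset.eq_of_subset_of_card_le this hJ.ge] at hs
    exact hs le_rfl

end Trials

/-! ### Probabilities of success patterns and independence of the inclusion events -/

section TrialsProb

variable {Ω : Type*} {mΩ : MeasurableSpace Ω} {P : Measure Ω}
  {U V : ℕ → ℕ → Set Ω} {r : ℕ}

theorem measurableSet_hitPattern {m : MeasurableSpace Ω} {A : ℕ → Set Ω}
    (hA : ∀ j, MeasurableSet[m] (A j)) (J : Finset ℕ) : MeasurableSet[m] (hitPattern A J) := by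
  have : hitPattern A J = ⋂ j ∈ Finset.range (J.sup id + 1), {ω | ω ∈ A j ↔ j ∈ J} := by
    ext ω
    simp [hitPattern]
  rw [this]
  refine Finset.measurableSet_biInter _ fun j _ => ?_
  by_cases h : j ∈ J
  · simpa [h] using hA j
  · simp only [h, iff_false]
    exact (hA j).compl

theorem measurableSet_firstHitsSubset {m : MeasurableSpace Ω} {A B : ℕ → Set Ω}
    (hA : ∀ j, MeasurableSet[m] (A j)) (hB : ∀ j, MeasurableSet[m] (B j)) (r : ℕ) :
    MeasurableSet[m] (firstHitsSubset A B r) := by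
  have hc : ∀ j, Measurable[m] (hitCount A j) := fun j =>
    Finset.measurable_sum _ fun i _ => measurable_const.indicator (hA i)
  have : firstHitsSubset A B r = ⋂ j, (A j)ᶜ ∪ ({ω | hitCount A j ω < r}ᶜ ∪ B j) := by
    ext ω
    simp only [firstHitsSubset, mem_ofPred_eq, mem_iInter, mem_union, mem_compl_iff]
    refine forall_congr' fun j => ?_
    tauto
  rw [this]
  exact MeasurableSet.iInter fun j => (hA j).compl.union
    (((hc j) (measurableSet_Iio (a := r))).compl.union (hB j))

theorem measure_hitPattern {A : ℕ → Set Ω} (hA : iIndepSet A P) {u w : ℝ≥0∞}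
    (hu : ∀ j, P (A j) = u) (hw : ∀ j, P (A j)ᶜ = w) (J : Finset ℕ) :
    P (hitPattern A J) = u ^ J.card * w ^ (Finset.range (J.sup id + 1) \ J).card := by
  classical
  have hsub : J ⊆ Finset.range (J.sup id + 1) := fun j hj =>
    Finset.mem_range.2 (Nat.lt_succ_iff.2 (le_sup_id hj))
  have : hitPattern A J
      = ⋂ j ∈ Finset.range (J.sup id + 1), if j ∈ J then A j else (A j)ᶜ := by
    ext ω
    simp only [hitPattern, mem_ofPred_eq, mem_iInter, Finset.mem_range, Nat.lt_succ_iff]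
    refine forall_congr' fun j => forall_congr' fun _ => ?_
    by_cases h : j ∈ J <;> simp [h]
  rw [this, iIndep.meas_biInter hA, ← Finset.prod_sdiff hsub, mul_comm]
  · congr 1
    · rw [← Finset.prod_const]
      exact Finset.prod_congr rfl fun j hj => by rw [if_pos hj, hu]
    · rw [← Finset.prod_const]
      exact Finset.prod_congr rfl fun j hj => by rw [if_neg (Finset.mem_sdiff.1 hj).2, hw]
  · intro j _
    have := MeasurableSpace.measurableSet_generateFrom (mem_singleton (A j))
    split_ifs
    · exact this
    · exact this.compl

/-- When there are almost surely infinitely many successes, the patterns of size `r` partition the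
space up to a null set. -/
theorem measure_eq_tsum_hitPattern {A : ℕ → Set Ω} (hA : ∀ j, MeasurableSet (A j))
    (hinf : ∀ᵐ ω ∂P, {j | ω ∈ A j}.Infinite) (hr : 1 ≤ r) {B : Set Ω} (hB : MeasurableSet B) :
    P B = ∑' J : {J : Finset ℕ // J.card = r}, P (B ∩ hitPattern A J) := by
  rw [← measure_iUnion]
  · rw [← inter_iUnion]
    refine measure_congr ?_
    filter_upwards [hinf] with ω hω
    obtain ⟨J, hJ, h⟩ := exists_hitPattern hω hr
    refine propext ⟨fun h' => ⟨h', mem_iUnion.2 ⟨⟨J, hJ⟩, h⟩⟩, fun h' => h'.1⟩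
  · intro J J' hne
    refine Set.disjoint_left.2 fun ω h h' => hne (Subtype.ext ?_)
    exact hitPattern_eq (J.2.trans J'.2.symm) h.2 h'.2
  · exact fun J => hB.inter (measurableSet_hitPattern hA J)

/-- In an increasing family of trials `U 0 ⊆ U 1 ⊆ …` obtained by successively adding
independent trials, the events that the first `r` successes of `U (k + 1)` are successes of
`U k` are independent. -/
theorem measure_biInter_firstHitsSubset [IsProbabilityMeasure P] (hr : 1 ≤ r)
    (hUm : ∀ n j, MeasurableSet (U n j)) (hUV : ∀ n j, U (n + 1) j = U n j ∪ V n j)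
    (hU : ∀ n, iIndepSet (U n) P) (hV : ∀ n, iIndepSet (V n) P)
    (hind : ∀ n, Indep (MeasurableSpace.generateFrom {s | ∃ l ≤ n, ∃ j, s = U l j})
      (⨆ j, MeasurableSpace.generateFrom {V n j}) P)
    {u w w' ρ : ℕ → ℝ≥0∞} (hu : ∀ n j, P (U n j) = u n) (hw : ∀ n j, P (U n j)ᶜ = w n)
    (hw' : ∀ n j, P (V n j)ᶜ = w' n) (hww : ∀ n, w (n + 1) = w n * w' n)
    (hρ : ∀ n, u n = ρ n * u (n + 1)) (hinf : ∀ n, ∀ᵐ ω ∂P, {j | ω ∈ U n j}.Infinite)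
    (I : Finset ℕ) :
    P (⋂ k ∈ I, firstHitsSubset (U (k + 1)) (U k) r) = ∏ k ∈ I, ρ k ^ r := by
  classical
  set 𝓜 : ℕ → MeasurableSpace Ω :=
    fun n => MeasurableSpace.generateFrom {s | ∃ l ≤ n, ∃ j, s = U l j} with h𝓜
  have hU𝓜 : ∀ n l j, l ≤ n → MeasurableSet[𝓜 n] (U l j) := fun n l j hl =>
    MeasurableSpace.measurableSet_generateFrom ⟨l, hl, j, rfl⟩
  have h𝓜le : ∀ n, 𝓜 n ≤ mΩ := fun n => MeasurableSpace.generateFrom_le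
    fun s ⟨l, _, j, hs⟩ => hs ▸ hUm l j
  set G : ℕ → Set Ω := fun n => ⋂ k ∈ I.filter (· < n), firstHitsSubset (U (k + 1)) (U k) r with hG
  have hG𝓜 : ∀ n, MeasurableSet[𝓜 n] (G n) := fun n =>
    Finset.measurableSet_biInter _ fun k hk => by
      have : k < n := (Finset.mem_filter.1 hk).2
      exact measurableSet_firstHitsSubset (fun j => hU𝓜 _ _ _ this) (fun j => hU𝓜 _ _ _ this.le) r
  have hFU : ∀ n J, MeasurableSet[𝓜 n] (hitPattern (U n) J) := fun n J =>
    measurableSet_hitPattern (fun j => hU𝓜 _ _ _ le_rfl) J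
  -- The induction needs more than the product formula: the inclusion events below `n` are
  -- independent of the positions `J` of the first `r` successes of `U n`.
  have key : ∀ n, ∀ J : Finset ℕ, J.card = r → P (G n ∩ hitPattern (U n) J)
      = (∏ k ∈ I.filter (· < n), ρ k ^ r) * P (hitPattern (U n) J) := by
    intro n
    induction n with
    | zero => intro J _; simp [hG]
    | succ n ih =>
      intro J hJ
      by_cases hn : n ∈ I
      · have hf : I.filter (· < n + 1) = insert n (I.filter (· < n)) := by
          ext k
          simp only [Finset.mem_filter, Finset.mem_insert]
          constructor
          · rintro ⟨h1, h2⟩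
            rcases Nat.lt_succ_iff_lt_or_eq.1 h2 with h | h
            · exact Or.inr ⟨h1, h⟩
            · exact Or.inl h
          · rintro (rfl | ⟨h1, h2⟩)
            · exact ⟨hn, Nat.lt_succ_self _⟩
            · exact ⟨h1, by omega⟩
        have hGs : G (n + 1) = G n ∩ firstHitsSubset (U (n + 1)) (U n) r := by
          simp only [hG, hf, Finset.set_biInter_insert]
          rw [inter_comm]
        have hD : MeasurableSet[⨆ j, MeasurableSpace.generateFrom {V n j}]
            (⋂ j ∈ Finset.range (J.sup id + 1) \ J, (V n j)ᶜ) :=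
          Finset.measurableSet_biInter _ fun j _ => MeasurableSet.compl
            (le_iSup (fun j => MeasurableSpace.generateFrom {V n j}) j _
              (MeasurableSpace.measurableSet_generateFrom (mem_singleton _)))
        have hPD : P (⋂ j ∈ Finset.range (J.sup id + 1) \ J, (V n j)ᶜ)
            = w' n ^ (Finset.range (J.sup id + 1) \ J).card := by
          rw [iIndep.meas_biInter (hV n), ← Finset.prod_const]
          · exact Finset.prod_congr rfl fun j _ => hw' n j
          · exact fun j _ => (MeasurableSpace.measurableSet_generateFrom (mem_singleton _)).compl
        -- The failures of `U n` and `V n` outside `J` combine into failures of `U (n + 1)`, as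
        -- w_{n+1} = w_n w'_n. The `r` successes give u_n^r = ρ_n^r u_{n+1}^r, and ρ_n^r is the new
        -- factor.
        rw [hGs, inter_assoc, firstHitsSubset_inter_hitPattern (hUV n) hJ, ← inter_assoc,
          (Indep_iff _ _ _).1 (hind n) _ _ (MeasurableSet.inter (hG𝓜 n) (hFU n J)) hD, ih J hJ, hPD,
          measure_hitPattern (hU n) (hu n) (hw n), measure_hitPattern (hU (n + 1)) (hu _) (hw _),
          hf, Finset.prod_insert (by simp), hJ, hww, hρ n]
        ring
      · have hf : I.filter (· < n + 1) = I.filter (· < n) := by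
          ext k
          simp only [Finset.mem_filter]
          refine and_congr_right fun hk => ?_
          have : k ≠ n := fun h => hn (h ▸ hk)
          omega
        have hGs : G (n + 1) = G n := by simp only [hG, hf]
        -- No event is added here, but the pattern has to pass from `U n` to `U (n + 1)`. This is
        -- done by summing over the pattern `J'` of `U n`, given which only `V n` matters.
        rw [hGs, hf, measure_eq_tsum_hitPattern (hUm n) (hinf n) hr
            ((h𝓜le _ _ (hG𝓜 n)).inter (h𝓜le _ _ (hFU (n + 1) J))),
          measure_eq_tsum_hitPattern (hUm n) (hinf n) hr (h𝓜le _ _ (hFU (n + 1) J)),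
          ← ENNReal.tsum_mul_left]
        refine tsum_congr fun J' => ?_
        obtain ⟨C, hC, hCe⟩ := exists_hitPattern_inter_hitPattern (hUV n) (J'.2.trans hJ.symm)
        rw [inter_assoc, inter_comm (hitPattern (U (n + 1)) J), hCe, ← inter_assoc,
          (Indep_iff _ _ _).1 (hind n) _ _ (MeasurableSet.inter (hG𝓜 n) (hFU n J')) hC, ih J' J'.2,
          (Indep_iff _ _ _).1 (hind n) _ _ (hFU n J') hC, mul_assoc]
  have hI : I.filter (· < I.sup id + 1) = I :=
    Finset.filter_true_of_mem fun k hk => Nat.lt_succ_iff.2 (le_sup_id hk)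
  have hfin := fun J hJ => key (I.sup id + 1) J hJ
  simp only [hG, hI] at hfin
  have hm : MeasurableSet (⋂ k ∈ I, firstHitsSubset (U (k + 1)) (U k) r) :=
    Finset.measurableSet_biInter _ fun k _ => measurableSet_firstHitsSubset (hUm _) (hUm _) r
  -- The factor does not depend on the pattern, and the probabilities of the patterns sum to 1.
  rw [measure_eq_tsum_hitPattern (hUm (I.sup id + 1)) (hinf _) hr hm,
    tsum_congr fun J : {J : Finset ℕ // J.card = r} => hfin J.1 J.2, ENNReal.tsum_mul_left]
  have := measure_eq_tsum_hitPattern (P := P) (hUm (I.sup id + 1)) (hinf _) hr MeasurableSet.univ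
  simp only [univ_inter, measure_univ] at this
  rw [← this, mul_one]

end TrialsProb


/-! ### Deterministic configurations of times and levels -/

/-- The points of `Z` arriving until time `t` with level above `y`. -/
def pointsAbove (Z : Set (ℝ × ℝ)) (t y : ℝ) : Set (ℝ × ℝ) := {p ∈ Z | p.1 ≤ t ∧ y < p.2}

/-- The points of `Z` arriving before time `t` with level above `y`. -/
def pointsBefore (Z : Set (ℝ × ℝ)) (t y : ℝ) : Set (ℝ × ℝ) := {p ∈ Z | p.1 < t ∧ y < p.2}

/-- The levels of those points of `Z` that are among the `r` highest on arrival. -/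
def recordLevels (Z : Set (ℝ × ℝ)) (r : ℕ) : Set ℝ :=
  {y | ∃ s, (s, y) ∈ Z ∧ (pointsAbove Z s y).encard < r}

/-- The typical configurations of times and levels. -/
structure IsRegularConfig (Z : Set (ℝ × ℝ)) : Prop where
  pos : ∀ p ∈ Z, 0 < p.1
  injOn_fst : InjOn Prod.fst Z
  finite_above : ∀ t y, (pointsAbove Z t y).Finite
  infinite_above : ∀ y, {p ∈ Z | y < p.2}.Infinite
  infinite_until : ∀ t, 0 < t → {p ∈ Z | p.1 ≤ t}.Infinite

variable {Z : Set (ℝ × ℝ)} {r : ℕ}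

theorem pointsAbove_mono {t t' y y' : ℝ} (ht : t ≤ t') (hy : y' ≤ y) :
    pointsAbove Z t y ⊆ pointsAbove Z t' y' :=
  fun _ hp => ⟨hp.1, hp.2.1.trans ht, hy.trans_lt hp.2.2⟩

/-- This says that the first `r` points above `y` all lie above `y'`. A point of the band with fewer
than `r` predecessors above `y` is a record itself, since arrival times are distinct. Conversely, a
record in the band forces the earliest point of the band to have too few predecessors. -/
theorem disjoint_recordLevels_Ioc (hZ : IsRegularConfig Z) {y y' : ℝ} :
    Disjoint (recordLevels Z r) (Ioc y y') ↔
      ∀ p ∈ Z, y < p.2 → p.2 ≤ y' → (r : ℕ∞) ≤ (pointsBefore Z p.1 y).encard := by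
  constructor
  · intro h p hp h1 h2
    by_contra hlt
    refine Set.disjoint_left.1 h ⟨p.1, hp, lt_of_le_of_lt (encard_le_encard ?_) (not_le.1 hlt)⟩
      ⟨h1, h2⟩
    rintro q ⟨hq, hq1, hq2⟩
    refine ⟨hq, lt_of_le_of_ne hq1 fun he => ?_, h1.trans hq2⟩
    rw [hZ.injOn_fst hq hp he] at hq2
    exact lt_irrefl _ hq2
  · intro h
    refine Set.disjoint_left.2 ?_
    rintro y₁ ⟨s, hs, hlt⟩ ⟨h1, h2⟩
    have hfin : {q ∈ Z | q.1 ≤ s ∧ y < q.2 ∧ q.2 ≤ y'}.Finite :=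
      (hZ.finite_above s y).subset fun q hq => ⟨hq.1, hq.2.1, hq.2.2.1⟩
    -- Before the earliest point `p` of the band, every point above `y` is above `y'`, hence above
    -- `y₁`; so these points are among the fewer than `r` points above `y₁` until time `s`.
    obtain ⟨p, hp, hmin⟩ := exists_min_image _ Prod.fst hfin ⟨(s, y₁), hs, le_rfl, h1, h2⟩
    refine absurd (h p hp.1 hp.2.2.1 hp.2.2.2) (not_le.2 ?_)
    refine lt_of_le_of_lt (encard_le_encard ?_) hlt
    rintro q ⟨hq, hq1, hq2⟩
    refine ⟨hq, hq1.le.trans hp.2.1, h2.trans_lt ?_⟩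
    by_contra hle
    exact not_le.2 hq1 (hmin q ⟨hq, hq1.le.trans hp.2.1, hq2, not_lt.1 hle⟩)

theorem exists_le_encard_pointsAbove (hZ : IsRegularConfig Z) (y : ℝ) (k : ℕ) :
    ∃ t, (k : ℕ∞) ≤ (pointsAbove Z t y).encard := by
  obtain ⟨F, hF, hk⟩ := (hZ.infinite_above y).exists_subset_card_eq k
  obtain ⟨t, ht⟩ := (F.finite_toSet.image Prod.fst).bddAbove
  refine ⟨t, ?_⟩
  rw [← hk, ← encard_coe_eq_coe_finsetCard]
  exact encard_le_encard fun p hp => ⟨(hF hp).1, ht (mem_image_of_mem _ hp), (hF hp).2⟩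

/-- Once `r` points above `b` have arrived, no later point at a level at most `b` is a record, and
until then only finitely many points lie above `a - 1`. -/
theorem finite_recordLevels_inter_Icc (hZ : IsRegularConfig Z) (r : ℕ) (a b : ℝ) :
    (recordLevels Z r ∩ Icc a b).Finite := by
  obtain ⟨t, ht⟩ := exists_le_encard_pointsAbove hZ b r
  refine ((hZ.finite_above t (a - 1)).image Prod.snd).subset ?_
  rintro y ⟨⟨s, hs, hlt⟩, h1, h2⟩
  refine ⟨(s, y), ⟨hs, ?_, by simp only; linarith⟩, rfl⟩
  by_contra hts
  refine absurd hlt (not_lt.2 (ht.trans (encard_le_encard ?_)))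
  exact pointsAbove_mono (not_le.1 hts).le h2

/-- Points above `y` keep arriving, one at a time, so their number passes through every value from
the present one on. -/
theorem exists_encard_pointsAbove_eq (hZ : IsRegularConfig Z) (s y : ℝ) (k : ℕ) :
    ∃ t, s ≤ t ∧ (pointsAbove Z t y).encard = (pointsAbove Z s y).encard + k := by
  induction k with
  | zero => exact ⟨s, le_rfl, by simp⟩
  | succ k ih =>
    obtain ⟨t, hst, ht⟩ := ih
    obtain ⟨q₀, hq₀, hq₀'⟩ := ((hZ.infinite_above y).sdiff (hZ.finite_above t y)).nonempty
    have hq₀t : t < q₀.1 := by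
      by_contra hle
      exact hq₀' ⟨hq₀.1, not_lt.1 hle, hq₀.2⟩
    have hfin : {q ∈ Z | t < q.1 ∧ q.1 ≤ q₀.1 ∧ y < q.2}.Finite :=
      (hZ.finite_above q₀.1 y).subset fun q hq => ⟨hq.1, hq.2.2⟩
    -- `q` is the first arrival above `y` after time `t`.
    obtain ⟨q, hq, hmin⟩ := exists_min_image _ Prod.fst hfin ⟨q₀, hq₀.1, hq₀t, le_rfl, hq₀.2⟩
    refine ⟨q.1, hst.trans hq.2.1.le, ?_⟩
    have : pointsAbove Z q.1 y = insert q (pointsAbove Z t y) := by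
      ext p
      rw [mem_insert_iff]
      constructor
      · rintro ⟨h1, h2, h3⟩
        by_cases hpt : p.1 ≤ t
        · exact Or.inr ⟨h1, hpt, h3⟩
        · exact Or.inl (hZ.injOn_fst h1 hq.1 (le_antisymm h2
            (hmin p ⟨h1, not_le.1 hpt, h2.trans hq.2.2.1, h3⟩)))
      · rintro (rfl | h)
        · exact ⟨hq.1, le_rfl, hq.2.2.2⟩
        · exact pointsAbove_mono hq.2.1.le le_rfl h
    rw [this, encard_insert_of_notMem fun h => not_le.2 hq.2.1 h.2.1, ht]
    push_cast
    rw [add_assoc]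

/-! ### The range of the extremal process -/

/-- The two bounds say that `y` is the `r`-th highest level at time `t`, ties allowed. Strict
monotonicity of `T` carries the counts above `y` over to the counts above `T y`. -/
theorem extremalProcess_eq {xl xr : EReal} {N : Measure (ℝ × ℝ)} {T : ℝ → ℝ}
    (hT : StrictMono T) (hTw : ∀ y, T y ∈ window xl xr) (hZ : IsRegularConfig Z)
    (hN : ∀ B, MeasurableSet B → N B = ((Z ∩ {p | (p.1, T p.2) ∈ B}).encard : ℝ≥0∞))
    {t y : ℝ} (h1 : (pointsAbove Z t y).encard < r)
    (h2 : (r : ℕ∞) ≤ {p ∈ Z | p.1 ≤ t ∧ y ≤ p.2}.encard) :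
    extremalProcess xl xr N r t = (T y : EReal) := by
  have hcount : ∀ x : EReal,
      N {p : ℝ × ℝ | p.1 ∈ Icc 0 t ∧ x < (p.2 : EReal) ∧ (p.2 : EReal) < xr} < (r : ℝ≥0∞)
        ↔ {p ∈ Z | p.1 ≤ t ∧ x < (T p.2 : EReal)}.encard < r := by
    intro x
    have hm : MeasurableSet {p : ℝ × ℝ | p.1 ∈ Icc 0 t ∧ x < (p.2 : EReal) ∧ (p.2 : EReal) < xr} :=
      (measurable_fst measurableSet_Icc).inter
        ((measurable_coe_real_ereal.comp measurable_snd) measurableSet_Ioo)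
    have e : Z ∩ {p | (p.1, T p.2) ∈
        {p : ℝ × ℝ | p.1 ∈ Icc 0 t ∧ x < (p.2 : EReal) ∧ (p.2 : EReal) < xr}}
        = {p ∈ Z | p.1 ≤ t ∧ x < (T p.2 : EReal)} := by
      ext p
      constructor
      · rintro ⟨h, h', h'', _⟩
        exact ⟨h, h'.2, h''⟩
      · rintro ⟨h, h', h''⟩
        exact ⟨h, ⟨(hZ.pos p h).le, h'⟩, h'', (hTw p.2).2⟩
    rw [hN _ hm, e]
    norm_cast
  rw [extremalProcess]
  simp only [hcount]
  apply le_antisymm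
  · refine sInf_le ⟨(hTw y).1, ?_⟩
    simp only [EReal.coe_lt_coe_iff, hT.lt_iff_lt]
    exact h1
  · refine le_sInf fun x hx => ?_
    by_contra hlt
    refine absurd hx.2 (not_lt.2 (h2.trans (encard_le_encard ?_)))
    rintro p ⟨hp, hp1, hp2⟩
    exact ⟨hp, hp1, (not_le.1 hlt).trans_le (EReal.coe_le_coe_iff.2 (hT.monotone hp2))⟩

/-- Existence of the `r`-th highest level: there are infinitely many points until time `t`, but only
finitely many above each level. -/
theorem exists_level_at (hZ : IsRegularConfig Z) (hr : 1 ≤ r) {t : ℝ} (ht : 0 < t) :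
    ∃ p ∈ Z, p.1 ≤ t ∧ (pointsAbove Z t p.2).encard < r ∧
      (r : ℕ∞) ≤ {q ∈ Z | q.1 ≤ t ∧ p.2 ≤ q.2}.encard := by
  obtain ⟨F, hF, hk⟩ := (hZ.infinite_until t ht).exists_subset_card_eq r
  obtain ⟨y, hy⟩ := (F.finite_toSet.image Prod.snd).bddBelow
  have hy₀ : (r : ℕ∞) ≤ (pointsAbove Z t (y - 1)).encard := by
    rw [← hk, ← encard_coe_eq_coe_finsetCard]
    refine encard_le_encard fun p hp => ⟨(hF hp).1, (hF hp).2, ?_⟩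
    linarith [hy (mem_image_of_mem _ hp)]
  set y₀ := y - 1
  have hsub : {p ∈ Z | p.1 ≤ t ∧ (pointsAbove Z t p.2).encard < r} ⊆ pointsAbove Z t y₀ := by
    rintro p ⟨hp, hp1, hp2⟩
    refine ⟨hp, hp1, ?_⟩
    by_contra hle
    exact absurd hp2 (not_lt.2 (hy₀.trans (encard_le_encard
      (pointsAbove_mono le_rfl (not_lt.1 hle)))))
  have hne : (pointsAbove Z t y₀).Nonempty := by
    rw [← one_le_encard_iff_nonempty]
    exact le_trans (by exact_mod_cast hr) hy₀
  obtain ⟨m, hm, hmax⟩ := exists_max_image _ Prod.snd (hZ.finite_above t y₀) hne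
  have hm' : pointsAbove Z t m.2 = ∅ := by
    rw [eq_empty_iff_forall_notMem]
    rintro q ⟨hq, hq1, hq2⟩
    exact not_le.2 hq2 (hmax q ⟨hq, hq1, hm.2.2.trans hq2⟩)
  -- The `r`-th highest level is the lowest one with fewer than `r` points above it. The top point
  -- `m` shows that such levels exist, as `r` is positive.
  obtain ⟨p, hp, hmin⟩ := exists_min_image _ Prod.snd ((hZ.finite_above t y₀).subset hsub)
    ⟨m, hm.1, hm.2.1, by rw [hm', encard_empty]; exact_mod_cast hr⟩
  refine ⟨p, hp.1, hp.2.1, hp.2.2, ?_⟩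
  by_contra hlt
  have hM : {q ∈ Z | q.1 ≤ t ∧ y₀ < q.2 ∧ q.2 < p.2}.Nonempty := by
    by_contra hemp
    rw [not_nonempty_iff_eq_empty, eq_empty_iff_forall_notMem] at hemp
    refine hlt (hy₀.trans (encard_le_encard ?_))
    rintro q ⟨hq, hq1, hq2⟩
    exact ⟨hq, hq1, not_lt.1 fun h => hemp q ⟨hq, hq1, hq2, h⟩⟩
  -- If fewer than `r` points were at or above the level of `p`, the next lower point `q` would also
  -- have fewer than `r` points above it, against the minimality of `p`.
  obtain ⟨q, hq, hqmax⟩ := exists_max_image _ Prod.snd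
    ((hZ.finite_above t y₀).subset fun q hq => ⟨hq.1, hq.2.1, hq.2.2.1⟩) hM
  refine absurd (hmin q ⟨hq.1, hq.2.1, lt_of_le_of_lt (encard_le_encard ?_) (not_le.1 hlt)⟩)
    (not_le.2 hq.2.2.2)
  rintro q' ⟨hq', h1, h2⟩
  refine ⟨hq', h1, not_lt.1 fun h => not_le.2 h2 (hqmax q' ⟨hq', h1, hq.2.2.1.trans h2, h⟩)⟩

/-- The number of points above a level only grows in time. So the `r`-th highest level at any time
was among the `r` highest on arrival. Conversely, a level among the `r` highest on arrival is the
`r`-th highest as soon as exactly `r - 1` points lie above it. -/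
theorem extremalRange_eq_image {xl xr : EReal} {N : Measure (ℝ × ℝ)} {T : ℝ → ℝ}
    (hT : StrictMono T) (hTw : ∀ y, T y ∈ window xl xr) (hZ : IsRegularConfig Z)
    (hN : ∀ B, MeasurableSet B → N B = ((Z ∩ {p | (p.1, T p.2) ∈ B}).encard : ℝ≥0∞))
    (hr : 1 ≤ r) : extremalRange xl xr N r = T '' recordLevels Z r := by
  apply Subset.antisymm
  · rintro x ⟨t, ht, hx⟩
    obtain ⟨p, hp, hpt, h1, h2⟩ := exists_level_at hZ hr ht
    rw [extremalProcess_eq hT hTw hZ hN h1 h2] at hx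
    exact ⟨p.2, ⟨p.1, hp, lt_of_le_of_lt (encard_le_encard (pointsAbove_mono hpt le_rfl)) h1⟩,
      EReal.coe_injective hx⟩
  · rintro _ ⟨y, ⟨s, hs, hlt⟩, rfl⟩
    obtain ⟨n, hn⟩ := ENat.ne_top_iff_exists.1 (hlt.trans (ENat.natCast_lt_top r)).ne
    rw [← hn] at hlt
    have hnr : n < r := by exact_mod_cast hlt
    obtain ⟨t, hst, ht⟩ := exists_encard_pointsAbove_eq hZ s y (r - 1 - n)
    have ht' : (pointsAbove Z t y).encard = ((r - 1 : ℕ) : ℕ∞) := by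
      rw [ht, ← hn]
      norm_cast
      omega
    refine ⟨t, (hZ.pos _ hs).trans_le hst, extremalProcess_eq hT hTw hZ hN ?_ ?_⟩
    · rw [ht']
      exact_mod_cast (by omega : r - 1 < r)
    · have hsub : insert (s, y) (pointsAbove Z t y) ⊆ {p ∈ Z | p.1 ≤ t ∧ y ≤ p.2} := by
        rintro p (rfl | ⟨h1, h2, h3⟩)
        · exact ⟨hs, hst, le_rfl⟩
        · exact ⟨h1, h2, h3.le⟩
      refine le_trans ?_ (encard_le_encard hsub)
      rw [encard_insert_of_notMem fun h => lt_irrefl _ h.2.2, ht']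
      exact_mod_cast (by omega : r ≤ r - 1 + 1)

/-! ### Discretization of time -/

/-- The dyadic time slot `[j / 2^L, (j + 1) / 2^L)`. -/
def timeSlot (L j : ℕ) : Set ℝ := Ico ((j : ℝ) / 2 ^ L) (((j : ℝ) + 1) / 2 ^ L)

theorem mem_timeSlot_iff {L j : ℕ} {s : ℝ} (hs : 0 ≤ s) : s ∈ timeSlot L j ↔ ⌊s * 2 ^ L⌋₊ = j := by
  have h : (0 : ℝ) < 2 ^ L := by positivity
  rw [timeSlot, mem_Ico, div_le_iff₀ h, lt_div_iff₀ h, Nat.floor_eq_iff (by positivity)]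

theorem coe_hitCount {Ω : Type*} (A : ℕ → Set Ω) (j : ℕ) (ω : Ω) :
    (hitCount A j ω : ℕ∞) = {i | i < j ∧ ω ∈ A i}.encard := by
  classical
  rw [hitCount_eq_card A j ω (J := (Finset.range j).filter fun i => ω ∈ A i) (by simp),
    ← encard_coe_eq_coe_finsetCard]
  congr 1
  ext i
  simp

/-- On a regular configuration, whether there are record levels in `(y, y']` can be read off
the occupied time slots, once these are short enough. -/
theorem eventually_mem_firstHitsSubset_iff {Ω : Type*} {ω : Ω} {A B : ℕ → ℕ → Set Ω}
    (hZ : IsRegularConfig Z) {y y' : ℝ}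
    (hA : ∀ L j, ω ∈ A L j ↔ ∃ p ∈ Z, p.1 ∈ timeSlot L j ∧ y < p.2)
    (hB : ∀ L j, ω ∈ B L j ↔ ∃ p ∈ Z, p.1 ∈ timeSlot L j ∧ y' < p.2) :
    ∀ᶠ L in atTop, (ω ∈ firstHitsSubset (A L) (B L) r ↔
      Disjoint (recordLevels Z r) (Ioc y y')) := by
  -- After time `t` there are `r` points above `y`, so later points cannot matter. The margin of 2
  -- in the horizon `t + 2` exceeds the length of a slot, so that points sharing a slot with a point
  -- before `t` are still covered.
  obtain ⟨t, ht⟩ := exists_le_encard_pointsAbove hZ y r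
  have hF := hZ.finite_above (t + 2) y
  have hp : Tendsto (fun L : ℕ => (2 ^ L : ℝ)⁻¹) atTop (𝓝 0) :=
    tendsto_inv_atTop_zero.comp (tendsto_pow_atTop_atTop_of_one_lt (one_lt_two (α := ℝ)))
  -- Short slots separate the finitely many points above `y` until the horizon; occupied slots can
  -- then be counted in place of points.
  have hsep : ∀ᶠ L : ℕ in atTop, ∀ p ∈ pointsAbove Z (t + 2) y, ∀ q ∈ pointsAbove Z (t + 2) y,
      p ≠ q → (2 ^ L : ℝ)⁻¹ < |p.1 - q.1| := by
    refine (hF.eventually_all).2 fun p hp' => (hF.eventually_all).2 fun q hq' =>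
      eventually_imp_distrib_left.2 fun hne => hp.eventually_lt_const (abs_pos.2 ?_)
    exact sub_ne_zero.2 fun h => hne (hZ.injOn_fst hp'.1 hq'.1 h)
  filter_upwards [hsep, hp.eventually_lt_const one_pos] with L hL hL1
  rw [disjoint_recordLevels_Ioc hZ]
  have h2 : (0 : ℝ) < 2 ^ L := by positivity
  set idx : ℝ × ℝ → ℕ := fun p => ⌊p.1 * 2 ^ L⌋₊ with hidx
  have hslot : ∀ p ∈ Z, ∀ j, p.1 ∈ timeSlot L j ↔ idx p = j := fun p hp j =>
    mem_timeSlot_iff (hZ.pos p hp).le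
  have hnear : ∀ p ∈ Z, ∀ q ∈ Z, idx p = idx q → |p.1 - q.1| < (2 ^ L)⁻¹ := by
    intro p hp q hq he
    have h1 := (hslot p hp _).2 rfl
    have h2 := (hslot q hq _).2 rfl
    rw [← he] at h2
    rw [timeSlot, mem_Ico, add_div, one_div] at h1 h2
    rw [abs_lt]
    constructor <;> linarith [h1.1, h1.2, h2.1, h2.2]
  have hmono : ∀ p q : ℝ × ℝ, p.1 ≤ q.1 → idx p ≤ idx q := fun p q h =>
    Nat.floor_le_floor (by gcongr)
  have hinj : InjOn idx (pointsAbove Z (t + 2) y) := by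
    intro p hp q hq he
    by_contra hne
    exact lt_asymm (hnear p hp.1 q hq.1 he) (hL p hp q hq hne)
  have hcount : ∀ p ∈ pointsAbove Z (t + 2) y,
      (hitCount (A L) (idx p) ω : ℕ∞) = (pointsBefore Z p.1 y).encard := by
    intro p hp
    have hsub : pointsBefore Z p.1 y ⊆ pointsAbove Z (t + 2) y := fun q hq =>
      ⟨hq.1, hq.2.1.le.trans hp.2.1, hq.2.2⟩
    rw [coe_hitCount, ← (hinj.mono hsub).encard_image]
    congr 1
    ext i
    simp only [mem_ofPred_eq, hA, mem_image]
    constructor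
    · rintro ⟨hi, q, hq, hqi, hqy⟩
      rw [hslot q hq] at hqi
      refine ⟨q, ⟨hq, ?_, hqy⟩, hqi⟩
      by_contra hle
      have := hmono p q (not_lt.1 hle)
      omega
    · rintro ⟨q, hq, rfl⟩
      refine ⟨lt_of_le_of_ne (hmono q p hq.2.1.le) fun he => ?_, q, hq.1, (hslot q hq.1 _).2 rfl,
        hq.2.2⟩
      have := hinj (hsub hq) hp he
      rw [this] at hq
      exact lt_irrefl _ hq.2.1
  constructor
  · intro hE p hp h1 h2
    by_contra hlt
    have hpt : p.1 ≤ t := by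
      by_contra hpt
      refine hlt (ht.trans (encard_le_encard fun q hq => ⟨hq.1, ?_, hq.2.2⟩))
      exact hq.2.1.trans_lt (not_le.1 hpt)
    have hpF : p ∈ pointsAbove Z (t + 2) y := ⟨hp, by linarith, h1⟩
    have hBp : ω ∈ B L (idx p) := by
      refine hE _ ((hA _ _).2 ⟨p, hp, (hslot p hp _).2 rfl, h1⟩) ?_
      have := hcount p hpF
      rw [← this] at hlt
      exact_mod_cast not_le.1 hlt
    obtain ⟨q, hq, hqp, hqy⟩ := (hB _ _).1 hBp
    rw [hslot q hq] at hqp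
    have hqF : q ∈ pointsAbove Z (t + 2) y := by
      have := (abs_lt.1 (hnear q hq p hp hqp)).2
      exact ⟨hq, by linarith, h1.trans (h2.trans_lt hqy)⟩
    rw [hinj hqF hpF hqp] at hqy
    exact not_lt.2 h2 hqy
  · intro h j hj hc
    obtain ⟨p, hp, hpj, hpy⟩ := (hA _ _).1 hj
    rw [hslot p hp] at hpj
    have hpF : p ∈ pointsAbove Z (t + 2) y := by
      refine ⟨hp, ?_, hpy⟩
      by_contra hpt
      have hsub : pointsAbove Z t y ⊆ pointsAbove Z (t + 2) y :=
        pointsAbove_mono (by linarith) le_rfl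
      have : (r : ℕ∞) ≤ hitCount (A L) j ω := by
        refine ht.trans ?_
        rw [coe_hitCount, ← (hinj.mono hsub).encard_image]
        refine encard_le_encard ?_
        rintro _ ⟨q, hq, rfl⟩
        refine ⟨lt_of_le_of_ne (hpj ▸ hmono q p ?_) fun he => ?_,
          (hA _ _).2 ⟨q, hq.1, (hslot q hq.1 _).2 rfl, hq.2.2⟩⟩
        · linarith [hq.2.1, not_le.1 hpt]
        · have := (abs_lt.1 (hnear q hq.1 p hp (he.trans hpj.symm))).1
          linarith [hq.2.1, not_le.1 hpt]
      have : r ≤ hitCount (A L) j ω := by exact_mod_cast this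
      omega
    by_contra hBj
    have hpy' : p.2 ≤ y' := by
      by_contra hlt
      exact hBj ((hB _ _).2 ⟨p, hp, (hslot p hp _).2 hpj, not_le.1 hlt⟩)
    have := h p hp hpy hpy'
    rw [← hcount p hpF, hpj] at this
    have : r ≤ hitCount (A L) j ω := by exact_mod_cast this
    omega


/-! ### The level scale -/

section Scale

variable {Pi : Measure ℝ} {xl xr : EReal}

/-- The level scale `x ↦ S(x) - S(0) = log (Q(0) / Q(x))`. -/
noncomputable def levelScale (Pi : Measure ℝ) (xl xr : EReal) (x : ℝ) : ℝ :=
  logTail Pi xl xr x - logTail Pi xl xr 0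

/-- The tail mass `Q(x)` as a real number. -/
noncomputable def tailMass (Pi : Measure ℝ) (xl xr : EReal) (x : ℝ) : ℝ :=
  (Pi (Ioi x ∩ window xl xr)).toReal

theorem tailMass_pos (h : IsJumpIntensity Pi xl xr) {x : ℝ} (hx : x ∈ window xl xr) :
    0 < tailMass Pi xl xr x :=
  ENNReal.toReal_pos (h.tail_pos x hx).ne' (h.tail_lt_top x hx).ne

theorem exp_neg_levelScale (h : IsJumpIntensity Pi xl xr) (h0 : (0 : ℝ) ∈ window xl xr) {x : ℝ}
    (hx : x ∈ window xl xr) :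
    tailMass Pi xl xr 0 * Real.exp (-levelScale Pi xl xr x) = tailMass Pi xl xr x := by
  have h1 := tailMass_pos h h0
  have h2 := tailMass_pos h hx
  have : -levelScale Pi xl xr x
      = Real.log (tailMass Pi xl xr x) - Real.log (tailMass Pi xl xr 0) := by
    simp only [levelScale, logTail, tailMass]
    ring
  rw [this, Real.exp_sub, Real.exp_log h1, Real.exp_log h2]
  field_simp

theorem levelScale_mono (h : IsJumpIntensity Pi xl xr) :
    MonotoneOn (levelScale Pi xl xr) (window xl xr) := by
  intro x hx y hy hxy
  exact sub_le_sub_right ((logTailStieltjes h).mono (show (⟨x, hx⟩ : window xl xr) ≤ ⟨y, hy⟩ from hxy)) _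

theorem levelScale_zero : levelScale Pi xl xr 0 = 0 := sub_self _

theorem measurable_levelScale : Measurable (levelScale Pi xl xr) := by
  have : Antitone fun x : ℝ => Pi (Ioi x ∩ window xl xr) := fun x y hxy =>
    measure_mono (inter_subset_inter_left _ (Ioi_subset_Ioi hxy))
  have h1 : Measurable (logTail Pi xl xr) :=
    (Real.measurable_log.comp this.measurable.ennreal_toReal).neg
  exact h1.sub_const _

theorem measure_Ioc_eq (h : IsJumpIntensity Pi xl xr) {a b : ℝ} (ha : a ∈ window xl xr)
    (hb : b ∈ window xl xr) (hab : a ≤ b) :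
    Pi (Ioc a b) = ENNReal.ofReal (tailMass Pi xl xr a - tailMass Pi xl xr b) := by
  have hsub : Ioc a b ⊆ window xl xr := fun x hx =>
    (ordConnected_window xl xr).out ha hb (Ioc_subset_Icc_self hx)
  have hu : Ioi a ∩ window xl xr = Ioc a b ∪ (Ioi b ∩ window xl xr) := by
    rw [← Ioc_union_Ioi_eq_Ioi hab, union_inter_distrib_right, inter_eq_left.2 hsub]
  have hd : Disjoint (Ioc a b) (Ioi b ∩ window xl xr) :=
    (Ioc_disjoint_Ioi le_rfl).mono_right inter_subset_left
  have hm := measure_union (μ := Pi) hd (measurableSet_Ioi.inter (measurableSet_window xl xr))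
  rw [← hu] at hm
  have hf := (h.tail_lt_top b hb).ne
  rw [tailMass, tailMass, ENNReal.ofReal_sub _ ENNReal.toReal_nonneg,
    ENNReal.ofReal_toReal (h.tail_lt_top a ha).ne, ENNReal.ofReal_toReal hf, hm,
    ENNReal.add_sub_cancel_right hf]

theorem continuousOn_tailMass (h : IsJumpIntensity Pi xl xr) {a b : ℝ} (ha : a ∈ window xl xr)
    (hb : b ∈ window xl xr) : ContinuousOn (tailMass Pi xl xr) (Icc a b) := by
  set ν := Pi.restrict (Ioi a ∩ window xl xr) with hν
  have hfin : IsFiniteMeasure ν := ⟨by rw [hν, Measure.restrict_apply_univ]; exact h.tail_lt_top a ha⟩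
  -- The absence of atoms of Π gives the continuity of Q, hence of the level scale.
  have hna : NullSingletonClass ν := ⟨fun x => nonpos_iff_eq_zero.1
    ((Measure.restrict_apply_le _ _).trans (h.atomless x).le)⟩
  have hcont := intervalIntegral.continuous_primitive (μ := ν) (f := fun _ => (1 : ℝ))
    (fun a b => intervalIntegrable_const) a
  have : ContinuousOn (fun x => tailMass Pi xl xr a - ∫ _ in a..x, (1 : ℝ) ∂ν) (Icc a b) :=
    (continuous_const.sub hcont).continuousOn
  refine this.congr fun x hx => ?_
  have hxw : x ∈ window xl xr := (ordConnected_window xl xr).out ha hb hx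
  have hsub : Ioc a x ⊆ Ioi a ∩ window xl xr := fun z hz =>
    ⟨hz.1, (ordConnected_window xl xr).out ha hxw (Ioc_subset_Icc_self hz)⟩
  have hanti : tailMass Pi xl xr x ≤ tailMass Pi xl xr a :=
    ENNReal.toReal_mono (h.tail_lt_top a ha).ne
      (measure_mono (inter_subset_inter_left _ (Ioi_subset_Ioi hx.1)))
  simp only
  rw [intervalIntegral.integral_of_le hx.1, setIntegral_const, measureReal_def, hν,
    Measure.restrict_apply measurableSet_Ioc, inter_eq_left.2 hsub, measure_Ioc_eq h ha hxw hx.1,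
    ENNReal.toReal_ofReal (sub_nonneg.2 hanti)]
  simp

theorem continuousOn_levelScale (h : IsJumpIntensity Pi xl xr) {a b : ℝ} (ha : a ∈ window xl xr)
    (hb : b ∈ window xl xr) : ContinuousOn (levelScale Pi xl xr) (Icc a b) :=
  (((continuousOn_tailMass h ha hb).log fun _ hx =>
    (tailMass_pos h ((ordConnected_window xl xr).out ha hb hx)).ne').neg).sub continuousOn_const

/-- An exhaustion by real intervals, which treats finite and infinite endpoints of the window alike.
-/
theorem exists_seq_window (h0 : (0 : ℝ) ∈ window xl xr) :
    ∃ a b : ℕ → ℝ, (∀ n, a n ∈ window xl xr) ∧ (∀ n, b n ∈ window xl xr) ∧ Antitone a ∧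
      Monotone b ∧ ∀ x ∈ window xl xr, ∃ n, a n < x ∧ x < b n := by
  have hl : ∃ a : ℕ → ℝ, (∀ n, a n ∈ window xl xr) ∧ Antitone a ∧
      ∀ x ∈ window xl xr, ∃ n, a n < x := by
    obtain ⟨u, hu1, hu2, hu3⟩ := exists_seq_strictAnti_tendsto' h0.1
    have hne : ∀ n, u n ≠ ⊥ ∧ u n ≠ ⊤ := fun n => ⟨(bot_le.trans_lt (hu2 n).1).ne',
      ((hu2 n).2.trans (EReal.coe_lt_top 0)).ne⟩
    have hc : ∀ n, ((u n).toReal : EReal) = u n := fun n => EReal.coe_toReal (hne n).2 (hne n).1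
    refine ⟨fun n => (u n).toReal, fun n => ?_, fun n m hnm => ?_, fun x hx => ?_⟩
    · simp only [window, mem_ofPred_eq, hc]
      exact ⟨(hu2 n).1, (hu2 n).2.trans h0.2⟩
    · rw [← EReal.coe_le_coe_iff, hc, hc]
      exact hu1.antitone hnm
    · obtain ⟨n, hn⟩ := (hu3.eventually_lt_const hx.1).exists
      exact ⟨n, by rw [← EReal.coe_lt_coe_iff, hc]; exact hn⟩
  have hr : ∃ a : ℕ → ℝ, (∀ n, a n ∈ window xl xr) ∧ Monotone a ∧
      ∀ x ∈ window xl xr, ∃ n, x < a n := by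
    obtain ⟨u, hu1, hu2, hu3⟩ := exists_seq_strictMono_tendsto' h0.2
    have hne : ∀ n, u n ≠ ⊥ ∧ u n ≠ ⊤ := fun n => ⟨((EReal.bot_lt_coe 0).trans (hu2 n).1).ne',
      ((hu2 n).2.trans_le le_top).ne⟩
    have hc : ∀ n, ((u n).toReal : EReal) = u n := fun n => EReal.coe_toReal (hne n).2 (hne n).1
    refine ⟨fun n => (u n).toReal, fun n => ?_, fun n m hnm => ?_, fun x hx => ?_⟩
    · simp only [window, mem_ofPred_eq, hc]
      exact ⟨h0.1.trans (hu2 n).1, (hu2 n).2⟩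
    · rw [← EReal.coe_le_coe_iff, hc, hc]
      exact hu1.monotone hnm
    · obtain ⟨n, hn⟩ := (hu3.eventually_const_lt hx.2).exists
      exact ⟨n, by rw [← EReal.coe_lt_coe_iff, hc]; exact hn⟩
  obtain ⟨a, ha1, ha2, ha3⟩ := hl
  obtain ⟨b, hb1, hb2, hb3⟩ := hr
  refine ⟨a, b, ha1, hb1, ha2, hb2, fun x hx => ?_⟩
  obtain ⟨n, hn⟩ := ha3 x hx
  obtain ⟨m, hm⟩ := hb3 x hx
  exact ⟨max n m, (ha2 (le_max_left n m)).trans_lt hn, hm.trans_le (hb2 (le_max_right n m))⟩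

theorem exists_tailMass_gt (h : IsJumpIntensity Pi xl xr) (h0 : (0 : ℝ) ∈ window xl xr) (y : ℝ) :
    ∃ x ∈ window xl xr, y < tailMass Pi xl xr x := by
  obtain ⟨a, b, ha, hb, ham, hbm, hab⟩ := exists_seq_window h0
  have hm : Monotone fun n => Ioi (a n) ∩ window xl xr := fun n m hnm =>
    inter_subset_inter_left _ (Ioi_subset_Ioi (ham hnm))
  have hU : ⋃ n, Ioi (a n) ∩ window xl xr = window xl xr := by
    rw [← iUnion_inter, inter_eq_right]
    exact fun x hx => mem_iUnion.2 ((hab x hx).imp fun n hn => hn.1)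
  have ht := tendsto_measure_iUnion_atTop (μ := Pi) hm
  rw [hU, h.infinite] at ht
  obtain ⟨n, hn⟩ := (ht.eventually_const_lt (ENNReal.ofReal_lt_top (r := y))).exists
  refine ⟨a n, ha n, ?_⟩
  rw [tailMass]
  refine lt_of_not_ge fun hle => absurd hn (not_lt.2 ?_)
  change Pi (Ioi (a n) ∩ window xl xr) ≤ _
  rw [← ENNReal.ofReal_toReal (h.tail_lt_top _ (ha n)).ne]
  exact ENNReal.ofReal_le_ofReal hle

theorem exists_tailMass_lt (h : IsJumpIntensity Pi xl xr) (h0 : (0 : ℝ) ∈ window xl xr) {y : ℝ}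
    (hy : 0 < y) : ∃ x ∈ window xl xr, tailMass Pi xl xr x < y := by
  obtain ⟨a, b, ha, hb, ham, hbm, hab⟩ := exists_seq_window h0
  have hm : Antitone fun n => Ioi (b n) ∩ window xl xr := fun n m hnm =>
    inter_subset_inter_left _ (Ioi_subset_Ioi (hbm hnm))
  have hU : ⋂ n, Ioi (b n) ∩ window xl xr = ∅ := by
    rw [eq_empty_iff_forall_notMem]
    intro x hx
    obtain ⟨n, hn⟩ := hab x (mem_iInter.1 hx 0).2
    exact lt_asymm hn.2 (mem_iInter.1 hx n).1
  have ht := tendsto_measure_iInter_atTop (μ := Pi)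
    (fun n => (measurableSet_Ioi.inter (measurableSet_window xl xr)).nullMeasurableSet) hm
    ⟨0, (h.tail_lt_top _ (hb 0)).ne⟩
  rw [hU, measure_empty] at ht
  obtain ⟨n, hn⟩ := (ht.eventually_lt_const (ENNReal.ofReal_pos.2 hy)).exists
  refine ⟨b n, hb n, ?_⟩
  rw [tailMass, ← ENNReal.lt_ofReal_iff_toReal_lt (h.tail_lt_top _ (hb n)).ne]
  exact hn

/-- The level scale is continuous and takes every real value, because Q runs from ∞ to 0. It may be
constant on gaps of Π, so the least preimage of `y` is chosen; leastness yields the equivalence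
`levelQuantile_le_iff`. -/
theorem exists_levelQuantile (h : IsJumpIntensity Pi xl xr) (h0 : (0 : ℝ) ∈ window xl xr) (y : ℝ) :
    ∃ m ∈ window xl xr, levelScale Pi xl xr m = y ∧
      ∀ x ∈ window xl xr, y ≤ levelScale Pi xl xr x → m ≤ x := by
  have hc := tailMass_pos h h0
  have hiff : ∀ x ∈ window xl xr, (levelScale Pi xl xr x < y ↔
      tailMass Pi xl xr 0 * Real.exp (-y) < tailMass Pi xl xr x) := by
    intro x hx
    rw [← exp_neg_levelScale h h0 hx, mul_lt_mul_iff_right₀ hc, Real.exp_lt_exp, neg_lt_neg_iff]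
  have hiff' : ∀ x ∈ window xl xr, (y < levelScale Pi xl xr x ↔
      tailMass Pi xl xr x < tailMass Pi xl xr 0 * Real.exp (-y)) := by
    intro x hx
    rw [← exp_neg_levelScale h h0 hx, mul_lt_mul_iff_right₀ hc, Real.exp_lt_exp, neg_lt_neg_iff]
  obtain ⟨a, ha, hay⟩ := exists_tailMass_gt h h0 (tailMass Pi xl xr 0 * Real.exp (-y))
  obtain ⟨b, hb, hby⟩ := exists_tailMass_lt h h0 (mul_pos hc (Real.exp_pos (-y)))
  rw [← hiff a ha] at hay
  rw [← hiff' b hb] at hby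
  have hab : a ≤ b := by
    by_contra hlt
    linarith [levelScale_mono h hb ha (not_le.1 hlt).le]
  have hcont := continuousOn_levelScale h ha hb
  obtain ⟨z, hz, hzy⟩ := intermediate_value_Icc hab hcont ⟨hay.le, hby.le⟩
  have hcl : IsClosed (Icc a b ∩ levelScale Pi xl xr ⁻¹' Ici y) :=
    hcont.preimage_isClosed_of_isClosed isClosed_Icc isClosed_Ici
  have hK : IsCompact (Icc a b ∩ levelScale Pi xl xr ⁻¹' Ici y) :=
    isCompact_Icc.of_isClosed_subset hcl inter_subset_left
  obtain ⟨m, hm, hmin⟩ := hK.exists_isLeast ⟨z, hz, hzy.ge⟩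
  have hmw : m ∈ window xl xr := (ordConnected_window xl xr).out ha hb hm.1
  refine ⟨m, hmw, le_antisymm ?_ hm.2, fun x hx hyx => ?_⟩
  · rw [← hzy]
    exact levelScale_mono h hmw ((ordConnected_window xl xr).out ha hb hz) (hmin ⟨hz, hzy.ge⟩)
  · rcases le_total x b with hxb | hbx
    · refine hmin ⟨⟨?_, hxb⟩, hyx⟩
      by_contra hlt
      linarith [levelScale_mono h hx ha (not_le.1 hlt).le]
    · exact hm.1.2.trans hbx

/-- The generalized inverse of the level scale. -/
noncomputable def levelQuantile (h : IsJumpIntensity Pi xl xr) (h0 : (0 : ℝ) ∈ window xl xr)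
    (y : ℝ) : ℝ := (exists_levelQuantile h h0 y).choose

variable (h : IsJumpIntensity Pi xl xr) (h0 : (0 : ℝ) ∈ window xl xr)

theorem levelQuantile_mem (y : ℝ) : levelQuantile h h0 y ∈ window xl xr :=
  (exists_levelQuantile h h0 y).choose_spec.1

theorem preimage_levelQuantile_window : levelQuantile h h0 ⁻¹' window xl xr = univ :=
  eq_univ_of_forall fun y => levelQuantile_mem h h0 y

theorem levelScale_levelQuantile (y : ℝ) : levelScale Pi xl xr (levelQuantile h h0 y) = y :=
  (exists_levelQuantile h h0 y).choose_spec.2.1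

theorem levelQuantile_le_iff {x y : ℝ} (hx : x ∈ window xl xr) :
    levelQuantile h h0 y ≤ x ↔ y ≤ levelScale Pi xl xr x := by
  refine ⟨fun hle => ?_, (exists_levelQuantile h h0 y).choose_spec.2.2 x hx⟩
  rw [← levelScale_levelQuantile h h0 y]
  exact levelScale_mono h (levelQuantile_mem h h0 y) hx hle

theorem strictMono_levelQuantile : StrictMono (levelQuantile h h0) := by
  intro y y' hyy
  by_contra hle
  have := levelScale_mono h (levelQuantile_mem h h0 y') (levelQuantile_mem h h0 y) (not_lt.1 hle)
  rw [levelScale_levelQuantile, levelScale_levelQuantile] at this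
  linarith

theorem measurable_levelQuantile : Measurable (levelQuantile h h0) :=
  (strictMono_levelQuantile h h0).monotone.measurable

theorem levelQuantile_pos_iff {y : ℝ} : 0 < levelQuantile h h0 y ↔ 0 < y := by
  rw [← not_le, levelQuantile_le_iff h h0 h0, levelScale_zero, not_le]

/-- Unlike `levelQuantile_pos_iff` this is only an implication: if Π has no mass just to the left of
0, the quantile of level 0 is negative too. The level 0 is therefore excluded almost surely further
on. -/
theorem levelQuantile_neg {y : ℝ} (hy : y < 0) : levelQuantile h h0 y < 0 := by
  refine ((strictMono_levelQuantile h h0) hy).trans_le ?_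
  rw [levelQuantile_le_iff h h0 h0, levelScale_zero]

theorem preimage_levelQuantile_Ioc {a b : ℝ} (ha : a ∈ window xl xr) (hb : b ∈ window xl xr) :
    levelQuantile h h0 ⁻¹' Ioc a b = Ioc (levelScale Pi xl xr a) (levelScale Pi xl xr b) := by
  ext y
  rw [mem_preimage, mem_Ioc, mem_Ioc, levelQuantile_le_iff h h0 hb, ← not_le,
    levelQuantile_le_iff h h0 ha, not_le]

theorem measure_ext_window {μ ν : Measure ℝ} (h0 : (0 : ℝ) ∈ window xl xr)
    (hμ : μ (window xl xr)ᶜ = 0) (hν : ν (window xl xr)ᶜ = 0)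
    (hfin : ∀ a ∈ window xl xr, ∀ b ∈ window xl xr, a < b → μ (Ioc a b) ≠ ∞)
    (heq : ∀ a ∈ window xl xr, ∀ b ∈ window xl xr, a < b → μ (Ioc a b) = ν (Ioc a b)) :
    μ = ν := by
  obtain ⟨a, b, ha, hb, ham, hbm, hab⟩ := exists_seq_window h0
  have hres : ∀ n, μ.restrict (Ioc (a n) (b n)) = ν.restrict (Ioc (a n) (b n)) := by
    intro n
    have hfinite : IsFiniteMeasure (μ.restrict (Ioc (a n) (b n))) := by
      refine ⟨?_⟩
      rw [Measure.restrict_apply_univ]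
      rcases lt_or_ge (a n) (b n) with hlt | hle
      · exact (hfin _ (ha n) _ (hb n) hlt).lt_top
      · simp [Ioc_eq_empty (not_lt.2 hle)]
    refine Measure.ext_of_Ioc _ _ fun c d hcd => ?_
    rw [Measure.restrict_apply measurableSet_Ioc, Measure.restrict_apply measurableSet_Ioc,
      Ioc_inter_Ioc]
    rcases lt_or_ge (c ⊔ a n) (d ⊓ b n) with hlt | hle
    · have h1 : c ⊔ a n ∈ window xl xr := (ordConnected_window xl xr).out (ha n) (hb n)
        ⟨le_sup_right, hlt.le.trans inf_le_right⟩
      have h2 : d ⊓ b n ∈ window xl xr := (ordConnected_window xl xr).out (ha n) (hb n)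
        ⟨le_sup_right.trans hlt.le, inf_le_right⟩
      exact heq _ h1 _ h2 hlt
    · rw [Ioc_eq_empty (not_lt.2 hle), measure_empty, measure_empty]
  have hm : Monotone fun n => Ioc (a n) (b n) := fun n m hnm =>
    Ioc_subset_Ioc (ham hnm) (hbm hnm)
  have hW : window xl xr ⊆ ⋃ n, Ioc (a n) (b n) := fun x hx =>
    mem_iUnion.2 ((hab x hx).imp fun n hn => ⟨hn.1, hn.2.le⟩)
  have hsup : ∀ κ : Measure ℝ, κ (window xl xr)ᶜ = 0 → ∀ B, MeasurableSet B →
      κ B = ⨆ n, κ.restrict (Ioc (a n) (b n)) B := by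
    intro κ hκ B hB
    have hmB : Monotone fun n => B ∩ Ioc (a n) (b n) := fun n m hnm =>
      inter_subset_inter_right _ (hm hnm)
    simp only [Measure.restrict_apply hB]
    rw [← hmB.measure_iUnion, ← inter_iUnion]
    refine (measure_inter_conull' (measure_mono_null (fun x hx => ?_) hκ)).symm
    exact fun hxw => hx.2 (hW hxw)
  ext B hB
  rw [hsup μ hμ B hB, hsup ν hν B hB]
  simp only [hres]

/-- The intensity on the level scale: `e^{-y} dy` up to a constant. -/
noncomputable def expIntensity (c : ℝ) : Measure ℝ :=
  volume.withDensity fun y => ENNReal.ofReal (c * Real.exp (-y))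

theorem expIntensity_Ioi {c : ℝ} (hc : 0 ≤ c) (y : ℝ) :
    expIntensity c (Ioi y) = ENNReal.ofReal (c * Real.exp (-y)) := by
  rw [expIntensity, withDensity_apply _ measurableSet_Ioi, ← ofReal_integral_eq_lintegral_ofReal]
  · rw [integral_const_mul, integral_exp_neg_Ioi]
  · exact (integrableOn_exp_neg_Ioi y).const_mul c
  · exact ae_of_all _ fun x => by positivity

theorem expIntensity_Ioc {c : ℝ} (hc : 0 ≤ c) {y y' : ℝ} (hyy : y ≤ y') :
    expIntensity c (Ioc y y')
      = ENNReal.ofReal (c * Real.exp (-y) - c * Real.exp (-y')) := by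
  have hm := measure_union (μ := expIntensity c) (Ioc_disjoint_Ioi (a := y) (le_refl y'))
    measurableSet_Ioi
  rw [Ioc_union_Ioi_eq_Ioi hyy, expIntensity_Ioi hc, expIntensity_Ioi hc] at hm
  rw [ENNReal.ofReal_sub _ (by positivity), hm, ENNReal.add_sub_cancel_right ENNReal.ofReal_ne_top]

theorem expIntensity_univ {c : ℝ} (hc : 0 < c) : expIntensity c univ = ∞ := by
  refine ENNReal.eq_top_of_forall_nnreal_le fun q => ?_
  obtain ⟨y, hy⟩ : ∃ y, (q : ℝ) ≤ c * Real.exp (-y) := by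
    refine ⟨-((q : ℝ) / c), ?_⟩
    rw [neg_neg]
    have := Real.add_one_le_exp ((q : ℝ) / c)
    calc (q : ℝ) = c * (q / c) := by field_simp
      _ ≤ c * Real.exp (q / c) := by gcongr; linarith
  calc (q : ℝ≥0∞) = ENNReal.ofReal q := by simp
    _ ≤ ENNReal.ofReal (c * Real.exp (-y)) := ENNReal.ofReal_le_ofReal hy
    _ = expIntensity c (Ioi y) := (expIntensity_Ioi hc.le y).symm
    _ ≤ _ := measure_mono (subset_univ _)

/-- Together with `map_volume_levelQuantile` this reduces the general intensity to the exponential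
one: the same map carries e^{-y} dy to Π and Lebesgue measure to S. -/
theorem map_expIntensity_levelQuantile :
    (expIntensity (tailMass Pi xl xr 0)).map (levelQuantile h h0) = Pi := by
  have hT := measurable_levelQuantile h h0
  have hIoc : ∀ a ∈ window xl xr, ∀ b ∈ window xl xr, a < b →
      (expIntensity (tailMass Pi xl xr 0)).map (levelQuantile h h0) (Ioc a b) = Pi (Ioc a b) := by
    intro a ha b hb hab
    rw [Measure.map_apply hT measurableSet_Ioc, preimage_levelQuantile_Ioc h h0 ha hb,
      expIntensity_Ioc (tailMass_pos h h0).le (levelScale_mono h ha hb hab.le),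
      exp_neg_levelScale h h0 ha, exp_neg_levelScale h h0 hb, measure_Ioc_eq h ha hb hab.le]
  refine measure_ext_window h0 ?_ h.concentrated (fun a ha b hb hab => ?_) hIoc
  · rw [Measure.map_apply hT (measurableSet_window xl xr).compl, preimage_compl,
      preimage_levelQuantile_window, compl_univ, measure_empty]
  · rw [hIoc a ha b hb hab, measure_Ioc_eq h ha hb hab.le]
    exact ENNReal.ofReal_ne_top

theorem map_volume_levelQuantile : volume.map (levelQuantile h h0) = recordMeasure h := by
  have hT := measurable_levelQuantile h h0
  have hIoc : ∀ a ∈ window xl xr, ∀ b ∈ window xl xr, a < b →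
      volume.map (levelQuantile h h0) (Ioc a b) = recordMeasure h (Ioc a b) := by
    intro a ha b hb hab
    rw [Measure.map_apply hT measurableSet_Ioc, preimage_levelQuantile_Ioc h h0 ha hb,
      recordMeasure_Ioc h ha hb, Real.volume_Ioc, levelScale, levelScale, sub_sub_sub_cancel_right]
  refine measure_ext_window h0 ?_ (recordMeasure_compl h) (fun a ha b hb hab => ?_) hIoc
  · rw [Measure.map_apply hT (measurableSet_window xl xr).compl, preimage_compl,
      preimage_levelQuantile_window, compl_univ, measure_empty]
  · rw [hIoc a ha b hb hab, recordMeasure_Ioc h ha hb]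
    exact ENNReal.ofReal_ne_top

end Scale


/-! ### Point measures -/

theorem pointMeasure_apply (A : Set ℝ) {B : Set ℝ} (hB : MeasurableSet B) :
    pointMeasure A B = ((A ∩ B).encard : ℝ≥0∞) := by
  rw [pointMeasure, Measure.sum_apply _ hB, ← ENNReal.tsum_set_one,
    tsum_subtype (A ∩ B) fun _ => (1 : ℝ≥0∞), tsum_subtype A fun x => Measure.dirac x B]
  congr 1
  ext x
  by_cases h1 : x ∈ A <;> by_cases h2 : x ∈ B <;> simp [h1, h2, indicator]

theorem pointMeasure_apply_eq_zero (A : Set ℝ) {B : Set ℝ} (hB : MeasurableSet B) :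
    pointMeasure A B = 0 ↔ Disjoint A B := by
  rw [pointMeasure_apply A hB, disjoint_iff_inter_eq_empty]
  simp

theorem pointMeasure_restrict (A : Set ℝ) {D : Set ℝ} (hD : MeasurableSet D) :
    (pointMeasure A).restrict D = pointMeasure (A ∩ D) := by
  ext B hB
  rw [Measure.restrict_apply hB, pointMeasure_apply _ (hB.inter hD), pointMeasure_apply _ hB,
    inter_assoc, inter_comm D]

theorem pointMeasure_map {A : Set ℝ} {g : ℝ → ℝ} (hg : Measurable g) (hi : InjOn g A) :
    (pointMeasure A).map g = pointMeasure (g '' A) := by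
  ext B hB
  rw [Measure.map_apply hg hB, pointMeasure_apply _ (hg hB), pointMeasure_apply _ hB,
    ← image_inter_preimage, (hi.mono inter_subset_left).encard_image]

theorem sum_dirac_eq_pointMeasure {ι : Type*} {z : ι → ℝ} (hz : Function.Injective z) :
    (Measure.sum fun k => Measure.dirac (z k)) = pointMeasure (range z) := by
  ext B hB
  rw [pointMeasure, Measure.sum_apply _ hB, Measure.sum_apply _ hB,
    ← (Equiv.ofInjective z hz).tsum_eq]
  rfl

theorem exists_sum_dirac_eq_pointMeasure {A : Set ℝ} (hA : A.Countable) :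
    ∃ (I : Set ℕ) (z : I → ℝ), pointMeasure A = Measure.sum fun k : I => Measure.dirac (z k) :=
  have := hA.to_subtype
  exists_sum_dirac_eq _

/-! ### Dyadic cells -/

/-- The dyadic interval `(k / 2^m, (k + 1) / 2^m]`. -/
def dyadicCell (m : ℕ) (k : ℤ) : Set ℝ := Ioc ((k : ℝ) / 2 ^ m) (((k : ℝ) + 1) / 2 ^ m)

/-- A finite union of dyadic intervals of the same length. -/
def dyadicUnion (m : ℕ) (I : Finset ℤ) : Set ℝ := ⋃ k ∈ I, dyadicCell m k

theorem measurableSet_dyadicCell (m : ℕ) (k : ℤ) : MeasurableSet (dyadicCell m k) :=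
  measurableSet_Ioc

theorem measurableSet_dyadicUnion (m : ℕ) (I : Finset ℤ) : MeasurableSet (dyadicUnion m I) :=
  Finset.measurableSet_biUnion _ fun k _ => measurableSet_dyadicCell m k

theorem mem_dyadicCell_iff {m : ℕ} {k : ℤ} {x : ℝ} :
    x ∈ dyadicCell m k ↔ ⌈x * 2 ^ m⌉ = k + 1 := by
  have h : (0 : ℝ) < 2 ^ m := by positivity
  rw [dyadicCell, mem_Ioc, div_lt_iff₀ h, le_div_iff₀ h, Int.ceil_eq_iff]
  push_cast
  rw [add_sub_cancel_right]

theorem mem_dyadicCell_ceil (m : ℕ) (x : ℝ) : x ∈ dyadicCell m (⌈x * 2 ^ m⌉ - 1) :=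
  mem_dyadicCell_iff.2 (by ring)

theorem pairwise_disjoint_dyadicCell (m : ℕ) :
    Pairwise fun k l => Disjoint (dyadicCell m k) (dyadicCell m l) := by
  intro k l hkl
  refine Set.disjoint_left.2 fun x hx hx' => hkl ?_
  have := (mem_dyadicCell_iff.1 hx).symm.trans (mem_dyadicCell_iff.1 hx')
  omega

theorem volume_dyadicCell (m : ℕ) (k : ℤ) : volume (dyadicCell m k) = (2 ^ m)⁻¹ := by
  rw [dyadicCell, Real.volume_Ioc, ← sub_div, add_sub_cancel_left, one_div, ENNReal.ofReal_inv_of_pos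
    (by positivity), ENNReal.ofReal_pow (by norm_num)]
  norm_num

theorem volume_dyadicUnion (m : ℕ) (I : Finset ℤ) :
    volume (dyadicUnion m I) = I.card * (2 ^ m)⁻¹ := by
  rw [dyadicUnion, measure_biUnion_finset (fun k _ l _ h => pairwise_disjoint_dyadicCell m h)
    fun k _ => measurableSet_dyadicCell m k]
  simp [volume_dyadicCell]

theorem dyadicCell_succ (m : ℕ) (k : ℤ) :
    dyadicCell m k = dyadicCell (m + 1) (2 * k) ∪ dyadicCell (m + 1) (2 * k + 1) := by
  have h : (0 : ℝ) < 2 ^ m := by positivity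
  have e1 : ((2 * k : ℤ) : ℝ) / 2 ^ (m + 1) = k / 2 ^ m := by
    rw [pow_succ]; push_cast; field_simp
  have e2 : (((2 * k + 1 : ℤ) : ℝ) + 1) / 2 ^ (m + 1) = (k + 1) / 2 ^ m := by
    rw [pow_succ]; push_cast; field_simp; ring
  have e3 : (((2 * k : ℤ) : ℝ) + 1) / 2 ^ (m + 1) = ((2 * k + 1 : ℤ) : ℝ) / 2 ^ (m + 1) := by
    push_cast; ring
  rw [dyadicCell, dyadicCell, dyadicCell, e1, e2, e3, Ioc_union_Ioc_eq_Ioc]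
  · rw [← e1]; gcongr; omega
  · rw [← e2]; gcongr; linarith

theorem dyadicUnion_succ (m : ℕ) (I : Finset ℤ) :
    ∃ I', dyadicUnion m I = dyadicUnion (m + 1) I' := by
  classical
  refine ⟨I.image (fun k => 2 * k) ∪ I.image (fun k => 2 * k + 1), ?_⟩
  simp only [dyadicUnion, Finset.set_biUnion_union, Finset.set_biUnion_finset_image,
    dyadicCell_succ m, iUnion_union_distrib]

theorem dyadicUnion_of_le {m m' : ℕ} (h : m ≤ m') (I : Finset ℤ) :
    ∃ I', dyadicUnion m I = dyadicUnion m' I' := by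
  induction m', h using Nat.le_induction with
  | base => exact ⟨I, rfl⟩
  | succ n _ ih =>
    obtain ⟨I', h'⟩ := ih
    rw [h']
    exact dyadicUnion_succ n I'

/-! ### Locally finite random sets -/

/-- Locally finite subsets of the line. -/
structure LocFinSet where
  /-- The underlying set. -/
  carrier : Set ℝ
  /-- Bounded intervals contain finitely many points. -/
  finite_inter_Icc : ∀ a b, (carrier ∩ Icc a b).Finite

namespace LocFinSet

/-- The event that a locally finite set does not meet `B`. -/
def avoid (B : Set ℝ) : Set LocFinSet := {A | Disjoint A.1 B}

/-- The generating avoidance events. -/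
def avoidEvents : Set (Set LocFinSet) := {s | ∃ m I, s = avoid (dyadicUnion m I)}

instance : MeasurableSpace LocFinSet := MeasurableSpace.generateFrom avoidEvents

theorem countable_avoidEvents : avoidEvents.Countable := by
  have : avoidEvents = range fun p : ℕ × Finset ℤ => avoid (dyadicUnion p.1 p.2) := by
    ext s
    simp [avoidEvents, eq_comm]
  rw [this]
  exact countable_range _

instance : MeasurableSpace.CountablyGenerated LocFinSet := ⟨⟨_, countable_avoidEvents, rfl⟩⟩

/-- Two dyadic unions can be written on a common grid, and avoiding both is avoiding their union. -/
theorem isPiSystem_avoidEvents : IsPiSystem avoidEvents := by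
  classical
  rintro _ ⟨m, I, rfl⟩ _ ⟨m', I', rfl⟩ _
  obtain ⟨J, hJ⟩ := dyadicUnion_of_le (le_max_left m m') I
  obtain ⟨J', hJ'⟩ := dyadicUnion_of_le (le_max_right m m') I'
  refine ⟨max m m', J ∪ J', ?_⟩
  rw [hJ, hJ']
  ext A
  simp only [avoid, mem_inter_iff, mem_ofPred_eq, dyadicUnion, Finset.set_biUnion_union,
    disjoint_union_right]

theorem measurableSet_avoid (m : ℕ) (I : Finset ℤ) : MeasurableSet (avoid (dyadicUnion m I)) :=
  MeasurableSpace.measurableSet_generateFrom ⟨m, I, rfl⟩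

theorem measurableSet_avoid_cell (m : ℕ) (k : ℤ) : MeasurableSet (avoid (dyadicCell m k)) := by
  simpa [dyadicUnion] using measurableSet_avoid m {k}

/-- The law of a locally finite random set is determined by the avoidance probabilities. -/
theorem map_eq_of_avoid {Ω Ω' : Type*} [MeasurableSpace Ω] [MeasurableSpace Ω'] {P : Measure Ω}
    {P' : Measure Ω'} [IsProbabilityMeasure P] [IsProbabilityMeasure P'] {X : Ω → LocFinSet}
    {X' : Ω' → LocFinSet} (hX : AEMeasurable X P) (hX' : AEMeasurable X' P')
    (h : ∀ m I, P {ω | Disjoint (X ω).1 (dyadicUnion m I)}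
      = P' {ω | Disjoint (X' ω).1 (dyadicUnion m I)}) : P.map X = P'.map X' := by
  have := Measure.isProbabilityMeasure_map hX
  have := Measure.isProbabilityMeasure_map hX'
  refine ext_of_generate_finite avoidEvents rfl isPiSystem_avoidEvents ?_ (by simp)
  rintro _ ⟨m, I, rfl⟩
  rw [Measure.map_apply_of_aemeasurable hX (measurableSet_avoid m I),
    Measure.map_apply_of_aemeasurable hX' (measurableSet_avoid m I)]
  exact h m I

/-- The σ-algebra on `LocFinSet` is countably generated, so measurability up to null sets of the
generating events gives a measurable modification. -/
theorem aemeasurable_of_avoid {Ω : Type*} [MeasurableSpace Ω] {P : Measure Ω} {X : Ω → LocFinSet}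
    (h : ∀ m I, NullMeasurableSet {ω | Disjoint (X ω).1 (dyadicUnion m I)} P) :
    AEMeasurable X P := by
  refine NullMeasurable.aemeasurable ?_
  refine @measurable_generateFrom (NullMeasurableSpace Ω P) LocFinSet _ avoidEvents X ?_
  rintro _ ⟨m, I, rfl⟩
  exact h m I

/-- The counting measure of an open set in terms of the dyadic intervals inside it. -/
theorem pointMeasure_eq_iSup (A : LocFinSet) {U : Set ℝ} (hU : IsOpen U)
    (hb : Bornology.IsBounded U) :
    pointMeasure A.1 U = ⨆ L : ℕ, ∑' k : ℤ,
      {A : LocFinSet | dyadicCell L k ⊆ U ∧ A ∉ avoid (dyadicCell L k)}.indicator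
        (fun _ => (1 : ℝ≥0∞)) A := by
  classical
  apply le_antisymm
  · obtain ⟨a, b, hab⟩ : ∃ a b, U ⊆ Icc a b := by
      obtain ⟨R, hR⟩ := hb.subset_closedBall 0
      exact ⟨0 - R, 0 + R, hR.trans Real.closedBall_eq_Icc.subset⟩
    have hF : (A.1 ∩ U).Finite := (A.2 a b).subset (inter_subset_inter_right _ hab)
    have hp : Tendsto (fun L : ℕ => (2 ^ L : ℝ)⁻¹) atTop (𝓝 0) := by
      exact tendsto_inv_atTop_zero.comp
        (tendsto_pow_atTop_atTop_of_one_lt (one_lt_two (α := ℝ)))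
    have h1 : ∀ x ∈ A.1 ∩ U, ∀ᶠ L : ℕ in atTop, dyadicCell L (⌈x * 2 ^ L⌉ - 1) ⊆ U := by
      intro x hx
      obtain ⟨ε, hε, hball⟩ := Metric.isOpen_iff.1 hU x hx.2
      filter_upwards [hp.eventually_lt_const hε] with L hL y hy
      refine hball ?_
      have hx' := mem_dyadicCell_ceil L x
      have h2 : (0 : ℝ) < 2 ^ L := by positivity
      rw [dyadicCell, mem_Ioc, add_div, one_div] at hy hx'
      rw [Metric.mem_ball, Real.dist_eq, abs_lt]
      constructor <;> linarith [hx'.1, hx'.2, hy.1, hy.2]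
    have h2 : ∀ x ∈ A.1 ∩ U, ∀ y ∈ A.1 ∩ U, x ≠ y →
        ∀ᶠ L : ℕ in atTop, ⌈x * 2 ^ L⌉ ≠ ⌈y * 2 ^ L⌉ := by
      intro x hx y hy hxy
      filter_upwards [hp.eventually_lt_const (abs_pos.2 (sub_ne_zero.2 hxy))] with L hL he
      have hx' := mem_dyadicCell_ceil L x
      have hy' := mem_dyadicCell_ceil L y
      rw [← he] at hy'
      rw [dyadicCell, mem_Ioc, add_div, one_div] at hx' hy'
      refine absurd hL (not_lt.2 (abs_le.2 ⟨?_, ?_⟩)) <;>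
        linarith [hx'.1, hx'.2, hy'.1, hy'.2]
    have h1' := (hF.eventually_all).2 h1
    have h2' := (hF.eventually_all).2 fun x hx => (hF.eventually_all).2 fun y hy =>
      eventually_imp_distrib_left.2 (h2 x hx y hy)
    -- On a fine enough grid the finitely many points lie in distinct cells contained in `U`.
    obtain ⟨L, hL1, hL2⟩ := (h1'.and h2').exists
    refine le_trans ?_ (le_iSup _ L)
    rw [pointMeasure_apply _ hU.measurableSet]
    have hinj : InjOn (fun x : ℝ => ⌈x * 2 ^ L⌉ - 1) (A.1 ∩ U) := by
      intro x hx y hy hxy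
      by_contra hne
      exact hL2 x hx y hy hne (by simpa using hxy)
    rw [← hinj.encard_image, ← ENNReal.tsum_set_one,
      tsum_subtype _ fun _ => (1 : ℝ≥0∞)]
    refine ENNReal.tsum_le_tsum fun k => ?_
    by_cases hk : k ∈ (fun x : ℝ => ⌈x * 2 ^ L⌉ - 1) '' (A.1 ∩ U)
    swap
    · rw [indicator_of_notMem hk]
      exact zero_le
    rw [indicator_of_mem hk]
    obtain ⟨x, hx, rfl⟩ := hk
    rw [indicator_of_mem]
    exact ⟨hL1 x hx, fun hd => Set.disjoint_left.1 hd hx.1 (mem_dyadicCell_ceil L x)⟩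
  · refine iSup_le fun L => ?_
    calc _ ≤ ∑' k : ℤ, (pointMeasure A.1) (dyadicCell L k ∩ U) := by
          refine ENNReal.tsum_le_tsum fun k => ?_
          by_cases hk : dyadicCell L k ⊆ U ∧ A ∉ avoid (dyadicCell L k)
          · rw [indicator_of_mem (by exact hk), inter_eq_left.2 hk.1,
              pointMeasure_apply _ (measurableSet_dyadicCell L k)]
            have := hk.2
            rw [avoid, mem_ofPred_eq, disjoint_iff_inter_eq_empty, ← ne_eq,
              ← nonempty_iff_ne_empty, ← one_le_encard_iff_nonempty] at this
            exact_mod_cast this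
          · rw [indicator_of_notMem (by exact hk)]
            exact zero_le
      _ = pointMeasure A.1 (⋃ k, dyadicCell L k ∩ U) := by
          rw [measure_iUnion]
          · exact fun k l h => (pairwise_disjoint_dyadicCell L h).mono inter_subset_left
              inter_subset_left
          · exact fun k => (measurableSet_dyadicCell L k).inter hU.measurableSet
      _ ≤ pointMeasure A.1 U := measure_mono (iUnion_subset fun k => inter_subset_right)

theorem measurable_pointMeasure_open {U : Set ℝ} (hU : IsOpen U) (hb : Bornology.IsBounded U) :
    Measurable fun A : LocFinSet => pointMeasure A.1 U := by
  simp only [fun A : LocFinSet => pointMeasure_eq_iSup A hU hb]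
  refine Measurable.iSup fun L => Measurable.tsum fun k => measurable_const.indicator ?_
  by_cases h : dyadicCell L k ⊆ U
  · simp only [h, true_and]
    exact (measurableSet_avoid_cell L k).compl
  · simp [h]

/-- Avoidance of dyadic unions thus already determines all counts, so the counting measure is a
measurable function of the set. The passage from open sets to Borel sets is made on bounded windows,
where the counts are finite. -/
theorem measurable_pointMeasure_carrier : Measurable fun A : LocFinSet => pointMeasure A.1 := by
  have hfin : ∀ n : ℕ, Measurable fun A : LocFinSet =>
      (pointMeasure A.1).restrict (Ioo (-(n : ℝ)) n) := by
    intro n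
    have : ∀ A : LocFinSet, IsFiniteMeasure ((pointMeasure A.1).restrict (Ioo (-(n : ℝ)) n)) := by
      intro A
      refine ⟨?_⟩
      rw [Measure.restrict_apply_univ, pointMeasure_apply _ measurableSet_Ioo]
      have := (A.2 (-(n : ℝ)) n).subset (inter_subset_inter_right _ Ioo_subset_Icc_self)
      have h2 := encard_lt_top_iff.2 this
      exact_mod_cast h2
    refine Measurable.measure_of_isPiSystem (BorelSpace.measurable_eq (α := ℝ)) isPiSystem_isOpen ?_ ?_
    · intro U hU
      have hU : IsOpen U := hU
      simp only [Measure.restrict_apply hU.measurableSet]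
      exact measurable_pointMeasure_open (hU.inter isOpen_Ioo)
        ((Metric.isBounded_Ioo _ _).subset inter_subset_right)
    · simp only [Measure.restrict_apply_univ]
      exact measurable_pointMeasure_open isOpen_Ioo (Metric.isBounded_Ioo _ _)
  refine Measure.measurable_of_measurable_coe _ fun B hB => ?_
  have hU : ∀ A : LocFinSet, pointMeasure A.1 B
      = ⨆ n : ℕ, (pointMeasure A.1).restrict (Ioo (-(n : ℝ)) n) B := by
    intro A
    have hm : Monotone fun n : ℕ => B ∩ Ioo (-(n : ℝ)) n := by
      intro n m hnm
      have : (n : ℝ) ≤ m := by exact_mod_cast hnm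
      exact inter_subset_inter_right _ (Ioo_subset_Ioo (by linarith) this)
    simp only [Measure.restrict_apply hB]
    rw [← hm.measure_iUnion, ← inter_iUnion]
    congr 1
    rw [eq_comm, inter_eq_left]
    intro x _
    obtain ⟨n, hn⟩ := exists_nat_gt |x|
    exact mem_iUnion.2 ⟨n, abs_lt.1 hn⟩
  simp only [hU]
  exact Measurable.iSup fun n => (Measure.measurable_coe hB).comp (hfin n)

theorem measurableSet_avoid' {B : Set ℝ} (hB : MeasurableSet B) : MeasurableSet (avoid B) := by
  have : avoid B = {A : LocFinSet | pointMeasure A.1 B = 0} := by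
    ext A
    exact (pointMeasure_apply_eq_zero _ hB).symm
  rw [this]
  exact ((Measure.measurable_coe hB).comp measurable_pointMeasure_carrier) (measurableSet_singleton 0)

/-- The part of a locally finite set in `D`. -/
def inter (A : LocFinSet) (D : Set ℝ) : LocFinSet :=
  ⟨A.1 ∩ D, fun a b => (A.2 a b).subset (inter_subset_inter_left _ inter_subset_left)⟩

theorem measurable_inter {D : Set ℝ} (hD : MeasurableSet D) :
    Measurable fun A : LocFinSet => A.inter D := by
  refine measurable_generateFrom ?_
  rintro _ ⟨m, I, rfl⟩
  have : (fun A : LocFinSet => A.inter D) ⁻¹' avoid (dyadicUnion m I)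
      = avoid (D ∩ dyadicUnion m I) := by
    ext A
    change Disjoint (A.1 ∩ D) _ ↔ Disjoint A.1 _
    rw [disjoint_iff_inter_eq_empty, disjoint_iff_inter_eq_empty, inter_assoc]
  rw [this]
  exact measurableSet_avoid' (hD.inter (measurableSet_dyadicUnion m I))

/-- The image of a locally finite set under division by `c`. -/
def scale (c : ℝ) (hc : 0 < c) (A : LocFinSet) : LocFinSet :=
  ⟨(fun x => x / c) '' A.1, fun a b => by
    refine ((A.2 (a * c) (b * c)).image fun x => x / c).subset ?_
    rintro _ ⟨⟨x, hx, rfl⟩, h1, h2⟩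
    exact ⟨x, ⟨hx, (le_div_iff₀ hc).1 h1, (div_le_iff₀ hc).1 h2⟩, rfl⟩⟩

theorem disjoint_scale {c : ℝ} {hc : 0 < c} {A : LocFinSet} {B : Set ℝ} :
    Disjoint (A.scale c hc).1 B ↔ Disjoint A.1 ((fun x => x / c) ⁻¹' B) := by
  rw [scale, Set.disjoint_left, Set.disjoint_left]
  exact ⟨fun h x hx hB => h ⟨x, hx, rfl⟩ hB, by rintro h _ ⟨x, hx, rfl⟩ hB; exact h hx hB⟩

theorem measurable_scale {c : ℝ} (hc : 0 < c) : Measurable (scale c hc) := by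
  refine measurable_generateFrom ?_
  rintro _ ⟨m, I, rfl⟩
  have : scale c hc ⁻¹' avoid (dyadicUnion m I)
      = avoid ((fun x => x / c) ⁻¹' dyadicUnion m I) := by
    ext A
    exact disjoint_scale
  rw [this]
  exact measurableSet_avoid' ((measurable_id.div_const c) (measurableSet_dyadicUnion m I))

theorem countable (A : LocFinSet) : A.1.Countable := by
  have : A.1 = ⋃ n : ℕ, A.1 ∩ Icc (-(n : ℝ)) n := by
    rw [← inter_iUnion, eq_comm, inter_eq_left]
    intro x _
    obtain ⟨n, hn⟩ := exists_nat_ge |x|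
    exact mem_iUnion.2 ⟨n, abs_le.1 hn⟩
  rw [this]
  exact countable_iUnion fun n => (A.2 _ _).countable

end LocFinSet

/-! ### Poisson processes on the line as random locally finite sets -/

/-- The avoidance events of the two parts form π-systems, so independence need only be checked for
two counts on disjoint sets being zero. -/
theorem indepFun_inter {μ : Measure ℝ} {Q : Measure LocFinSet} [IsProbabilityMeasure Q]
    (h : IsPoissonRandomMeasure (fun A : LocFinSet => pointMeasure A.1) μ Q) {D D' : Set ℝ}
    (hD : MeasurableSet D) (hD' : MeasurableSet D') (hdisj : Disjoint D D') :
    IndepFun (fun A : LocFinSet => A.inter D) (fun A => A.inter D') Q := by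
  have hpi : ∀ D : Set ℝ, IsPiSystem (preimage (fun A : LocFinSet => A.inter D) ''
      LocFinSet.avoidEvents) := by
    rintro D _ ⟨s, hs, rfl⟩ _ ⟨t, ht, rfl⟩ hne
    refine ⟨s ∩ t, LocFinSet.isPiSystem_avoidEvents s hs t ht ?_, rfl⟩
    exact hne.elim fun x hx => ⟨_, hx⟩
  refine IndepSets.indep (LocFinSet.measurable_inter hD).comap_le
    (LocFinSet.measurable_inter hD').comap_le (hpi D) (hpi D') MeasurableSpace.comap_generateFrom
    MeasurableSpace.comap_generateFrom ?_
  rw [IndepSets_iff]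
  rintro _ _ ⟨_, ⟨m, I, rfl⟩, rfl⟩ ⟨_, ⟨m', I', rfl⟩, rfl⟩
  set B := D ∩ dyadicUnion m I
  set B' := D' ∩ dyadicUnion m' I'
  have hB : MeasurableSet B := hD.inter (measurableSet_dyadicUnion m I)
  have hB' : MeasurableSet B' := hD'.inter (measurableSet_dyadicUnion m' I')
  have e : ∀ D m I, MeasurableSet D → (fun A : LocFinSet => A.inter D) ⁻¹'
      LocFinSet.avoid (dyadicUnion m I)
      = (fun A : LocFinSet => pointMeasure A.1 (D ∩ dyadicUnion m I)) ⁻¹' {0} := by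
    intro D m I hD
    ext A
    rw [mem_preimage, mem_preimage, mem_singleton_iff,
      pointMeasure_apply_eq_zero _ (hD.inter (measurableSet_dyadicUnion m I))]
    change Disjoint (A.1 ∩ D) _ ↔ Disjoint A.1 _
    rw [disjoint_iff_inter_eq_empty, disjoint_iff_inter_eq_empty, inter_assoc]
  rw [e D m I hD, e D' m' I' hD']
  have hind := h.indep 2 ![B, B'] (by simp [Fin.forall_fin_two, hB, hB']) (by
    have hBB : Disjoint B B' := hdisj.mono inter_subset_left inter_subset_left
    intro i j hij
    fin_cases i <;> fin_cases j <;> simp_all [hBB.symm])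
  exact (hind.indepFun (i := 0) (j := 1) (by simp)).measure_inter_preimage_eq_mul _ _
    (measurableSet_singleton 0) (measurableSet_singleton 0)

/-- A Poisson random measure on the line whose mean is at most a multiple of Lebesgue measure has
no multiple points. -/
theorem IsPoissonRandomMeasure.ae_singleton_lt_two {Ω : Type*} [MeasurableSpace Ω] {P : Measure Ω}
    [IsProbabilityMeasure P] {N : Ω → Measure ℝ} {μ : Measure ℝ}
    (h : IsPoissonRandomMeasure N μ P) (c : ℝ≥0) (hμ : μ ≤ (c : ℝ≥0∞) • volume) :
    ∀ᵐ ω ∂P, ∀ x, N ω {x} < 2 := by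
  have hcell : ∀ m k, μ (dyadicCell m k) ≤ c * (2 ^ m)⁻¹ := by
    intro m k
    refine (hμ _).trans ?_
    rw [Measure.smul_apply, volume_dyadicCell, smul_eq_mul]
  have hfin : ∀ m k, μ (dyadicCell m k) ≠ ∞ := fun m k =>
    ((hcell m k).trans_lt (ENNReal.mul_lt_top ENNReal.coe_lt_top (ENNReal.inv_lt_top.2 (by positivity)))).ne
  have key : ∀ n : ℕ, P {ω | ∃ x ∈ Icc (-(n : ℝ)) n, 2 ≤ N ω {x}} = 0 := by
    intro n
    -- A multiple point makes some cell contain two points. At depth `m` there are of order n 2^m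
    -- cells, each with probability at most (c 2^{-m})², so the total is of order 2^{-m}.
    have hle : ∀ m : ℕ, P {ω | ∃ x ∈ Icc (-(n : ℝ)) n, 2 ≤ N ω {x}}
        ≤ (2 * n + 2 : ℝ≥0∞) * c ^ 2 * (2 ^ m)⁻¹ := by
      intro m
      calc _ ≤ P (⋃ k ∈ Finset.Icc (-(n * 2 ^ m : ℤ) - 1) (n * 2 ^ m),
              {ω | 2 ≤ N ω (dyadicCell m k)}) := by
            refine measure_mono ?_
            rintro ω ⟨x, ⟨hx1, hx2⟩, hx⟩
            have hp : (0 : ℝ) < 2 ^ m := by positivity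
            refine mem_iUnion₂.2 ⟨⌈x * 2 ^ m⌉ - 1, Finset.mem_Icc.2 ⟨?_, ?_⟩, ?_⟩
            · have : -(n * 2 ^ m : ℤ) ≤ ⌈x * 2 ^ m⌉ := by
                have h1 := Int.le_ceil (x * 2 ^ m)
                have h2 : -(n : ℝ) * 2 ^ m ≤ x * 2 ^ m := by gcongr
                have h3 := h2.trans h1
                have h4 : ((-(n * 2 ^ m : ℤ) : ℤ) : ℝ) ≤ (⌈x * 2 ^ m⌉ : ℤ) := by
                  push_cast
                  linarith
                exact_mod_cast h4
              omega
            · have : ⌈x * 2 ^ m⌉ ≤ (n * 2 ^ m : ℤ) := by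
                refine Int.ceil_le.2 ?_
                push_cast
                gcongr
              omega
            · exact hx.trans (measure_mono (singleton_subset_iff.2 (mem_dyadicCell_ceil m x)))
        _ ≤ ∑ k ∈ Finset.Icc (-(n * 2 ^ m : ℤ) - 1) (n * 2 ^ m), (c * (2 ^ m)⁻¹ : ℝ≥0∞) ^ 2 := by
            refine (measure_biUnion_finset_le _ _).trans (Finset.sum_le_sum fun k _ => ?_)
            refine (h.measure_two_le (measurableSet_dyadicCell m k) (hfin m k)).trans ?_
            exact pow_le_pow_left' (hcell m k) 2
        _ = (2 * n * 2 ^ m + 2 : ℝ≥0∞) * (c * (2 ^ m)⁻¹) ^ 2 := by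
            rw [Finset.sum_const, Int.card_Icc, nsmul_eq_mul]
            congr 1
            have : ((n * 2 ^ m : ℤ) + 1 - (-(n * 2 ^ m : ℤ) - 1)).toNat = 2 * n * 2 ^ m + 2 := by
              have e : ((n * 2 ^ m : ℤ) + 1 - (-(n * 2 ^ m : ℤ) - 1))
                  = ((2 * n * 2 ^ m + 2 : ℕ) : ℤ) := by
                push_cast
                ring
              rw [e, Int.toNat_natCast]
            rw [this]
            push_cast
            ring
        _ ≤ ((2 * n + 2) * 2 ^ m : ℝ≥0∞) * (c * (2 ^ m)⁻¹) ^ 2 := by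
            gcongr
            rw [add_mul]
            gcongr
            exact le_mul_of_one_le_right' (one_le_pow_of_one_le' (by norm_num) m)
        _ = _ := by
            have h0 : (2 ^ m : ℝ≥0∞) ≠ 0 := by simp
            have h1 : (2 ^ m : ℝ≥0∞) ≠ ∞ := by simp
            calc ((2 * n + 2) * 2 ^ m : ℝ≥0∞) * (c * (2 ^ m)⁻¹) ^ 2
                = (2 * n + 2) * c ^ 2 * (2 ^ m)⁻¹ * (2 ^ m * (2 ^ m)⁻¹) := by ring
              _ = _ := by rw [ENNReal.mul_inv_cancel h0 h1, mul_one]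
    have hlim : Tendsto (fun m : ℕ => (2 * n + 2 : ℝ≥0∞) * c ^ 2 * (2 ^ m)⁻¹) atTop (𝓝 0) := by
      have h0 : Tendsto (fun m : ℕ => ((2 : ℝ≥0∞) ^ m)⁻¹) atTop (𝓝 0) := by
        simp_rw [ENNReal.inv_pow]
        exact ENNReal.tendsto_pow_atTop_nhds_zero_of_lt_one (by simp)
      have := ENNReal.Tendsto.const_mul (a := (2 * n + 2 : ℝ≥0∞) * c ^ 2) h0
        (Or.inr (by finiteness))
      simpa using this
    exact le_antisymm (ge_of_tendsto' hlim hle) (zero_le)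
  have hall := ae_all_iff.2 fun n : ℕ => (measure_eq_zero_iff_ae_notMem.1 (key n))
  filter_upwards [hall] with ω hω x
  obtain ⟨n, hn⟩ := exists_nat_ge |x|
  by_contra hx
  exact hω n ⟨x, abs_le.1 hn, not_lt.1 hx⟩

/-- A Poisson process with unit rate is the counting measure of a random locally finite set. -/
theorem IsPoissonRandomMeasure.exists_locFinSet {Ω : Type*} [MeasurableSpace Ω] {P : Measure Ω}
    [IsProbabilityMeasure P] {N : Ω → Measure ℝ} (h : IsPoissonRandomMeasure N volume P) :
    ∃ X : Ω → LocFinSet, AEMeasurable X P ∧ (∀ᵐ ω ∂P, N ω = pointMeasure (X ω).1) := by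
  classical
  have hloc : ∀ᵐ ω ∂P, ∀ n : ℕ, N ω (Icc (-(n : ℝ)) n) ≠ ∞ :=
    ae_all_iff.2 fun n => h.ae_ne_top measurableSet_Icc (by simp)
  have hex : ∀ᵐ ω ∂P, ∃ A : LocFinSet, N ω = pointMeasure A.1 := by
    filter_upwards [hloc, h.isPointMeasure, h.ae_singleton_lt_two 1 (by simp)] with ω h1 h2 h3
    obtain ⟨I, z, hz⟩ := h2
    have hinj : Function.Injective z := by
      intro k l hkl
      by_contra hne
      refine absurd (h3 (z k)) (not_lt.2 ?_)
      rw [hz, Measure.sum_apply _ (measurableSet_singleton _)]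
      refine le_trans ?_ (ENNReal.sum_le_tsum {k, l})
      rw [Finset.sum_pair hne]
      simp [hkl, one_add_one_eq_two]
    rw [sum_dirac_eq_pointMeasure hinj] at hz
    refine ⟨⟨range z, fun a b => ?_⟩, hz⟩
    obtain ⟨n, hn⟩ := exists_nat_ge (max |a| |b|)
    have hfin := h1 n
    rw [hz, pointMeasure_apply _ measurableSet_Icc] at hfin
    have : (range z ∩ Icc (-(n : ℝ)) n).Finite := by
      rw [← encard_lt_top_iff, lt_top_iff_ne_top]
      exact_mod_cast hfin
    refine this.subset (inter_subset_inter_right _ (Icc_subset_Icc ?_ ?_))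
    · linarith [neg_abs_le a, le_max_left |a| |b|]
    · linarith [le_abs_self b, le_max_right |a| |b|]
  set X : Ω → LocFinSet := fun ω => if hω : ∃ A : LocFinSet, N ω = pointMeasure A.1
    then hω.choose else ⟨∅, by simp⟩
  have hX : ∀ᵐ ω ∂P, N ω = pointMeasure (X ω).1 := by
    filter_upwards [hex] with ω hω
    rw [show X ω = hω.choose from dif_pos hω]
    exact hω.choose_spec
  refine ⟨X, LocFinSet.aemeasurable_of_avoid fun m I => ?_, hX⟩
  have hm : NullMeasurableSet {ω | N ω (dyadicUnion m I) = 0} P :=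
    (h.nullMeasurable_coe (measurableSet_dyadicUnion m I)).nullMeasurableSet_preimage
      (measurableSet_singleton 0)
  refine hm.congr ?_
  filter_upwards [hX] with ω hω
  refine propext ?_
  have := pointMeasure_apply_eq_zero (X ω).1 (measurableSet_dyadicUnion m I)
  rw [← hω] at this
  exact this


namespace IsPoissonRandomMeasure

variable {Ω E : Type*} [MeasurableSpace Ω] [MeasurableSpace E] {N : Ω → Measure E} {μ : Measure E}
  {P : Measure Ω}

theorem iIndepFun_coe (h : IsPoissonRandomMeasure N μ P) {ι : Type*} {B : ι → Set E}
    (hB : ∀ i, MeasurableSet (B i)) (hd : Pairwise fun i j => Disjoint (B i) (B j)) :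
    iIndepFun (fun i ω => N ω (B i)) P := by
  rw [iIndepFun_iff_finset]
  intro s
  have := h.indep s.card (fun k => B (s.equivFin.symm k)) (fun k => hB _) fun k l hkl =>
    hd fun he => hkl (s.equivFin.symm.injective (Subtype.ext he))
  have e := this.precomp (g := s.equivFin) s.equivFin.injective
  simp only [Equiv.symm_apply_apply] at e
  exact e

theorem iIndepSet_ne_zero (h : IsPoissonRandomMeasure N μ P) {ι : Type*} {B : ι → Set E}
    (hB : ∀ i, MeasurableSet (B i)) (hd : Pairwise fun i j => Disjoint (B i) (B j)) :
    iIndepSet (fun i => {ω | N ω (B i) ≠ 0}) P := by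
  refine iIndep_of_iIndep_of_le (h.iIndepFun_coe hB hd).iIndep fun i => ?_
  refine MeasurableSpace.generateFrom_le ?_
  rintro _ rfl
  exact ⟨{0}ᶜ, (measurableSet_singleton 0).compl, rfl⟩

end IsPoissonRandomMeasure

/-! ### Regularity of the Poisson points -/

theorem sum_dirac_apply_eq_encard {E ι : Type*} [MeasurableSpace E] {z : ι → E}
    (hz : Function.Injective z) {B : Set E} (hB : MeasurableSet B) :
    (Measure.sum fun k => Measure.dirac (z k)) B = ((range z ∩ B).encard : ℝ≥0∞) := by
  rw [Measure.sum_apply _ hB, ← image_preimage_eq_range_inter, hz.encard_image,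
    ← ENNReal.tsum_set_one, tsum_subtype (z ⁻¹' B) fun _ => (1 : ℝ≥0∞)]
  congr 1
  ext k
  by_cases h2 : z k ∈ B <;> simp [h2, hB, indicator]

/-- The points charged by a measure. -/
def atoms {E : Type*} [MeasurableSpace E] (m : Measure E) : Set E := {p | m {p} ≠ 0}

instance (c : ℝ) : SFinite (expIntensity c) :=
  inferInstanceAs (SFinite (volume.withDensity _))

/-- The mean measure of the times and the levels. -/
noncomputable def timeLevelIntensity (c : ℝ) : Measure (ℝ × ℝ) :=
  ((volume : Measure ℝ).restrict (Ici 0)).prod (expIntensity c)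

theorem timeLevelIntensity_prod (c : ℝ) (A B : Set ℝ) : timeLevelIntensity c (A ×ˢ B)
    = (volume : Measure ℝ).restrict (Ici 0) A * expIntensity c B := Measure.prod_prod _ _

section Regular

variable {Ω : Type*} [MeasurableSpace Ω] {P : Measure Ω} [IsProbabilityMeasure P]
  {N : Ω → Measure (ℝ × ℝ)} {c : ℝ}

/-- Each property is read off the mean measure: time 0 is null, [0, n] × (-n, ∞) has finite mass,
while [0, ∞) × (n, ∞) and [0, 1/(n + 1)] × ℝ have infinite mass. Arrival times are distinct because
above each level they form a Poisson process of bounded rate. Countably many levels and times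
suffice, by monotonicity. -/
theorem ae_isRegularConfig (hc : 0 < c)
    (hN : IsPoissonRandomMeasure N (timeLevelIntensity c) P) :
    ∀ᵐ ω ∂P, IsRegularConfig (atoms (N ω)) ∧
      ∀ B, MeasurableSet B → N ω B = ((atoms (N ω) ∩ B).encard : ℝ≥0∞) := by
  have hpos : ∀ᵐ ω ∂P, N ω (Iic 0 ×ˢ univ) = 0 := by
    refine hN.ae_eq_zero (measurableSet_Iic.prod .univ) ?_
    rw [timeLevelIntensity_prod, Measure.restrict_apply measurableSet_Iic, Iic_inter_Ici, Icc_self]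
    simp
  have hfin : ∀ᵐ ω ∂P, ∀ n : ℕ, N ω (Iic (n : ℝ) ×ˢ Ioi (-(n : ℝ))) ≠ ∞ := by
    refine ae_all_iff.2 fun n => hN.ae_ne_top (measurableSet_Iic.prod measurableSet_Ioi) ?_
    rw [timeLevelIntensity_prod, Measure.restrict_apply measurableSet_Iic, Iic_inter_Ici,
      Real.volume_Icc, expIntensity_Ioi hc.le]
    finiteness
  have hinf : ∀ᵐ ω ∂P, ∀ n : ℕ, N ω (univ ×ˢ Ioi (n : ℝ)) = ∞ := by
    refine ae_all_iff.2 fun n => hN.eq_top _ (MeasurableSet.univ.prod measurableSet_Ioi) ?_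
    rw [timeLevelIntensity_prod, Measure.restrict_apply_univ, Real.volume_Ici,
      expIntensity_Ioi hc.le]
    exact ENNReal.top_mul (ENNReal.ofReal_pos.2 (by positivity)).ne'
  have hinf' : ∀ᵐ ω ∂P, ∀ n : ℕ, N ω (Iic (1 / ((n : ℝ) + 1)) ×ˢ univ) = ∞ := by
    refine ae_all_iff.2 fun n => hN.eq_top _ (measurableSet_Iic.prod .univ) ?_
    rw [timeLevelIntensity_prod, Measure.restrict_apply measurableSet_Iic, Iic_inter_Ici,
      Real.volume_Icc, expIntensity_univ hc]
    exact ENNReal.mul_top (ENNReal.ofReal_pos.2 (by rw [sub_zero]; positivity)).ne'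
  have hsimple : ∀ᵐ ω ∂P, ∀ n : ℕ, ∀ s : ℝ, N ω ({s} ×ˢ Ioi (-(n : ℝ))) < 2 := by
    refine ae_all_iff.2 fun n => ?_
    have hD : MeasurableSet ((univ : Set ℝ) ×ˢ Ioi (-(n : ℝ))) :=
      MeasurableSet.univ.prod measurableSet_Ioi
    have hM := (hN.restrict hD).map measurable_fst
    -- The arrival times of points above -n have rate c e^n on the half-line.
    have hle : ((timeLevelIntensity c).restrict (univ ×ˢ Ioi (-(n : ℝ)))).map Prod.fst
        ≤ ((c * Real.exp (-(-(n : ℝ)))).toNNReal : ℝ≥0∞) • volume := by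
      rw [timeLevelIntensity, ← Measure.prod_restrict, Measure.restrict_univ,
        Measure.map_fst_prod, Measure.restrict_apply_univ, expIntensity_Ioi hc.le]
      refine Measure.le_iff.2 fun B hB => ?_
      simp only [Measure.smul_apply, smul_eq_mul]
      gcongr
      · exact le_rfl
      · exact Measure.restrict_le_self
    filter_upwards [hM.ae_singleton_lt_two _ hle] with ω hω s
    have := hω s
    rw [Measure.map_apply measurable_fst (measurableSet_singleton s),
      Measure.restrict_apply (measurable_fst (measurableSet_singleton s))] at this
    convert this using 2
    ext p
    simp
  filter_upwards [hpos, hfin, hinf, hinf', hsimple, hN.isPointMeasure] with ω h1 h2 h3 h4 h5 h6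
  obtain ⟨I, z, hz⟩ := h6
  have hinj : Function.Injective fun k => (z k).1 := by
    intro k l hkl
    by_contra hne
    obtain ⟨n, hn⟩ := exists_nat_gt (max (-(z k).2) (-(z l).2))
    refine absurd (h5 n (z k).1) (not_lt.2 ?_)
    have hm : MeasurableSet ({(z k).1} ×ˢ Ioi (-(n : ℝ)) : Set (ℝ × ℝ)) :=
      (measurableSet_singleton _).prod measurableSet_Ioi
    rw [hz, Measure.sum_apply _ hm]
    refine le_trans ?_ (ENNReal.sum_le_tsum {k, l})
    have hk : z k ∈ ({(z k).1} ×ˢ Ioi (-(n : ℝ)) : Set (ℝ × ℝ)) :=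
      ⟨rfl, by have := (le_max_left _ _).trans_lt hn; simp only [mem_Ioi]; linarith⟩
    have hl : z l ∈ ({(z k).1} ×ˢ Ioi (-(n : ℝ)) : Set (ℝ × ℝ)) :=
      ⟨hkl.symm, by have := (le_max_right _ _).trans_lt hn; simp only [mem_Ioi]; linarith⟩
    rw [Finset.sum_pair hne, Measure.dirac_apply_of_mem hk, Measure.dirac_apply_of_mem hl,
      one_add_one_eq_two]
  have hz' : Function.Injective z := fun k l hkl => hinj (congrArg Prod.fst hkl)
  have hB : ∀ B, MeasurableSet B → N ω B = ((range z ∩ B).encard : ℝ≥0∞) := fun B hB => by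
    rw [hz, sum_dirac_apply_eq_encard hz' hB]
  have hatoms : atoms (N ω) = range z := by
    ext p
    rw [atoms, mem_ofPred_eq, hB _ (measurableSet_singleton p)]
    by_cases hp : p ∈ range z
    · simp [hp]
    · simp only [hp, inter_singleton_eq_empty.2 hp, encard_empty, iff_false, not_not]
      simp
  rw [hatoms]
  refine ⟨⟨fun p hp => ?_, ?_, fun t y => ?_, fun y hy => ?_, fun t ht hf => ?_⟩, hB⟩
  · rw [hB _ (measurableSet_Iic.prod .univ)] at h1
    have he : range z ∩ Iic 0 ×ˢ univ = ∅ := by simpa using h1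
    by_contra hle
    have : p ∈ range z ∩ Iic 0 ×ˢ univ := ⟨hp, not_lt.1 hle, mem_univ _⟩
    rw [he] at this
    exact this
  · rintro _ ⟨k, rfl⟩ _ ⟨l, rfl⟩ hkl
    rw [hinj hkl]
  · obtain ⟨n, hn⟩ := exists_nat_gt (max t (-y))
    have hf := h2 n
    rw [hB _ (measurableSet_Iic.prod measurableSet_Ioi)] at hf
    have hf' : (range z ∩ Iic (n : ℝ) ×ˢ Ioi (-(n : ℝ))).Finite := by
      rw [← encard_lt_top_iff, lt_top_iff_ne_top]
      exact_mod_cast hf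
    refine hf'.subset ?_
    rintro p ⟨hp, hp1, hp2⟩
    refine ⟨hp, ?_, ?_⟩
    · exact hp1.trans ((le_max_left _ _).trans hn.le)
    · have := (le_max_right _ _).trans_lt hn
      simp only [mem_Ioi]
      linarith
  · obtain ⟨n, hn⟩ := exists_nat_ge y
    have hf := h3 n
    rw [hB _ (MeasurableSet.univ.prod measurableSet_Ioi)] at hf
    have hf' : (range z ∩ univ ×ˢ Ioi (n : ℝ)).encard = ⊤ := by exact_mod_cast hf
    rw [encard_eq_top_iff] at hf'
    exact hf' (hy.subset fun p hp => ⟨hp.1, hn.trans_lt hp.2.2⟩)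
  · obtain ⟨n, hn⟩ := exists_nat_one_div_lt ht
    have hf' := h4 n
    rw [hB _ (measurableSet_Iic.prod .univ)] at hf'
    have hf'' : (range z ∩ Iic (1 / ((n : ℝ) + 1)) ×ˢ univ).encard = ⊤ := by exact_mod_cast hf'
    rw [encard_eq_top_iff] at hf''
    exact hf'' (hf.subset fun p hp => ⟨hp.1, (show p.1 ≤ _ from hp.2.1).trans hn.le⟩)

end Regular


/-! ### Avoidance probabilities of the record levels -/

/-- The quotient is the conditional probability that an occupied slot is occupied above the higher
level. As the slots shrink it becomes the ratio of the rates. -/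
theorem tendsto_one_sub_exp_div {a b : ℝ} (hb : b ≠ 0) :
    Tendsto (fun δ => (1 - Real.exp (-(δ * a))) / (1 - Real.exp (-(δ * b)))) (𝓝[≠] 0)
      (𝓝 (a / b)) := by
  have key : ∀ a : ℝ, Tendsto (fun δ : ℝ => δ⁻¹ * (1 - Real.exp (-(δ * a)))) (𝓝[≠] 0) (𝓝 a) := by
    intro a
    have h1 : HasDerivAt (fun δ : ℝ => 1 - Real.exp (-(δ * a))) a 0 := by
      have := (((hasDerivAt_id (0 : ℝ)).mul_const a).neg.exp).const_sub 1
      simpa using this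
    have := h1.tendsto_slope_zero
    simpa using this
  refine ((key a).div (key b) hb).congr' ?_
  filter_upwards [self_mem_nhdsWithin] with δ hδ
  have : δ⁻¹ ≠ 0 := inv_ne_zero hδ
  simp only [Pi.div_apply]
  rw [mul_div_mul_left _ _ this]

theorem volume_timeSlot (L j : ℕ) :
    (volume : Measure ℝ).restrict (Ici 0) (timeSlot L j) = ENNReal.ofReal ((2 ^ L : ℝ)⁻¹) := by
  have hsub : timeSlot L j ⊆ Ici 0 := fun s hs =>
    le_trans (by positivity : (0 : ℝ) ≤ (j : ℝ) / 2 ^ L) hs.1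
  rw [timeSlot] at *
  rw [Measure.restrict_apply measurableSet_Ico, inter_eq_left.2 hsub, Real.volume_Ico, ← sub_div,
    add_sub_cancel_left, one_div]

theorem measurableSet_timeSlot (L j : ℕ) : MeasurableSet (timeSlot L j) := measurableSet_Ico

theorem pairwise_disjoint_timeSlot (L : ℕ) :
    Pairwise fun i j => Disjoint (timeSlot L i) (timeSlot L j) := by
  intro i j hij
  refine Set.disjoint_left.2 fun s hi hj => hij ?_
  have hs : 0 ≤ s := le_trans (by positivity : (0 : ℝ) ≤ (i : ℝ) / 2 ^ L) hi.1
  exact ((mem_timeSlot_iff hs).1 hi).symm.trans ((mem_timeSlot_iff hs).1 hj)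

section Avoid

variable {Ω : Type*} {mΩ : MeasurableSpace Ω} {P : Measure Ω} [IsProbabilityMeasure P]
  {N : Ω → Measure (ℝ × ℝ)} {c : ℝ} {r : ℕ} {y : ℕ → ℝ}

/-- The event that some point arrives in the `j`-th time slot with level above `a`. -/
def slotHit (N : Ω → Measure (ℝ × ℝ)) (a : ℝ) (L j : ℕ) : Set Ω :=
  {ω | N ω (timeSlot L j ×ˢ Ioi a) ≠ 0}

/-- The levels `y` decrease, so `slotHit N (y n)` increases with `n`, and passing to `n + 1` adds
the points of the band (y (n + 1), y n]. Occupation of the disjoint cells, slots times bands, is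
independent, so the trials satisfy the hypotheses of `measure_biInter_firstHitsSubset`. -/
theorem measure_firstHitsSubset_slotHit (hc : 0 < c)
    (hN : IsPoissonRandomMeasure N (timeLevelIntensity c) P) (hNm : Measurable N)
    (hr : 1 ≤ r) (hy : StrictAnti y) (L : ℕ) (I : Finset ℕ) :
    P (⋂ k ∈ I, firstHitsSubset (slotHit N (y (k + 1)) L) (slotHit N (y k) L) r)
      = ∏ k ∈ I, ENNReal.ofReal ((1 - Real.exp (-((2 ^ L : ℝ)⁻¹ * (c * Real.exp (-y k)))))
        / (1 - Real.exp (-((2 ^ L : ℝ)⁻¹ * (c * Real.exp (-y (k + 1))))))) ^ r := by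
  set δ : ℝ := (2 ^ L : ℝ)⁻¹ with hδ
  have hδ0 : 0 < δ := by positivity
  set a : ℕ → ℝ := fun n => c * Real.exp (-y n) with ha
  have ha0 : ∀ n, 0 < a n := fun n => by positivity
  have haa : ∀ n, a n ≤ a (n + 1) := fun n => by
    have := (hy (Nat.lt_succ_self n)).le
    simp only [ha]
    gcongr
  have hm : ∀ B, MeasurableSet B → MeasurableSet {ω | N ω B ≠ 0} := fun B hB =>
    ((Measure.measurable_coe hB).comp hNm) (measurableSet_singleton 0).compl
  -- the disjoint cells: time slots times bands of levels
  set band : Option ℕ → Set ℝ := fun o => o.elim (Ioi (y 0)) fun n => Ioc (y (n + 1)) (y n)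
    with hband
  have hbandm : ∀ o, MeasurableSet (band o) := by
    rintro (_ | n)
    · exact measurableSet_Ioi
    · exact measurableSet_Ioc
  have hbandd : Pairwise fun o o' => Disjoint (band o) (band o') := by
    have h1 : ∀ n, Disjoint (Ioi (y 0)) (Ioc (y (n + 1)) (y n)) := fun n =>
      Set.disjoint_left.2 fun x hx hx' => not_lt.2 (hx'.2.trans (hy.antitone (Nat.zero_le n))) hx
    have h2 : ∀ n m, n < m → Disjoint (Ioc (y (n + 1)) (y n)) (Ioc (y (m + 1)) (y m)) :=
      fun n m hnm => Set.disjoint_left.2 fun x hx hx' =>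
        not_lt.2 (hx'.2.trans (hy.antitone (Nat.succ_le_of_lt hnm))) hx.1
    rintro (_ | n) (_ | m) hne
    · exact absurd rfl hne
    · exact h1 m
    · exact (h1 n).symm
    · rcases lt_trichotomy n m with h | h | h
      · exact h2 n m h
      · exact absurd (congrArg some h) hne
      · exact (h2 m n h).symm
  set cell : ℕ × Option ℕ → Set (ℝ × ℝ) := fun q => timeSlot L q.1 ×ˢ band q.2 with hcell
  have hcellm : ∀ q, MeasurableSet (cell q) := fun q =>
    (measurableSet_timeSlot L q.1).prod (hbandm q.2)
  have hcelld : Pairwise fun q q' => Disjoint (cell q) (cell q') := by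
    rintro ⟨j, o⟩ ⟨j', o'⟩ hne
    rw [Set.disjoint_prod]
    by_cases hj : j = j'
    · exact Or.inr (hbandd fun ho => hne (Prod.ext hj ho))
    · exact Or.inl (pairwise_disjoint_timeSlot L hj)
  have hcelli := hN.iIndepSet_ne_zero hcellm hcelld
  set U : ℕ → ℕ → Set Ω := fun n j => slotHit N (y n) L j with hU
  set V : ℕ → ℕ → Set Ω := fun n j => {ω | N ω (cell (j, some n)) ≠ 0} with hV
  have hUm : ∀ n j, MeasurableSet (U n j) := fun n j =>
    hm _ ((measurableSet_timeSlot L j).prod measurableSet_Ioi)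
  have hVm : ∀ n j, MeasurableSet (V n j) := fun n j => hm _ (hcellm _)
  have hsplit : ∀ n j, timeSlot L j ×ˢ Ioi (y (n + 1))
      = timeSlot L j ×ˢ Ioi (y n) ∪ cell (j, some n) := by
    intro n j
    rw [hcell]
    simp only [hband, Option.elim]
    rw [← prod_union, union_comm, Ioc_union_Ioi_eq_Ioi (hy (Nat.lt_succ_self n)).le]
  have hUV : ∀ n j, U (n + 1) j = U n j ∪ V n j := by
    intro n j
    ext ω
    simp only [hU, hV, slotHit, mem_ofPred_eq, mem_union, hsplit n j, ne_eq, measure_union_null_iff]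
    tauto
  have hUi : ∀ n, iIndepSet (U n) P := fun n =>
    hN.iIndepSet_ne_zero (fun j => (measurableSet_timeSlot L j).prod measurableSet_Ioi)
      fun i j hij => Set.disjoint_prod.2 (Or.inl (pairwise_disjoint_timeSlot L hij))
  have hVi : ∀ n, iIndepSet (V n) P := fun n =>
    hcelli.precomp (g := fun j : ℕ => (j, some n)) fun i j hij => (Prod.ext_iff.1 hij).1
  have hw : ∀ n j, P (U n j)ᶜ = ENNReal.ofReal (Real.exp (-(δ * a n))) := by
    intro n j
    have e : (U n j)ᶜ = {ω | N ω (timeSlot L j ×ˢ Ioi (y n)) = 0} := by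
      ext ω
      simp [hU, slotHit]
    have hμ : timeLevelIntensity c (timeSlot L j ×ˢ Ioi (y n)) = ENNReal.ofReal (δ * a n) := by
      rw [timeLevelIntensity_prod, volume_timeSlot, expIntensity_Ioi hc.le,
        ← ENNReal.ofReal_mul hδ0.le]
    rw [e, hN.measure_eq_zero ((measurableSet_timeSlot L j).prod measurableSet_Ioi)
      (by rw [hμ]; exact ENNReal.ofReal_ne_top), hμ,
      ENNReal.toReal_ofReal (mul_pos hδ0 (ha0 n)).le]
  have hw' : ∀ n j, P (V n j)ᶜ = ENNReal.ofReal (Real.exp (-(δ * (a (n + 1) - a n)))) := by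
    intro n j
    have e : (V n j)ᶜ = {ω | N ω (cell (j, some n)) = 0} := by
      ext ω
      simp [hV]
    have hμ : timeLevelIntensity c (cell (j, some n)) = ENNReal.ofReal (δ * (a (n + 1) - a n)) := by
      rw [hcell]
      simp only [hband, Option.elim]
      rw [timeLevelIntensity_prod, volume_timeSlot,
        expIntensity_Ioc hc.le (hy (Nat.lt_succ_self n)).le, ← ENNReal.ofReal_mul hδ0.le]
    rw [e, hN.measure_eq_zero (hcellm _) (by rw [hμ]; exact ENNReal.ofReal_ne_top), hμ,
      ENNReal.toReal_ofReal (mul_nonneg hδ0.le (sub_nonneg.2 (haa n)))]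
  have hp0 : ∀ n, 0 < 1 - Real.exp (-(δ * a n)) := fun n => by
    have := Real.exp_lt_exp.2 (neg_lt_zero.2 (mul_pos hδ0 (ha0 n)))
    rw [Real.exp_zero] at this
    linarith
  have hu : ∀ n j, P (U n j) = ENNReal.ofReal (1 - Real.exp (-(δ * a n))) := by
    intro n j
    have := prob_compl_eq_one_sub (μ := P) (hUm n j).compl
    rw [compl_compl] at this
    rw [this, hw, ← ENNReal.ofReal_one, ← ENNReal.ofReal_sub _ (Real.exp_pos _).le]
  refine measure_biInter_firstHitsSubset (V := V) hr hUm hUV hUi hVi ?_ hu hw hw' ?_ ?_ ?_ I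
  · intro n
    set m : ℕ × Option ℕ → MeasurableSpace Ω := fun q =>
      MeasurableSpace.generateFrom {{ω | N ω (cell q) ≠ 0}} with hmdef
    have hmle : ∀ q, m q ≤ mΩ := fun q => MeasurableSpace.generateFrom_le (by
      rintro _ rfl
      exact hm _ (hcellm q))
    -- `S` indexes the cells that make up `U l` for `l ≤ n`: the top band `none` and the bands below
    -- number `n`. The cells `T` of `V n` are disjoint from them.
    set S : Set (ℕ × Option ℕ) := {q | ∀ l, q.2 = some l → l < n} with hS
    set T : Set (ℕ × Option ℕ) := {q | q.2 = some n} with hT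
    have hST : Disjoint S T := Set.disjoint_left.2 fun q hq hq' => lt_irrefl n (hq n hq')
    have hmem : ∀ (R : Set (ℕ × Option ℕ)) q, q ∈ R →
        MeasurableSet[⨆ i ∈ R, m i] {ω | N ω (cell q) ≠ 0} := fun R q hq =>
      le_iSup₂ (f := fun i (_ : i ∈ R) => m i) q hq _
        (MeasurableSpace.measurableSet_generateFrom (mem_singleton _))
    have hUS : ∀ l ≤ n, ∀ j, MeasurableSet[⨆ i ∈ S, m i] (U l j) := by
      intro l
      induction l with
      | zero =>
        intro _ j
        exact hmem S (j, none) fun l hl => by simp at hl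
      | succ l ih =>
        intro hl j
        rw [hUV]
        refine MeasurableSet.union (ih (by omega) j) (hmem S (j, some l) fun l' hl' => ?_)
        have : l = l' := Option.some_injective _ hl'
        omega
    refine indep_of_indep_of_le_left (indep_of_indep_of_le_right
      (indep_iSup_of_disjoint hmle hcelli hST) ?_) ?_
    · refine iSup_le fun j => ?_
      exact le_iSup₂ (f := fun i (_ : i ∈ T) => m i) (j, some n) rfl
    · refine MeasurableSpace.generateFrom_le ?_
      rintro _ ⟨l, hl, j, rfl⟩
      exact hUS l hl j
  · intro n
    rw [← ENNReal.ofReal_mul (Real.exp_pos _).le, ← Real.exp_add]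
    congr 2
    ring
  · intro n
    rw [← ENNReal.ofReal_mul (div_nonneg (hp0 n).le (hp0 (n + 1)).le),
      div_mul_cancel₀ _ (hp0 (n + 1)).ne']
  · intro n
    have hsum : ∑' j, P (U n j) = ∞ := by
      simp only [hu n]
      exact ENNReal.tsum_const_eq_top_of_ne_zero (ENNReal.ofReal_pos.2 (hp0 n)).ne'
    -- Second Borel–Cantelli lemma: the trials are independent with a constant positive success
    -- probability.
    have h1 := measure_limsup_eq_one (hUm n) (hUi n) hsum
    have h2 : MeasurableSet (limsup (U n) atTop) := MeasurableSet.measurableSet_limsup (hUm n)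
    filter_upwards [(mem_ae_iff_prob_eq_one h2).2 h1] with ω hω
    exact Nat.frequently_atTop_iff_infinite.1 (mem_limsup_iff_frequently_mem.1 hω)

theorem ae_mem_slotHit_iff (hc : 0 < c)
    (hN : IsPoissonRandomMeasure N (timeLevelIntensity c) P) :
    ∀ᵐ ω ∂P, IsRegularConfig (atoms (N ω)) ∧ ∀ a L j, ω ∈ slotHit N a L j ↔
      ∃ p ∈ atoms (N ω), p.1 ∈ timeSlot L j ∧ a < p.2 := by
  filter_upwards [ae_isRegularConfig hc hN] with ω ⟨h1, h2⟩
  refine ⟨h1, fun a L j => ?_⟩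
  rw [slotHit, mem_ofPred_eq, h2 _ ((measurableSet_timeSlot L j).prod measurableSet_Ioi)]
  have : (((atoms (N ω) ∩ timeSlot L j ×ˢ Ioi a).encard : ℕ∞) : ℝ≥0∞) ≠ 0
      ↔ (atoms (N ω) ∩ timeSlot L j ×ˢ Ioi a).Nonempty := by
    rw [← encard_ne_zero]
    norm_cast
  rw [this]
  rfl

/-- The avoidance probabilities of the record levels on finitely many bands of levels. -/
theorem measure_recordLevels_avoid (hc : 0 < c)
    (hN : IsPoissonRandomMeasure N (timeLevelIntensity c) P)
    (hr : 1 ≤ r) (hy : StrictAnti y) (I : Finset ℕ) :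
    NullMeasurableSet
        {ω | ∀ k ∈ I, Disjoint (recordLevels (atoms (N ω)) r) (Ioc (y (k + 1)) (y k))} P ∧
      P {ω | ∀ k ∈ I, Disjoint (recordLevels (atoms (N ω)) r) (Ioc (y (k + 1)) (y k))}
        = ∏ k ∈ I, ENNReal.ofReal (Real.exp (-(y k - y (k + 1)))) ^ r := by
  -- The trials must be measurable events, so `N` is replaced by a measurable modification.
  wlog hNm : Measurable N generalizing N
  · have hae := hN.aemeasurable.ae_eq_mk
    obtain ⟨h1, h2⟩ := this (hN.congr hae) hN.aemeasurable.measurable_mk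
    have hset : {ω | ∀ k ∈ I, Disjoint (recordLevels (atoms (N ω)) r) (Ioc (y (k + 1)) (y k))}
        =ᵐ[P] {ω | ∀ k ∈ I, Disjoint (recordLevels (atoms (hN.aemeasurable.mk N ω)) r)
          (Ioc (y (k + 1)) (y k))} := by
      filter_upwards [hae] with ω hω
      refine propext ?_
      change (∀ k ∈ I, _) ↔ (∀ k ∈ I, _)
      rw [hω]
    exact ⟨h1.congr hset.symm, (measure_congr hset).trans h2⟩
  set D := {ω | ∀ k ∈ I, Disjoint (recordLevels (atoms (N ω)) r) (Ioc (y (k + 1)) (y k))} with hD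
  set E : ℕ → Set Ω := fun L =>
    ⋂ k ∈ I, firstHitsSubset (slotHit N (y (k + 1)) L) (slotHit N (y k) L) r with hE
  have hm : ∀ a L j, MeasurableSet (slotHit N a L j) := fun a L j =>
    ((Measure.measurable_coe ((measurableSet_timeSlot L j).prod measurableSet_Ioi)).comp hNm)
      (measurableSet_singleton 0).compl
  have hEm : ∀ L, MeasurableSet (E L) := fun L => Finset.measurableSet_biInter _ fun k _ =>
    measurableSet_firstHitsSubset (hm _ L) (hm _ L) r
  have hev : ∀ᵐ ω ∂P, ∀ᶠ L in atTop, ω ∈ E L ↔ ω ∈ D := by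
    filter_upwards [ae_mem_slotHit_iff hc hN] with ω ⟨h1, h2⟩
    have : ∀ᶠ L in atTop, ∀ k ∈ I,
        (ω ∈ firstHitsSubset (slotHit N (y (k + 1)) L) (slotHit N (y k) L) r ↔
          Disjoint (recordLevels (atoms (N ω)) r) (Ioc (y (k + 1)) (y k))) :=
      (Finset.eventually_all I).2 fun k _ => eventually_mem_firstHitsSubset_iff
        (A := slotHit N (y (k + 1))) (B := slotHit N (y k)) h1 (h2 _) (h2 _)
    filter_upwards [this] with L hL
    simp only [hE, hD, mem_iInter, mem_ofPred_eq]
    exact forall₂_congr hL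
  have hDn : NullMeasurableSet D P :=
    nullMeasurableSet_of_tendsto_indicator atTop (fun L => (hEm L).nullMeasurableSet) hev
  refine ⟨hDn, ?_⟩
  -- `D` is known only as an almost sure limit of the slot events; the convergence of measures is
  -- applied to a measurable version.
  obtain ⟨D', _, hD'm, hD'⟩ := hDn.exists_measurable_superset_ae_eq
  have hev' : ∀ᵐ ω ∂P, ∀ᶠ L in atTop, ω ∈ E L ↔ ω ∈ D' := by
    filter_upwards [hev, hD'] with ω h1 h2
    have h2 : ω ∈ D' ↔ ω ∈ D := iff_of_eq h2
    filter_upwards [h1] with L h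
    rw [h, h2]
  have hlim := tendsto_measure_of_ae_tendsto_indicator_of_isFiniteMeasure atTop hD'm hEm hev'
  rw [← measure_congr hD']
  refine tendsto_nhds_unique hlim ?_
  simp only [hE, measure_firstHitsSubset_slotHit hc hN hNm hr hy]
  refine ENNReal.tendsto_finsetProd_of_ne_top I
    (fun k _ => ENNReal.Tendsto.pow (ENNReal.tendsto_ofReal ?_)) fun k _ => by finiteness
  have h2 : Tendsto (fun L : ℕ => (2 ^ L : ℝ)⁻¹) atTop (𝓝[≠] 0) :=
    tendsto_nhdsWithin_iff.2 ⟨tendsto_inv_atTop_zero.comp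
      (tendsto_pow_atTop_atTop_of_one_lt (one_lt_two (α := ℝ))),
      Eventually.of_forall fun L => inv_ne_zero (by positivity)⟩
  have h3 := (tendsto_one_sub_exp_div (a := c * Real.exp (-y k))
    (b := c * Real.exp (-y (k + 1))) (by positivity)).comp h2
  have h4 : c * Real.exp (-y k) / (c * Real.exp (-y (k + 1))) = Real.exp (-(y k - y (k + 1))) := by
    rw [mul_div_mul_left _ _ hc.ne', ← Real.exp_sub]
    congr 1
    ring
  rw [h4] at h3
  exact h3

/-- The record levels form a random locally finite set with known avoidance probabilities. -/
theorem exists_recordSet (hc : 0 < c)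
    (hN : IsPoissonRandomMeasure N (timeLevelIntensity c) P) (hr : 1 ≤ r) :
    ∃ X : Ω → LocFinSet, AEMeasurable X P ∧
      (∀ᵐ ω ∂P, (X ω).carrier = recordLevels (atoms (N ω)) r) ∧
      ∀ m I, P {ω | Disjoint (X ω).carrier (dyadicUnion m I)}
        = ENNReal.ofReal (Real.exp (-(r * (volume (dyadicUnion m I)).toReal))) := by
  classical
  set X : Ω → LocFinSet := fun ω => if hω : IsRegularConfig (atoms (N ω))
    then ⟨recordLevels (atoms (N ω)) r, finite_recordLevels_inter_Icc hω r⟩ else ⟨∅, by simp⟩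
  have hX : ∀ᵐ ω ∂P, (X ω).carrier = recordLevels (atoms (N ω)) r := by
    filter_upwards [ae_isRegularConfig hc hN] with ω ⟨hω, _⟩
    rw [show X ω = ⟨recordLevels (atoms (N ω)) r, finite_recordLevels_inter_Icc hω r⟩ from
      dif_pos hω]
  have key : ∀ m I, NullMeasurableSet {ω | Disjoint (X ω).carrier (dyadicUnion m I)} P ∧
      P {ω | Disjoint (X ω).carrier (dyadicUnion m I)}
        = ENNReal.ofReal (Real.exp (-(r * (volume (dyadicUnion m I)).toReal))) := by
    intro m I
    obtain ⟨K, hK⟩ := I.bddAbove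
    -- The grid is numbered downwards from the upper end of cell `K`, an upper bound of `I`, so that
    -- cell `k` is the band with number `K - k`.
    set y : ℕ → ℝ := fun n => ((K : ℝ) + 1 - n) / 2 ^ m with hydef
    have hp : (0 : ℝ) < 2 ^ m := by positivity
    have hy : StrictAnti y := by
      intro i j hij
      have : (i : ℝ) < j := by exact_mod_cast hij
      simp only [hydef]
      gcongr
    have hcell : ∀ k ∈ I, dyadicCell m k = Ioc (y ((K - k).toNat + 1)) (y (K - k).toNat) := by
      intro k hk
      have h1 : (((K - k).toNat : ℕ) : ℝ) = (K : ℝ) - k := by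
        have : (((K - k).toNat : ℕ) : ℤ) = K - k := Int.toNat_of_nonneg (sub_nonneg.2 (hK hk))
        exact_mod_cast this
      simp only [hydef, dyadicCell]
      push_cast
      rw [h1]
      congr 2 <;> ring
    have hinj : Set.InjOn (fun k : ℤ => (K - k).toNat) I := by
      intro k hk l hl hkl
      have h1 := hK hk
      have h2 := hK hl
      simp only at hkl
      omega
    obtain ⟨h1, h2⟩ := measure_recordLevels_avoid hc hN hr hy (I.image fun k => (K - k).toNat)
    have hset : {ω | Disjoint (X ω).carrier (dyadicUnion m I)} =ᵐ[P]
        {ω | ∀ k ∈ I.image fun k => (K - k).toNat,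
          Disjoint (recordLevels (atoms (N ω)) r) (Ioc (y (k + 1)) (y k))} := by
      filter_upwards [hX] with ω hω
      refine propext ?_
      change Disjoint (X ω).carrier (dyadicUnion m I) ↔ ∀ k ∈ I.image fun k => (K - k).toNat,
          Disjoint (recordLevels (atoms (N ω)) r) (Ioc (y (k + 1)) (y k))
      rw [hω, dyadicUnion, disjoint_iUnion₂_right, Finset.forall_mem_image]
      exact forall₂_congr fun k hk => by rw [hcell k hk]
    refine ⟨h1.congr hset.symm, ?_⟩
    rw [measure_congr hset, h2, Finset.prod_image hinj]
    have hconst : ∀ n, y n - y (n + 1) = (2 ^ m)⁻¹ := fun n => by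
      simp only [hydef]
      push_cast
      field_simp
      ring
    simp only [hconst, Finset.prod_const, ← ENNReal.ofReal_pow (Real.exp_pos _).le, ← Real.exp_nat_mul]
    rw [volume_dyadicUnion]
    congr 2
    simp
    ring
  exact ⟨X, LocFinSet.aemeasurable_of_avoid fun m I => (key m I).1, hX, fun m I => (key m I).2⟩

end Avoid


/-! ### The Poisson law of the range -/

section Law

variable {Ω : Type*} [MeasurableSpace Ω] {P : Measure Ω}

/-- Below the curve t = e^y / c, level y is kept for a time e^y / c, which exactly cancels the
density c e^{-y}. -/
theorem map_snd_timeLevelIntensity {c : ℝ} (hc : 0 < c) :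
    ((timeLevelIntensity c).restrict {p | p.1 ≤ Real.exp p.2 / c}).map Prod.snd = volume := by
  have hG : MeasurableSet {p : ℝ × ℝ | p.1 ≤ Real.exp p.2 / c} :=
    measurableSet_le measurable_fst (by fun_prop)
  ext B hB
  rw [Measure.map_apply measurable_snd hB, Measure.restrict_apply (measurable_snd hB),
    timeLevelIntensity, Measure.prod_apply_symm ((measurable_snd hB).inter hG)]
  have h1 : ∀ y : ℝ, (volume : Measure ℝ).restrict (Ici 0)
      ((fun x => (x, y)) ⁻¹' (Prod.snd ⁻¹' B ∩ {p : ℝ × ℝ | p.1 ≤ Real.exp p.2 / c}))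
      = B.indicator (fun y => ENNReal.ofReal (Real.exp y / c)) y := by
    intro y
    by_cases hy : y ∈ B
    · have : (fun x => (x, y)) ⁻¹' (Prod.snd ⁻¹' B ∩ {p : ℝ × ℝ | p.1 ≤ Real.exp p.2 / c})
          = Iic (Real.exp y / c) := by
        ext x
        simp [hy]
      rw [this, Measure.restrict_apply measurableSet_Iic, Iic_inter_Ici, Real.volume_Icc, sub_zero,
        indicator_of_mem hy]
    · have : (fun x => (x, y)) ⁻¹' (Prod.snd ⁻¹' B ∩ {p : ℝ × ℝ | p.1 ≤ Real.exp p.2 / c})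
          = ∅ := by
        ext x
        simp [hy]
      rw [this, measure_empty, indicator_of_notMem hy]
  simp only [h1]
  rw [expIntensity, lintegral_withDensity_eq_lintegral_mul _ (by fun_prop)
    (Measurable.indicator (by fun_prop) hB), ← setLIntegral_one, ← lintegral_indicator hB]
  refine lintegral_congr fun y => ?_
  by_cases hy : y ∈ B
  · rw [Pi.mul_apply, indicator_of_mem hy, indicator_of_mem hy,
      ← ENNReal.ofReal_mul (by positivity), Real.exp_neg]
    have := Real.exp_pos y
    rw [show c * (Real.exp y)⁻¹ * (Real.exp y / c) = 1 by field_simp, ENNReal.ofReal_one]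
  · rw [Pi.mul_apply, indicator_of_notMem hy, indicator_of_notMem hy, mul_zero]

theorem map_pointMeasure_map {X : Ω → LocFinSet} (hX : AEMeasurable X P) :
    (P.map X).map (fun A : LocFinSet => pointMeasure A.carrier)
      = P.map fun ω => pointMeasure (X ω).carrier :=
  AEMeasurable.map_map_of_aemeasurable LocFinSet.measurable_pointMeasure_carrier.aemeasurable hX

/-- Allows the process to be studied on the canonical space `LocFinSet` under its law; the atomic
structure is automatic for a locally finite set. -/
theorem isPoissonRandomMeasure_map_iff [IsProbabilityMeasure P] {X : Ω → LocFinSet} (hX : AEMeasurable X P)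
    {μ : Measure ℝ} :
    IsPoissonRandomMeasure (fun A : LocFinSet => pointMeasure A.carrier) μ (P.map X)
      ↔ IsPoissonRandomMeasure (fun ω => pointMeasure (X ω).carrier) μ P := by
  have := Measure.isProbabilityMeasure_map hX
  constructor
  · intro h
    refine h.of_map_eq (LocFinSet.measurable_pointMeasure_carrier.comp_aemeasurable hX)
      (map_pointMeasure_map hX).symm ?_
    exact ae_of_all _ fun ω => exists_sum_dirac_eq_pointMeasure (X ω).countable
  · intro h
    refine h.of_map_eq LocFinSet.measurable_pointMeasure_carrier.aemeasurable (map_pointMeasure_map hX) ?_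
    exact ae_of_all _ fun A => exists_sum_dirac_eq_pointMeasure A.countable

/-- The reference process is extracted from `N`: the levels of the points below the curve t = e^y /
c form a Poisson process of rate 1. Only its law on `LocFinSet` is kept. -/
theorem exists_unit_poisson [IsProbabilityMeasure P] {N : Ω → Measure (ℝ × ℝ)} {c : ℝ} (hc : 0 < c)
    (hN : IsPoissonRandomMeasure N (timeLevelIntensity c) P) :
    ∃ Q : Measure LocFinSet, IsProbabilityMeasure Q ∧
      IsPoissonRandomMeasure (fun A : LocFinSet => pointMeasure A.carrier) volume Q := by
  have hG : MeasurableSet {p : ℝ × ℝ | p.1 ≤ Real.exp p.2 / c} :=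
    measurableSet_le measurable_fst (by fun_prop)
  have h1 := (hN.restrict hG).map measurable_snd
  rw [map_snd_timeLevelIntensity hc] at h1
  obtain ⟨X, hX, hXN⟩ := h1.exists_locFinSet
  refine ⟨P.map X, Measure.isProbabilityMeasure_map hX, ?_⟩
  rw [isPoissonRandomMeasure_map_iff hX]
  exact h1.congr hXN

theorem volume_preimage_div {c : ℝ} (hc : 0 < c) (B : Set ℝ) :
    volume ((fun x => x / c) ⁻¹' B) = ENNReal.ofReal c * volume B := by
  have := Real.volume_preimage_mul_right (inv_ne_zero hc.ne') B
  simpa [div_eq_mul_inv, abs_of_pos hc] using this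

/-- A unit rate process divided by `c` avoids a set B with probability e^{-c|B|}, and avoidance
probabilities determine the law. This is how the record levels turn out to be Poisson: all their
joint counts follow from avoidance alone. -/
theorem map_eq_map_scale [IsProbabilityMeasure P] {Q : Measure LocFinSet} [IsProbabilityMeasure Q]
    (hQ : IsPoissonRandomMeasure (fun A : LocFinSet => pointMeasure A.carrier) volume Q)
    {X : Ω → LocFinSet} (hX : AEMeasurable X P) {c : ℝ} (hc : 0 < c)
    (h : ∀ m I, P {ω | Disjoint (X ω).carrier (dyadicUnion m I)}
        = ENNReal.ofReal (Real.exp (-(c * (volume (dyadicUnion m I)).toReal)))) :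
    P.map X = Q.map (LocFinSet.scale c hc) := by
  refine LocFinSet.map_eq_of_avoid hX (LocFinSet.measurable_scale hc).aemeasurable fun m I => ?_
  have hB : MeasurableSet ((fun x => x / c) ⁻¹' dyadicUnion m I) :=
    (measurable_id.div_const c) (measurableSet_dyadicUnion m I)
  have hfin : volume (dyadicUnion m I) ≠ ∞ := by
    rw [volume_dyadicUnion]
    exact ENNReal.mul_ne_top (by simp) (ENNReal.inv_ne_top.2 (by positivity))
  have hvol := volume_preimage_div hc (dyadicUnion m I)
  have := hQ.measure_eq_zero hB (by rw [hvol]; finiteness)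
  rw [hvol, ENNReal.toReal_mul, ENNReal.toReal_ofReal hc.le] at this
  simp only [h, LocFinSet.disjoint_scale, ← this, pointMeasure_apply_eq_zero _ hB]

variable {Pi : Measure ℝ} {xl xr : EReal} {N : Ω → Measure (ℝ × ℝ)}

theorem isPoissonRandomMeasure_levels (h : IsJumpIntensity Pi xl xr)
    (h0 : (0 : ℝ) ∈ window xl xr)
    (hN : IsPoissonRandomMeasure N (((volume : Measure ℝ).restrict (Ici 0)).prod Pi) P) :
    IsPoissonRandomMeasure (fun ω => (N ω).map (Prod.map id (levelScale Pi xl xr)))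
      (timeLevelIntensity (tailMass Pi xl xr 0)) P := by
  have hS : Measurable (levelScale Pi xl xr) := measurable_levelScale
  have hT := measurable_levelQuantile h h0
  have hPi := map_expIntensity_levelQuantile h h0
  have hsf : SFinite Pi := by
    rw [← hPi]
    infer_instance
  have hmap : Pi.map (levelScale Pi xl xr) = expIntensity (tailMass Pi xl xr 0) := by
    have e := Measure.map_map (μ := expIntensity (tailMass Pi xl xr 0)) hS hT
    rw [hPi] at e
    rw [e, show levelScale Pi xl xr ∘ levelQuantile h h0 = id from
      funext fun y => levelScale_levelQuantile h h0 y, Measure.map_id]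
  have := hN.map (measurable_id.prodMap hS)
  rwa [← Measure.map_prod_map _ _ measurable_id hS, Measure.map_id, hmap] at this

/-- The level scale is not injective across gaps of Π. Still, Π is an image under the quantile map,
so it charges only points that are recovered from their level, and almost surely `N` has no others.
-/
theorem ae_map_levels_eq [IsProbabilityMeasure P] (h : IsJumpIntensity Pi xl xr) (h0 : (0 : ℝ) ∈ window xl xr)
    (hN : IsPoissonRandomMeasure N (((volume : Measure ℝ).restrict (Ici 0)).prod Pi) P) :
    ∀ᵐ ω ∂P, N ω = ((N ω).map (Prod.map id (levelScale Pi xl xr))).map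
      (Prod.map id (levelQuantile h h0)) := by
  have hS : Measurable (levelScale Pi xl xr) := measurable_levelScale
  have hT := measurable_levelQuantile h h0
  have hPi := map_expIntensity_levelQuantile h h0
  have hsf : SFinite Pi := by
    rw [← hPi]
    infer_instance
  set D : Set ℝ := {x | levelQuantile h h0 (levelScale Pi xl xr x) = x}
  have hD : MeasurableSet D := measurableSet_eq_fun (hT.comp hS) measurable_id
  have hnull : Pi Dᶜ = 0 := by
    have hpre : levelQuantile h h0 ⁻¹' Dᶜ = ∅ := by
      ext y
      simp [D, levelScale_levelQuantile]
    have e := Measure.map_apply (μ := expIntensity (tailMass Pi xl xr 0)) hT hD.compl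
    rwa [hPi, hpre, measure_empty] at e
  have hz : ((volume : Measure ℝ).restrict (Ici 0)).prod Pi (univ ×ˢ Dᶜ) = 0 := by
    rw [Measure.prod_prod, hnull, mul_zero]
  filter_upwards [hN.ae_eq_zero (MeasurableSet.univ.prod hD.compl) hz] with ω hω
  rw [Measure.map_map (measurable_id.prodMap hT) (measurable_id.prodMap hS)]
  have hae : (Prod.map id (levelQuantile h h0) ∘ Prod.map id (levelScale Pi xl xr))
      =ᵐ[N ω] id := by
    refine measure_mono_null ?_ hω
    intro p hp
    refine ⟨mem_univ _, fun hpD => hp ?_⟩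
    exact Prod.ext rfl hpD
  rw [Measure.map_congr hae, Measure.map_id]

/-- The range of the `r`-th extremal process, on the level scale, has the law of a unit rate
Poisson process divided by `r`. -/
theorem exists_levels_of_extremalRange [IsProbabilityMeasure P] (h : IsJumpIntensity Pi xl xr)
    (h0 : (0 : ℝ) ∈ window xl xr)
    (hN : IsPoissonRandomMeasure N (((volume : Measure ℝ).restrict (Ici 0)).prod Pi) P)
    {Q : Measure LocFinSet} [IsProbabilityMeasure Q]
    (hQ : IsPoissonRandomMeasure (fun A : LocFinSet => pointMeasure A.carrier) volume Q)
    {r : ℕ} (hr : 1 ≤ r) :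
    ∃ X : Ω → LocFinSet, AEMeasurable X P ∧
      (∀ᵐ ω ∂P, extremalRange xl xr (N ω) r = levelQuantile h h0 '' (X ω).carrier) ∧
      P.map X = Q.map (LocFinSet.scale r (Nat.cast_pos.2 hr)) := by
  have hc := tailMass_pos h h0
  have hN' := isPoissonRandomMeasure_levels h h0 hN
  obtain ⟨X, hX, hXr, hXP⟩ := exists_recordSet hc hN' hr
  refine ⟨X, hX, ?_, map_eq_map_scale hQ hX _ hXP⟩
  have hT := measurable_levelQuantile h h0
  filter_upwards [hXr, ae_isRegularConfig hc hN', ae_map_levels_eq h h0 hN] with ω h1 h2 h3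
  rw [h1]
  refine extremalRange_eq_image (strictMono_levelQuantile h h0) (levelQuantile_mem h h0) h2.1
    (fun B hB => ?_) hr
  refine (congrArg (fun m => m B) h3).trans ?_
  rw [Measure.map_apply (measurable_id.prodMap hT) hB,
    h2.2 _ ((measurable_id.prodMap hT) hB)]
  rfl

/-! ### The positive and the negative part of the range -/

/-- The Poisson property depends only on the law, so it is transferred from the scaled unit process.
-/
theorem isPoissonRandomMeasure_scale [IsProbabilityMeasure P] {Q : Measure LocFinSet} [IsProbabilityMeasure Q]
    (hQ : IsPoissonRandomMeasure (fun A : LocFinSet => pointMeasure A.carrier) volume Q)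
    {X : Ω → LocFinSet} (hX : AEMeasurable X P) {r : ℕ} (hr : 1 ≤ r)
    (hlaw : P.map X = Q.map (LocFinSet.scale r (Nat.cast_pos.2 hr))) :
    IsPoissonRandomMeasure (fun ω => pointMeasure (X ω).carrier) ((r : ℝ≥0∞) • volume) P := by
  have hr0 : (0 : ℝ) < r := Nat.cast_pos.2 hr
  have hd : Measurable fun x : ℝ => x / r := measurable_id.div_const _
  rw [← isPoissonRandomMeasure_map_iff hX, hlaw,
    isPoissonRandomMeasure_map_iff (LocFinSet.measurable_scale hr0).aemeasurable]
  have h1 := hQ.map hd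
  have h2 : (volume : Measure ℝ).map (fun x : ℝ => x / (r : ℝ)) = (r : ℝ≥0∞) • volume := by
    ext B hB
    rw [Measure.map_apply hd hB, volume_preimage_div hr0, Measure.smul_apply, smul_eq_mul,
      ENNReal.ofReal_natCast]
  rw [h2] at h1
  refine h1.congr (ae_of_all _ fun A => ?_)
  exact pointMeasure_map hd fun x _ y _ hxy => by
    have : x / (r : ℝ) = y / r := hxy
    rwa [div_left_inj' hr0.ne'] at this

theorem indepFun_comp_of_map {E E' : Type*} [MeasurableSpace E] [MeasurableSpace E']
    {X : Ω → LocFinSet} (hX : AEMeasurable X P) {f : LocFinSet → E} {g : LocFinSet → E'}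
    (hf : Measurable f) (hg : Measurable g) (hfg : IndepFun f g (P.map X)) :
    IndepFun (fun ω => f (X ω)) (fun ω => g (X ω)) P := by
  rw [indepFun_iff_measure_inter_preimage_eq_mul] at hfg ⊢
  intro s t hs ht
  have := hfg s t hs ht
  rwa [Measure.map_apply_of_aemeasurable hX (hf hs), Measure.map_apply_of_aemeasurable hX (hg ht),
    Measure.map_apply_of_aemeasurable hX ((hf hs).inter (hg ht))] at this

variable (h : IsJumpIntensity Pi xl xr) (h0 : (0 : ℝ) ∈ window xl xr)

theorem image_levelQuantile_inter_Ioi (A : Set ℝ) :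
    levelQuantile h h0 '' A ∩ Ioi 0 = levelQuantile h h0 '' (A ∩ Ioi 0) := by
  ext x
  constructor
  · rintro ⟨⟨y, hy, rfl⟩, hx⟩
    exact ⟨y, ⟨hy, (levelQuantile_pos_iff h h0).1 hx⟩, rfl⟩
  · rintro ⟨y, ⟨hy, hy0⟩, rfl⟩
    exact ⟨⟨y, hy, rfl⟩, (levelQuantile_pos_iff h h0).2 hy0⟩

/-- Level 0 must be absent because its quantile may be strictly negative. -/
theorem image_levelQuantile_inter_Iio {A : Set ℝ} (hA : (0 : ℝ) ∉ A) :
    levelQuantile h h0 '' A ∩ Iio 0 = levelQuantile h h0 '' (A ∩ Iio 0) := by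
  ext x
  constructor
  · rintro ⟨⟨y, hy, rfl⟩, hx⟩
    have hy0 : y ≠ 0 := by
      rintro rfl
      exact hA hy
    refine ⟨y, ⟨hy, lt_of_le_of_ne (not_lt.1 fun h' => ?_) hy0⟩, rfl⟩
    exact lt_asymm hx ((levelQuantile_pos_iff h h0).2 h')
  · rintro ⟨y, ⟨hy, hy0⟩, rfl⟩
    exact ⟨⟨y, hy, rfl⟩, levelQuantile_neg h h0 hy0⟩

/-- The counting measure of the image of the part of `A` in `D`. -/
noncomputable def imageMeasure (D : Set ℝ) (g : ℝ → ℝ) (A : LocFinSet) : Measure ℝ :=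
  (pointMeasure (A.carrier ∩ D)).map g

theorem measurable_imageMeasure {D : Set ℝ} (hD : MeasurableSet D) {g : ℝ → ℝ}
    (hg : Measurable g) : Measurable (imageMeasure D g) :=
by
  have h1 := LocFinSet.measurable_pointMeasure_carrier.comp (LocFinSet.measurable_inter hD)
  exact (Measure.measurable_map g hg).comp h1

theorem imageMeasure_eq {D : Set ℝ} {g : ℝ → ℝ} (hg : Measurable g) (A : LocFinSet)
    (hi : InjOn g (A.carrier ∩ D)) :
    imageMeasure D g A = pointMeasure (g '' (A.carrier ∩ D)) :=
  pointMeasure_map hg hi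

theorem isPoissonRandomMeasure_imageMeasure {X : Ω → LocFinSet} {μ : Measure ℝ}
    (hX : IsPoissonRandomMeasure (fun ω => pointMeasure (X ω).carrier) μ P) {D : Set ℝ}
    (hD : MeasurableSet D) {g : ℝ → ℝ} (hg : Measurable g) :
    IsPoissonRandomMeasure (fun ω => imageMeasure D g (X ω)) ((μ.restrict D).map g) P := by
  have := (hX.restrict hD).map hg
  simp only [pointMeasure_restrict _ hD] at this
  exact this

theorem indepFun_imageMeasure [IsProbabilityMeasure P] {X : Ω → LocFinSet} (hX : AEMeasurable X P) {μ : Measure ℝ}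
    (hXμ : IsPoissonRandomMeasure (fun ω => pointMeasure (X ω).carrier) μ P) {D D' : Set ℝ}
    (hD : MeasurableSet D) (hD' : MeasurableSet D') (hdisj : Disjoint D D') {g g' : ℝ → ℝ}
    (hg : Measurable g) (hg' : Measurable g') :
    IndepFun (fun ω => imageMeasure D g (X ω)) (fun ω => imageMeasure D' g' (X ω)) P := by
  have := Measure.isProbabilityMeasure_map hX
  refine indepFun_comp_of_map hX (measurable_imageMeasure hD hg) (measurable_imageMeasure hD' hg')
    ?_
  have h1 := indepFun_inter ((isPoissonRandomMeasure_map_iff hX).2 hXμ) hD hD' hdisj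
  exact h1.comp ((Measure.measurable_map g hg).comp LocFinSet.measurable_pointMeasure_carrier)
    ((Measure.measurable_map g' hg').comp LocFinSet.measurable_pointMeasure_carrier)

theorem map_restrict_Ioi_levelQuantile :
    ((volume : Measure ℝ).restrict (Ioi 0)).map (levelQuantile h h0) = recordMeasurePos h := by
  rw [recordMeasurePos, ← map_volume_levelQuantile h h0,
    Measure.restrict_map (measurable_levelQuantile h h0) measurableSet_Ioi]
  congr 2
  ext y
  exact (levelQuantile_pos_iff h h0).symm

theorem map_restrict_Iio_levelQuantile :
    ((volume : Measure ℝ).restrict (Iio 0)).map (fun y => -levelQuantile h h0 y)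
      = recordMeasureNeg h := by
  have hT := measurable_levelQuantile h h0
  rw [recordMeasureNeg, ← map_volume_levelQuantile h h0,
    Measure.restrict_map hT measurableSet_Iio, Measure.map_map measurable_neg hT]
  -- The two sets differ at most by the point 0.
  have : (volume : Measure ℝ).restrict (levelQuantile h h0 ⁻¹' Iio 0)
      = (volume : Measure ℝ).restrict (Iio 0) := by
    refine Measure.restrict_congr_set ?_
    have h1 : ∀ᵐ y : ℝ, y ≠ 0 := by simp [ae_iff]
    filter_upwards [h1] with y hy
    refine propext ⟨fun h' => ?_, fun h' => levelQuantile_neg h h0 h'⟩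
    refine lt_of_le_of_ne (not_lt.1 fun h'' => ?_) hy
    exact lt_asymm h' ((levelQuantile_pos_iff h h0).2 h'')
  rw [this]
  rfl

theorem ae_zero_notMem [IsProbabilityMeasure P] {X : Ω → LocFinSet} {μ : Measure ℝ} (hμ : μ {0} = 0)
    (hX : IsPoissonRandomMeasure (fun ω => pointMeasure (X ω).carrier) μ P) :
    ∀ᵐ ω ∂P, (0 : ℝ) ∉ (X ω).carrier := by
  filter_upwards [hX.ae_eq_zero (measurableSet_singleton 0) hμ] with ω hω
  rw [pointMeasure_apply_eq_zero _ (measurableSet_singleton 0), disjoint_singleton_right] at hω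
  exact hω

end Law


/-! ### The law of the range for fixed order -/

section FixedOrder

variable {Pi : Measure ℝ} {xl xr : EReal} (h : IsJumpIntensity Pi xl xr)

variable (h0 : (0 : ℝ) ∈ window xl xr)

theorem zero_notMem_image_levelQuantile {A : Set ℝ} (hA : (0 : ℝ) ∉ A) :
    (0 : ℝ) ∉ levelQuantile h h0 '' A := by
  rintro ⟨y, hy, hy0⟩
  rcases lt_trichotomy y 0 with hlt | rfl | hgt
  · exact (levelQuantile_neg h h0 hlt).ne hy0
  · exact hA hy
  · exact ((levelQuantile_pos_iff h h0).2 hgt).ne' hy0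

theorem pointMeasure_image_pos {A : LocFinSet} {k : ℝ → ℝ} (hk : Measurable k)
    (hki : Function.Injective k) :
    pointMeasure (k '' (levelQuantile h h0 '' A.carrier ∩ Ioi 0))
      = imageMeasure (Ioi 0) (fun y => k (levelQuantile h h0 y)) A := by
  rw [image_levelQuantile_inter_Ioi, imageMeasure_eq (g := fun y => k (levelQuantile h h0 y))
      (hk.comp (measurable_levelQuantile h h0)) A
    (hki.comp (strictMono_levelQuantile h h0).injective).injOn, image_image]

theorem pointMeasure_image_neg {A : LocFinSet} (hA : (0 : ℝ) ∉ A.carrier) {k : ℝ → ℝ}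
    (hk : Measurable k) (hki : Function.Injective k) :
    pointMeasure (k '' (levelQuantile h h0 '' A.carrier ∩ Iio 0))
      = imageMeasure (Iio 0) (fun y => k (levelQuantile h h0 y)) A := by
  rw [image_levelQuantile_inter_Iio h h0 hA,
    imageMeasure_eq (g := fun y => k (levelQuantile h h0 y))
      (hk.comp (measurable_levelQuantile h h0)) A
    (hki.comp (strictMono_levelQuantile h h0).injective).injOn, image_image]

theorem isPoissonRandomMeasure_extremalRange (h0 : (0 : ℝ) ∈ window xl xr) {Ω : Type*} [MeasurableSpace Ω] {P : Measure Ω}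
    [IsProbabilityMeasure P] {N : Ω → Measure (ℝ × ℝ)}
    (hN : IsPoissonRandomMeasure N (((volume : Measure ℝ).restrict (Ici 0)).prod Pi) P)
    {r : ℕ} (hr : 1 ≤ r) :
    (∀ᵐ ω ∂P, extremalRange xl xr (N ω) r
      = extremalRangePos xl xr (N ω) r ∪ extremalRangeNeg xl xr (N ω) r) ∧
    IsPoissonRandomMeasure (fun ω => pointMeasure (extremalRangePos xl xr (N ω) r))
      ((r : ℝ≥0∞) • recordMeasurePos h) P ∧
    IsPoissonRandomMeasure
      (fun ω => pointMeasure ((fun x : ℝ => -x) '' extremalRangeNeg xl xr (N ω) r))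
      ((r : ℝ≥0∞) • recordMeasureNeg h) P ∧
    IndepFun (fun ω => pointMeasure (extremalRangePos xl xr (N ω) r))
      (fun ω => pointMeasure (extremalRangeNeg xl xr (N ω) r)) P := by
  obtain ⟨Q, hQ, hQN⟩ := exists_unit_poisson (tailMass_pos h h0)
    (isPoissonRandomMeasure_levels h h0 hN)
  obtain ⟨X, hX, hXr, hXQ⟩ := exists_levels_of_extremalRange h h0 hN hQN hr
  have hXP := isPoissonRandomMeasure_scale hQN hX hr hXQ
  have hX0 := ae_zero_notMem (by simp) hXP
  have hT := measurable_levelQuantile h h0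
  have hpos : (fun ω => imageMeasure (Ioi 0) (levelQuantile h h0) (X ω))
      =ᵐ[P] fun ω => pointMeasure (extremalRangePos xl xr (N ω) r) := by
    filter_upwards [hXr] with ω h1
    have := pointMeasure_image_pos h h0 (A := X ω) measurable_id Function.injective_id
    rw [image_id] at this
    rw [extremalRangePos, h1, this]
    rfl
  have hneg : (fun ω => imageMeasure (Iio 0) (levelQuantile h h0) (X ω))
      =ᵐ[P] fun ω => pointMeasure (extremalRangeNeg xl xr (N ω) r) := by
    filter_upwards [hXr, hX0] with ω h1 h2
    have := pointMeasure_image_neg h h0 h2 measurable_id Function.injective_id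
    rw [image_id] at this
    rw [extremalRangeNeg, h1, this]
    rfl
  have hneg' : (fun ω => imageMeasure (Iio 0) (fun y => -levelQuantile h h0 y) (X ω))
      =ᵐ[P] fun ω => pointMeasure ((fun x : ℝ => -x) '' extremalRangeNeg xl xr (N ω) r) := by
    filter_upwards [hXr, hX0] with ω h1 h2
    rw [extremalRangeNeg, h1, ← pointMeasure_image_neg h h0 h2 measurable_neg neg_injective]
  refine ⟨?_, ?_, ?_, ?_⟩
  · filter_upwards [hXr, hX0] with ω h1 h2
    have := zero_notMem_image_levelQuantile h h0 h2
    rw [← h1] at this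
    rw [extremalRangePos, extremalRangeNeg, ← inter_union_distrib_left, union_comm,
      Iio_union_Ioi, eq_comm, inter_eq_left]
    exact fun x hx hx0 => this (hx0 ▸ hx)
  · have := isPoissonRandomMeasure_imageMeasure hXP measurableSet_Ioi hT (D := Ioi 0)
    rw [Measure.restrict_smul, Measure.map_smul, map_restrict_Ioi_levelQuantile] at this
    exact this.congr hpos
  · have := isPoissonRandomMeasure_imageMeasure hXP measurableSet_Iio hT.neg (D := Iio 0)
    rw [Measure.restrict_smul, Measure.map_smul] at this
    have e := map_restrict_Iio_levelQuantile h h0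
    rw [← e]
    exact this.congr hneg'
  · exact (indepFun_imageMeasure hX hXP measurableSet_Ioi measurableSet_Iio
      (by simp [Set.disjoint_left]; intros; linarith) hT hT).congr hpos hneg

end FixedOrder


/-! ### Generalized inverses of distribution functions -/

section Quantile

/-- `v` is a value at `u` of a generalized inverse of the nondecreasing function `F`. -/
structure IsGenInverseAt (F : ℝ → ℝ≥0∞) (u v : ℝ) : Prop where
  le_of_lt : ∀ x, ENNReal.ofReal u < F x → v ≤ x
  le_of_le : ∀ x, v ≤ x → ENNReal.ofReal u ≤ F x

/-- The quantile function of a measure on the half-line. -/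
noncomputable def halfLineQuantile (σ : Measure ℝ) (u : ℝ) : ℝ :=
  sInf {x : ℝ | ENNReal.ofReal u ≤ σ (Ioc 0 x)}

variable {σ : Measure ℝ}

theorem measure_Ioc_mono : Monotone fun x : ℝ => σ (Ioc 0 x) := fun _ _ hxy =>
  measure_mono (Ioc_subset_Ioc_right hxy)

theorem IsInfiniteRadonOnHalfLine.measure_Ioc_eq (hσ : IsInfiniteRadonOnHalfLine σ) (x : ℝ) :
    σ (Ioc 0 x) = σ (Iic x) := by
  refine le_antisymm (measure_mono Ioc_subset_Iic_self) ?_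
  calc σ (Iic x) ≤ σ (Iic 0 ∪ Ioc 0 x) := measure_mono fun y hy => by
        rcases le_or_gt y 0 with h | h
        · exact Or.inl h
        · exact Or.inr ⟨h, hy⟩
    _ ≤ σ (Iic 0) + σ (Ioc 0 x) := measure_union_le _ _
    _ = _ := by rw [hσ.concentrated, zero_add]

theorem pos_of_ofReal_le {u x : ℝ} (hu : 0 < u) (hx : ENNReal.ofReal u ≤ σ (Ioc 0 x)) : 0 < x := by
  by_contra hle
  rw [Ioc_eq_empty hle, measure_empty] at hx
  exact (ENNReal.ofReal_pos.2 hu).not_ge hx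

theorem IsInfiniteRadonOnHalfLine.exists_le (hσ : IsInfiniteRadonOnHalfLine σ) (u : ℝ) :
    ∃ x : ℝ, ENNReal.ofReal u ≤ σ (Ioc 0 x) := by
  have hm : Monotone fun n : ℕ => Iic (n : ℝ) := fun n m hnm =>
    Iic_subset_Iic.2 (Nat.cast_le.2 hnm)
  have ht := tendsto_measure_iUnion_atTop (μ := σ) hm
  have hU : ⋃ n : ℕ, Iic (n : ℝ) = univ :=
    eq_univ_of_forall fun x => mem_iUnion.2 (exists_nat_ge x)
  rw [hU, hσ.infinite] at ht
  obtain ⟨n, hn⟩ := (ht.eventually_const_lt (ENNReal.ofReal_lt_top (r := u))).exists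
  exact ⟨n, by rw [hσ.measure_Ioc_eq]; exact hn.le⟩

/-- For `u ≤ 0` the defining set is the whole line, and the value is the conventional infimum 0. -/
theorem halfLineQuantile_nonneg (u : ℝ) : 0 ≤ halfLineQuantile σ u := by
  rcases le_or_gt u 0 with hu | hu
  · have : {x : ℝ | ENNReal.ofReal u ≤ σ (Ioc 0 x)} = univ :=
      eq_univ_of_forall fun x => by simp [ENNReal.ofReal_of_nonpos hu]
    rw [halfLineQuantile, this, Real.sInf_univ]
  · exact Real.sInf_nonneg fun x hx => (pos_of_ofReal_le hu hx).le

/-- The infimum is attained because the distribution function is right-continuous; this is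
continuity from above, available as σ is finite on bounded intervals. -/
theorem IsInfiniteRadonOnHalfLine.halfLineQuantile_le_iff (hσ : IsInfiniteRadonOnHalfLine σ)
    {u x : ℝ} (hu : 0 < u) :
    halfLineQuantile σ u ≤ x ↔ ENNReal.ofReal u ≤ σ (Ioc 0 x) := by
  have hbdd : BddBelow {x : ℝ | ENNReal.ofReal u ≤ σ (Ioc 0 x)} :=
    ⟨0, fun x hx => (pos_of_ofReal_le hu hx).le⟩
  refine ⟨fun hle => ?_, fun hx => csInf_le hbdd hx⟩
  have hgt : ∀ z, halfLineQuantile σ u < z → ENNReal.ofReal u ≤ σ (Ioc 0 z) := by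
    intro z hz
    obtain ⟨y, hy, hyz⟩ := exists_lt_of_csInf_lt (hσ.exists_le u) hz
    exact le_trans hy (measure_Ioc_mono hyz.le)
  have hm : Antitone fun n : ℕ => Ioc 0 (x + 1 / ((n : ℝ) + 1)) := by
    intro n m hnm
    have := Nat.one_div_le_one_div (α := ℝ) hnm
    exact Ioc_subset_Ioc_right (by linarith)
  have hI : ⋂ n : ℕ, Ioc 0 (x + 1 / ((n : ℝ) + 1)) = Ioc 0 x := by
    ext y
    simp only [mem_iInter, mem_Ioc]
    constructor
    · refine fun hy => ⟨(hy 0).1, le_of_forall_pos_lt_add fun ε hε => ?_⟩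
      obtain ⟨n, hn⟩ := exists_nat_one_div_lt hε
      linarith [(hy n).2]
    · intro hy n
      have : (0 : ℝ) < 1 / ((n : ℝ) + 1) := by positivity
      exact ⟨hy.1, by linarith [hy.2]⟩
  have ht := tendsto_measure_iInter_atTop (μ := σ)
    (fun n : ℕ => (measurableSet_Ioc (a := (0 : ℝ)) (b := x + 1 / ((n : ℝ) + 1))).nullMeasurableSet)
    hm ⟨0, (hσ.finite _).ne⟩
  rw [hI] at ht
  refine ge_of_tendsto' ht fun n => hgt _ ?_
  have : (0 : ℝ) < 1 / ((n : ℝ) + 1) := by positivity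
  linarith

theorem IsInfiniteRadonOnHalfLine.isGenInverseAt (hσ : IsInfiniteRadonOnHalfLine σ) {u : ℝ}
    (hu : 0 < u) : IsGenInverseAt (fun x => σ (Ioc 0 x)) u (halfLineQuantile σ u) :=
  ⟨fun _ hx => (hσ.halfLineQuantile_le_iff hu).2 hx.le,
    fun _ hx => (hσ.halfLineQuantile_le_iff hu).1 hx⟩

theorem IsInfiniteRadonOnHalfLine.monotone_halfLineQuantile (hσ : IsInfiniteRadonOnHalfLine σ) :
    Monotone (halfLineQuantile σ) := by
  intro u v huv
  rcases le_or_gt u 0 with hu | hu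
  · have : {x : ℝ | ENNReal.ofReal u ≤ σ (Ioc 0 x)} = univ :=
      eq_univ_of_forall fun x => by simp [ENNReal.ofReal_of_nonpos hu]
    calc halfLineQuantile σ u = 0 := by rw [halfLineQuantile, this, Real.sInf_univ]
      _ ≤ _ := halfLineQuantile_nonneg v
  · rw [hσ.halfLineQuantile_le_iff hu]
    exact (ENNReal.ofReal_le_ofReal huv).trans
      ((hσ.halfLineQuantile_le_iff (hu.trans_le huv)).1 le_rfl)

/-- Inverse transform: the quantile function pulls (a, b] back to the interval from F(a) to F(b),
whose length is the mass of (a, b]. -/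
theorem IsInfiniteRadonOnHalfLine.map_halfLineQuantile (hσ : IsInfiniteRadonOnHalfLine σ) :
    ((volume : Measure ℝ).restrict (Ioi 0)).map (halfLineQuantile σ) = σ := by
  have hq := hσ.monotone_halfLineQuantile.measurable
  have hw : (window ⊥ ⊤)ᶜ = ∅ := by
    rw [compl_empty_iff]
    exact eq_univ_of_forall fun x => ⟨EReal.bot_lt_coe x, EReal.coe_lt_top x⟩
  have hIoc : ∀ a b : ℝ, a < b →
      ((volume : Measure ℝ).restrict (Ioi 0)).map (halfLineQuantile σ) (Ioc a b)
        = σ (Ioc a b) := by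
    intro a b hab
    have hpre : halfLineQuantile σ ⁻¹' Ioc a b ∩ Ioi 0
        = Ioc (σ (Ioc 0 a)).toReal (σ (Ioc 0 b)).toReal := by
      ext u
      simp only [mem_inter_iff, mem_preimage, mem_Ioc, mem_Ioi]
      constructor
      · rintro ⟨⟨h1, h2⟩, hu⟩
        rw [← not_le, hσ.halfLineQuantile_le_iff hu, not_le,
          ENNReal.lt_ofReal_iff_toReal_lt (hσ.finite a).ne] at h1
        rw [hσ.halfLineQuantile_le_iff hu, ENNReal.ofReal_le_iff_le_toReal (hσ.finite b).ne] at h2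
        exact ⟨h1, h2⟩
      · rintro ⟨h1, h2⟩
        have hu : 0 < u := ENNReal.toReal_nonneg.trans_lt h1
        refine ⟨⟨?_, ?_⟩, hu⟩
        · rwa [← not_le, hσ.halfLineQuantile_le_iff hu, not_le,
            ENNReal.lt_ofReal_iff_toReal_lt (hσ.finite a).ne]
        · rwa [hσ.halfLineQuantile_le_iff hu, ENNReal.ofReal_le_iff_le_toReal (hσ.finite b).ne]
    rw [Measure.map_apply hq measurableSet_Ioc,
      Measure.restrict_apply (hq measurableSet_Ioc), hpre, Real.volume_Ioc,
      ENNReal.ofReal_sub _ ENNReal.toReal_nonneg, ENNReal.ofReal_toReal (hσ.finite a).ne,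
      ENNReal.ofReal_toReal (hσ.finite b).ne, hσ.measure_Ioc_eq, hσ.measure_Ioc_eq,
      show Ioc a b = Iic b \ Iic a by ext; simp [and_comm],
      measure_sdiff (Iic_subset_Iic.2 hab.le) measurableSet_Iic.nullMeasurableSet]
    rw [← hσ.measure_Ioc_eq]
    exact (hσ.finite a).ne
  refine measure_ext_window (xl := ⊥) (xr := ⊤) ⟨EReal.bot_lt_coe 0, EReal.coe_lt_top 0⟩
    (by rw [hw, measure_empty]) (by rw [hw, measure_empty]) (fun a _ b _ hab => ?_)
    fun a _ b _ hab => hIoc a b hab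
  rw [hIoc a b hab]
  refine ((measure_mono Ioc_subset_Iic_self).trans_lt ?_).ne
  rw [← hσ.measure_Ioc_eq]
  exact hσ.finite b

/-- The values at which the generalized inverse may fail to be continuous in the function. -/
noncomputable def exceptionalLevels (σ : Measure ℝ) : Set ℝ :=
  range fun q : ℚ => (σ (Ioc 0 (q : ℝ))).toReal

/-- The inverses are trapped between rationals on either side of the limit. To the left of the
quantile the limit function is automatically below `u`. To the right it is only at least `u`, and
strictness there is what excluding the exceptional levels provides. -/
theorem tendsto_of_isGenInverseAt (hσ : IsInfiniteRadonOnHalfLine σ) {F : ℕ → ℝ → ℝ≥0∞}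
    (hF : ∀ x, 0 < x → Tendsto (fun n => F n x) atTop (𝓝 (σ (Ioc 0 x)))) {u : ℝ} (hu : 0 < u)
    (hue : u ∉ exceptionalLevels σ) {v : ℕ → ℝ} (hv : ∀ᶠ n in atTop, IsGenInverseAt (F n) u (v n)) :
    Tendsto v atTop (𝓝 (halfLineQuantile σ u)) := by
  have hne : ∀ q : ℚ, ENNReal.ofReal u ≠ σ (Ioc 0 (q : ℝ)) := fun q hq =>
    hue ⟨q, by simp only [← hq, ENNReal.toReal_ofReal hu.le]⟩
  have hpos : 0 < halfLineQuantile σ u :=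
    pos_of_ofReal_le hu ((hσ.halfLineQuantile_le_iff hu).1 le_rfl)
  refine tendsto_order.2 ⟨fun c hc => ?_, fun c hc => ?_⟩
  -- The maximum with 0 keeps `q` positive, as convergence is assumed at positive points only.
  · obtain ⟨q, hq1, hq2⟩ := exists_rat_btwn (max_lt hc hpos)
    have hlt : σ (Ioc 0 (q : ℝ)) < ENNReal.ofReal u := by
      rwa [← not_le, ← hσ.halfLineQuantile_le_iff hu, not_le]
    filter_upwards [hv, (hF q ((le_max_right _ _).trans_lt hq1)).eventually_lt_const hlt]
      with n h1 h2
    refine ((le_max_left _ _).trans_lt hq1).trans (lt_of_not_ge fun hle => ?_)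
    exact (h1.le_of_le _ hle).not_gt h2
  · obtain ⟨q, hq1, hq2⟩ := exists_rat_btwn hc
    have hlt : ENNReal.ofReal u < σ (Ioc 0 (q : ℝ)) :=
      lt_of_le_of_ne ((hσ.halfLineQuantile_le_iff hu).1 hq1.le) (hne q)
    filter_upwards [hv, (hF q (hpos.trans hq1)).eventually_const_lt hlt] with n h1 h2
    exact (h1.le_of_lt _ h2).trans_lt hq2

end Quantile

/-! ### Vague convergence of point measures -/

section Vague

theorem tendsto_vagueTopology {E : Type*} [TopologicalSpace E] [MeasurableSpace E]
    {m : ℕ → Measure E} {m' : Measure E}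
    (hm : ∀ f : C_c(E, ℝ≥0), Tendsto (fun n => ∫⁻ x, (f x : ℝ≥0∞) ∂m n) atTop
      (𝓝 (∫⁻ x, (f x : ℝ≥0∞) ∂m'))) :
    Tendsto m atTop (@nhds _ (vagueTopology E) m') := by
  rw [vagueTopology, nhds_iInf, tendsto_iInf]
  intro f
  rw [nhds_induced, tendsto_comap_iff]
  exact hm f

theorem lintegral_pointMeasure (A : Set ℝ) {f : ℝ → ℝ≥0∞} (hf : Measurable f) :
    ∫⁻ x, f x ∂pointMeasure A = ∑' x : A, f x := by
  rw [pointMeasure, lintegral_sum_measure]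
  exact tsum_congr fun x => lintegral_dirac' _ hf

/-- Only finitely many points contribute: those with large `τ` are moved to the right of the support
of `f`, uniformly in large `n`. The remaining finite sums converge term by term. -/
theorem tendsto_lintegral_map_pointMeasure {σ : Measure ℝ} (hσ : IsInfiniteRadonOnHalfLine σ)
    {F : ℕ → ℝ → ℝ≥0∞} (hF : ∀ x, 0 < x → Tendsto (fun n => F n x) atTop (𝓝 (σ (Ioc 0 x))))
    {A : Set ℝ} {τ : ℝ → ℝ} (hτ : Measurable τ) (hpos : ∀ x ∈ A, 0 < τ x)
    (hfin : ∀ M, (A ∩ {x | τ x ≤ M}).Finite) (hexc : ∀ x ∈ A, τ x ∉ exceptionalLevels σ)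
    {g : ℕ → ℝ → ℝ} (hg : ∀ n, Measurable (g n))
    (hgF : ∀ᶠ n in atTop, ∀ x ∈ A, IsGenInverseAt (F n) (τ x) (g n x)) (f : C_c(ℝ, ℝ≥0)) :
    Tendsto (fun n => ∫⁻ x, (f x : ℝ≥0∞) ∂(pointMeasure A).map (g n)) atTop
      (𝓝 (∫⁻ x, (f x : ℝ≥0∞) ∂(pointMeasure A).map fun x => halfLineQuantile σ (τ x))) := by
  have hfm : Measurable fun x => (f x : ℝ≥0∞) := f.continuous.measurable.coe_nnreal_ennreal
  have hq : Measurable fun x => halfLineQuantile σ (τ x) :=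
    hσ.monotone_halfLineQuantile.measurable.comp hτ
  have hint : ∀ k : ℝ → ℝ, Measurable k →
      ∫⁻ x, (f x : ℝ≥0∞) ∂(pointMeasure A).map k = ∑' x : A, (f (k x) : ℝ≥0∞) := by
    intro k hk
    rw [lintegral_map hfm hk]
    exact lintegral_pointMeasure A (hfm.comp hk)
  simp only [hint _ (hg _), hint _ hq]
  obtain ⟨K₀, hK₀⟩ := f.hasCompactSupport.isCompact.bddAbove
  set K := max K₀ 1
  have hK : 0 < K := lt_max_of_lt_right one_pos
  have hfK : ∀ x, K < x → f x = 0 := fun x hx => by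
    by_contra hne
    exact (hK₀ (subset_tsupport _ hne)).not_gt ((le_max_left _ _).trans_lt hx)
  -- Any value above the mass of (0, K] works: a generalized inverse at a larger value exceeds `K`
  -- once `F n K < M`. The bound `K` is at least 1 so that the convergence of `F n` applies at `K`.
  set M := (σ (Ioc 0 K)).toReal + 1
  have hM : σ (Ioc 0 K) < ENNReal.ofReal M := by
    rw [ENNReal.lt_ofReal_iff_toReal_lt (hσ.finite K).ne]
    exact lt_add_one _
  have hzero : ∀ {G : ℝ → ℝ≥0∞} {u v : ℝ}, IsGenInverseAt G u v → G K < ENNReal.ofReal M →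
      M < u → (f v : ℝ≥0∞) = 0 := by
    intro G u v hG hGK hu
    rw [ENNReal.coe_eq_zero]
    refine hfK _ (lt_of_not_ge fun hle => ?_)
    exact ((hG.le_of_le _ hle).trans_lt hGK).not_ge (ENNReal.ofReal_le_ofReal hu.le)
  have hsfin : {x : A | τ x ≤ M}.Finite := by
    refine Finite.of_finite_image ((hfin M).subset ?_) Subtype.val_injective.injOn
    rintro _ ⟨x, hx, rfl⟩
    exact ⟨x.2, hx⟩
  have hlim : ∑' x : A, (f (halfLineQuantile σ (τ x)) : ℝ≥0∞)
      = ∑ x ∈ hsfin.toFinset, (f (halfLineQuantile σ (τ x)) : ℝ≥0∞) := by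
    refine tsum_eq_sum fun x hx => ?_
    rw [Finite.mem_toFinset, mem_ofPred_eq, not_le] at hx
    exact hzero (hσ.isGenInverseAt (hpos x x.2)) hM hx
  rw [hlim]
  have hsum : Tendsto (fun n => ∑ x ∈ hsfin.toFinset, (f (g n x) : ℝ≥0∞)) atTop
      (𝓝 (∑ x ∈ hsfin.toFinset, (f (halfLineQuantile σ (τ x)) : ℝ≥0∞))) := by
    refine tendsto_finsetSum _ fun x _ => ?_
    refine ((ENNReal.continuous_coe.comp f.continuous).tendsto _).comp ?_
    exact tendsto_of_isGenInverseAt hσ hF (hpos x x.2) (hexc x x.2)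
      (hgF.mono fun n hn => hn x x.2)
  refine hsum.congr' ?_
  filter_upwards [hgF, (hF K hK).eventually_lt_const hM] with n h1 h2
  refine (tsum_eq_sum fun x hx => ?_).symm
  rw [Finite.mem_toFinset, mem_ofPred_eq, not_le] at hx
  exact hzero (h1 x x.2) h2 hx

end Vague


/-! ### Convergence of the range as the order grows -/

section Convergence

/-- By monotonicity the set of y > 0 with k(y) ≤ a x - b is an initial piece of the half-line. It
contains (0, u/r] if k(u/r) ≤ a x - b and is contained in it otherwise; its length times `r` is the
function to be inverted. No continuity of `k` is needed. -/
theorem isGenInverseAt_of_monotone {k : ℝ → ℝ} (hk : Monotone k) (hpos : ∀ y, 0 < y → 0 < k y)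
    {r a : ℝ} (hr : 0 < r) (ha : 0 < a) (b : ℝ) {u : ℝ} (hu : 0 < u) :
    IsGenInverseAt
      (fun x => ENNReal.ofReal r *
        ((volume : Measure ℝ).restrict (Ioi 0)).map k (Ioc 0 (a * x - b)))
      u ((k (u / r) + b) / a) := by
  have hur : 0 < u / r := div_pos hu hr
  have hval : ∀ z, ((volume : Measure ℝ).restrict (Ioi 0)).map k (Ioc 0 z)
      = volume (k ⁻¹' Ioc 0 z ∩ Ioi 0) := fun z => by
    rw [Measure.map_apply hk.measurable measurableSet_Ioc,
      Measure.restrict_apply (hk.measurable measurableSet_Ioc)]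
  have hmul : ENNReal.ofReal r * ENNReal.ofReal (u / r) = ENNReal.ofReal u := by
    rw [← ENNReal.ofReal_mul hr.le, mul_div_cancel₀ _ hr.ne']
  have hle : ∀ x, (k (u / r) + b) / a ≤ x ↔ k (u / r) ≤ a * x - b := fun x => by
    rw [div_le_iff₀ ha, le_sub_iff_add_le, mul_comm x a]
  refine ⟨fun x hx => ?_, fun x hx => ?_⟩
  · rw [hle]
    by_contra hlt
    rw [hval] at hx
    refine hx.not_ge ?_
    rw [← hmul]
    gcongr
    calc volume (k ⁻¹' Ioc 0 (a * x - b) ∩ Ioi 0) ≤ volume (Ioc 0 (u / r)) := by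
          refine measure_mono fun y hy => ⟨hy.2, ?_⟩
          by_contra hy'
          exact hlt ((hk (not_le.1 hy').le).trans hy.1.2)
      _ = ENNReal.ofReal (u / r) := by rw [Real.volume_Ioc, sub_zero]
  · rw [hle] at hx
    rw [hval, ← hmul]
    gcongr
    calc ENNReal.ofReal (u / r) = volume (Ioc 0 (u / r)) := by rw [Real.volume_Ioc, sub_zero]
      _ ≤ _ := measure_mono (t := k ⁻¹' Ioc 0 (a * x - b) ∩ Ioi 0) fun y hy =>
          ⟨⟨hpos y hy.1, (hk hy.2).trans hx⟩, hy.1⟩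

theorem map_neg_restrict_Iio :
    ((volume : Measure ℝ).restrict (Iio 0)).map (fun x => -x) = volume.restrict (Ioi 0) := by
  have hpre : (fun x : ℝ => -x) ⁻¹' Ioi 0 = Iio 0 := by
    ext x
    simp
  have h1 := Measure.restrict_map (μ := (volume : Measure ℝ)) (f := fun x : ℝ => -x)
    measurable_neg (measurableSet_Ioi (a := (0 : ℝ)))
  rw [hpre] at h1
  rw [← h1]
  exact congrArg (fun m : Measure ℝ => m.restrict (Ioi 0)) (Measure.map_neg_eq_self volume)

theorem imageMeasure_scale {c : ℝ} (hc : 0 < c) {D : Set ℝ}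
    (hDc : ∀ x, x / c ∈ D ↔ x ∈ D) {g : ℝ → ℝ} (hg : Measurable g) (A : LocFinSet) :
    imageMeasure D g (A.scale c hc)
      = (pointMeasure (A.carrier ∩ D)).map fun x => g (x / c) := by
  have hd : Measurable fun x : ℝ => x / c := measurable_id.div_const _
  have hset : (A.scale c hc).carrier ∩ D = (fun x => x / c) '' (A.carrier ∩ D) := by
    ext x
    constructor
    · rintro ⟨⟨y, hy, rfl⟩, hx⟩
      exact ⟨y, ⟨hy, (hDc y).1 hx⟩, rfl⟩
    · rintro ⟨y, ⟨hy, hyD⟩, rfl⟩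
      exact ⟨⟨y, hy, rfl⟩, (hDc y).2 hyD⟩
  rw [imageMeasure, hset, ← pointMeasure_map hd fun x _ y _ hxy => (div_left_inj' hc.ne').1 hxy,
    Measure.map_map hg hd]
  rfl

theorem ae_disjoint_of_countable {Q : Measure LocFinSet} [IsProbabilityMeasure Q]
    (hQ : IsPoissonRandomMeasure (fun A : LocFinSet => pointMeasure A.carrier) volume Q)
    {C : Set ℝ} (hC : C.Countable) : ∀ᵐ A ∂Q, Disjoint A.carrier C := by
  filter_upwards [hQ.ae_eq_zero hC.measurableSet (hC.measure_zero _)] with A hA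
  rwa [pointMeasure_apply_eq_zero _ hC.measurableSet] at hA

/-- The sequence in the convergence statement starts at order 0. There the infimum is over the empty
set and equals ⊤, which is not a real number. -/
theorem extremalRange_zero (xl xr : EReal) (N : Measure (ℝ × ℝ)) :
    extremalRange xl xr N 0 = ∅ := by
  ext x
  simp [extremalRange, extremalProcess]

theorem integral_congr_law {Ω : Type*} [MeasurableSpace Ω] {P : Measure Ω} {E : Type*}
    [MeasurableSpace E] {Q : Measure LocFinSet} {X : Ω → LocFinSet} (hX : AEMeasurable X P)
    {s : LocFinSet → LocFinSet} (hs : Measurable s) (hlaw : P.map X = Q.map s)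
    {Θ : LocFinSet → E} (hΘ : Measurable Θ) {ξ : Ω → E} (hξ : ξ =ᵐ[P] fun ω => Θ (X ω))
    {F : E → ℝ} (hF : Measurable F) :
    ∫ ω, F (ξ ω) ∂P = ∫ A, F (Θ (s A)) ∂Q := by
  have h1 : ∫ ω, F (ξ ω) ∂P = ∫ ω, F (Θ (X ω)) ∂P :=
    integral_congr_ae (hξ.mono fun ω hω => congrArg F hω)
  have hFΘ : Measurable fun A => F (Θ A) := hF.comp hΘ
  rw [h1, ← integral_map hX hFΘ.aestronglyMeasurable, hlaw,
    integral_map hs.aemeasurable hFΘ.aestronglyMeasurable]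

theorem tendsto_vagueTopologyProd {m₁ m₂ : ℕ → Measure ℝ} {m₁' m₂' : Measure ℝ}
    (h₁ : Tendsto m₁ atTop (@nhds _ (vagueTopology ℝ) m₁'))
    (h₂ : Tendsto m₂ atTop (@nhds _ (vagueTopology ℝ) m₂')) :
    Tendsto (fun n => (m₁ n, m₂ n)) atTop (@nhds _ (vagueTopologyProd ℝ) (m₁', m₂')) := by
  let _ := vagueTopology ℝ
  exact h₁.prodMk_nhds h₂

variable {Pi : Measure ℝ} {xl xr : EReal} (h : IsJumpIntensity Pi xl xr)

/-- The orders are coupled by replacing the range of order `r`, in law, by the quantile image of A/r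
for a single unit process A under `Q`. On that space convergence is almost sure, and dominated
convergence finishes. -/
theorem vagueTendstoInDistribution_extremalRange (h0 : (0 : ℝ) ∈ window xl xr)
    {Ω : Type*} [MeasurableSpace Ω] {P : Measure Ω} [IsProbabilityMeasure P]
    {N : Ω → Measure (ℝ × ℝ)}
    (hN : IsPoissonRandomMeasure N (((volume : Measure ℝ).restrict (Ici 0)).prod Pi) P)
    {Q : Measure LocFinSet} [IsProbabilityMeasure Q]
    (hQ : IsPoissonRandomMeasure (fun A : LocFinSet => pointMeasure A.carrier) volume Q)
    {aPos bPos aNeg bNeg : ℝ → ℝ} {SlimPos SlimNeg : Measure ℝ}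
    (haPos : ∀ t : ℝ, 0 < t → 0 < aPos t) (haNeg : ∀ t : ℝ, 0 < t → 0 < aNeg t)
    (hSPos : IsInfiniteRadonOnHalfLine SlimPos) (hSNeg : IsInfiniteRadonOnHalfLine SlimNeg)
    (hTPos : TailCondition (recordMeasurePos h) SlimPos aPos bPos)
    (hTNeg : TailCondition (recordMeasureNeg h) SlimNeg aNeg bNeg) :
    VagueTendstoInDistribution
      (fun r ω =>
        (pointMeasure ((fun x : ℝ => (x + bPos r) / aPos r) '' extremalRangePos xl xr (N ω) r),
          pointMeasure ((fun x : ℝ => (-x + bNeg r) / aNeg r) ''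
            extremalRangeNeg xl xr (N ω) r)))
      P
      (fun A : LocFinSet => (imageMeasure (Ioi 0) (halfLineQuantile SlimPos) A,
        imageMeasure (Iio 0) (fun x => halfLineQuantile SlimNeg (-x)) A)) Q := by
  have hT := measurable_levelQuantile h h0
  have hTm := (strictMono_levelQuantile h h0).monotone
  have hqPos := hSPos.monotone_halfLineQuantile.measurable
  have hqNeg := hSNeg.monotone_halfLineQuantile.measurable.comp measurable_neg
  -- Reflection turns the negative half into a positive one: y ↦ -T(-y) is nondecreasing, positive
  -- for positive y, and maps Lebesgue measure to S⁻.
  have hkm : Monotone fun y => -levelQuantile h h0 (-y) := fun x y hxy =>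
    neg_le_neg (hTm (neg_le_neg hxy))
  have hkpos : ∀ y, 0 < y → 0 < -levelQuantile h h0 (-y) := fun y hy =>
    neg_pos.2 (levelQuantile_neg h h0 (neg_neg_of_pos hy))
  have hkNeg : ((volume : Measure ℝ).restrict (Ioi 0)).map (fun y => -levelQuantile h h0 (-y))
      = recordMeasureNeg h := by
    rw [← map_neg_restrict_Iio, Measure.map_map hkm.measurable measurable_neg,
      ← map_restrict_Iio_levelQuantile h h0]
    congr 1
    ext y
    simp
  set gPos : ℕ → ℝ → ℝ := fun r y => (levelQuantile h h0 y + bPos r) / aPos r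
  set gNeg : ℕ → ℝ → ℝ := fun r y => (-levelQuantile h h0 y + bNeg r) / aNeg r
  have hgPos : ∀ r, Measurable (gPos r) := fun r => (hT.add_const _).div_const _
  have hgNeg : ∀ r, Measurable (gNeg r) := fun r => (hT.neg.add_const _).div_const _
  set Θ : ℕ → LocFinSet → Measure ℝ × Measure ℝ := fun r A =>
    (imageMeasure (Ioi 0) (gPos r) A, imageMeasure (Iio 0) (gNeg r) A)
  have hΘ : ∀ r, Measurable (Θ r) := fun r =>
    (measurable_imageMeasure measurableSet_Ioi (hgPos r)).prodMk
      (measurable_imageMeasure measurableSet_Iio (hgNeg r))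
  have hcoupling : ∀ r : ℕ, ∀ hr : 1 ≤ r, ∃ X : Ω → LocFinSet, AEMeasurable X P ∧
      P.map X = Q.map (LocFinSet.scale r (Nat.cast_pos.2 hr)) ∧
      (fun ω =>
        (pointMeasure ((fun x : ℝ => (x + bPos r) / aPos r) '' extremalRangePos xl xr (N ω) r),
          pointMeasure ((fun x : ℝ => (-x + bNeg r) / aNeg r) ''
            extremalRangeNeg xl xr (N ω) r))) =ᵐ[P] fun ω => Θ r (X ω) := by
    intro r hr
    have hr0 : (0 : ℝ) < r := Nat.cast_pos.2 hr
    obtain ⟨X, hX, hXr, hXQ⟩ := exists_levels_of_extremalRange h h0 hN hQ hr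
    have hX0 := ae_zero_notMem (by simp) (isPoissonRandomMeasure_scale hQ hX hr hXQ)
    refine ⟨X, hX, hXQ, ?_⟩
    filter_upwards [hXr, hX0] with ω h1 h2
    refine Prod.ext ?_ ?_
    · simp only [extremalRangePos, h1]
      refine pointMeasure_image_pos h h0 (k := fun x => (x + bPos r) / aPos r)
        ((measurable_id.add_const _).div_const _) fun x y hxy => ?_
      exact add_left_injective _ ((div_left_inj' (haPos r hr0).ne').1 hxy)
    · simp only [extremalRangeNeg, h1]
      refine pointMeasure_image_neg h h0 h2 (k := fun x => (-x + bNeg r) / aNeg r)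
        ((measurable_neg.add_const _).div_const _) fun x y hxy => ?_
      exact neg_injective (add_left_injective _ ((div_left_inj' (haNeg r hr0).ne').1 hxy))
  refine ⟨fun r => ?_, ?_, ?_⟩
  · rcases Nat.eq_zero_or_pos r with rfl | hr
    · simp only [extremalRangePos, extremalRangeNeg, extremalRange_zero, empty_inter]
      exact aemeasurable_const
    · obtain ⟨X, hX, -, hXe⟩ := hcoupling r hr
      exact ((hΘ r).comp_aemeasurable hX).congr hXe.symm
  · exact ((measurable_imageMeasure measurableSet_Ioi hqPos).prodMk
      (measurable_imageMeasure measurableSet_Iio hqNeg)).aemeasurable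
  · rintro F hF hFc ⟨C, hC⟩
    -- The value at order 0 is arbitrary, since only large orders matter for the limit.
    set s : ℕ → LocFinSet → LocFinSet := fun r A =>
      if hr : 1 ≤ r then A.scale r (Nat.cast_pos.2 hr) else A
    have hs : ∀ r, Measurable (s r) := by
      intro r
      by_cases hr : 1 ≤ r
      · simp only [s, dif_pos hr]
        exact LocFinSet.measurable_scale _
      · simp only [s, dif_neg hr]
        exact measurable_id
    have hlim : Tendsto (fun r => ∫ A, F (Θ r (s r A)) ∂Q) atTop
        (𝓝 (∫ A, F (imageMeasure (Ioi 0) (halfLineQuantile SlimPos) A,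
          imageMeasure (Iio 0) (fun x => halfLineQuantile SlimNeg (-x)) A) ∂Q)) := by
      refine tendsto_integral_of_dominated_convergence (fun _ => C)
        (fun r => (hF.comp ((hΘ r).comp (hs r))).aestronglyMeasurable) (integrable_const C)
        (fun r => ae_of_all _ fun A => hC _) ?_
      have hcPos : (exceptionalLevels SlimPos).Countable := countable_range _
      have hcNeg : ((fun x => -x) '' exceptionalLevels SlimNeg).Countable :=
        (countable_range _).image _
      -- Almost surely no point of the unit process sits at one of the countably many levels where
      -- the inverses might fail to converge.
      filter_upwards [ae_disjoint_of_countable hQ hcPos, ae_disjoint_of_countable hQ hcNeg]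
        with A hA hA'
      have hpos : Tendsto (fun r => (Θ r (s r A)).1) atTop (@nhds _ (vagueTopology ℝ)
          (imageMeasure (Ioi 0) (halfLineQuantile SlimPos) A)) := by
        refine tendsto_vagueTopology fun f => ?_
        refine (tendsto_lintegral_map_pointMeasure hSPos
          (fun x hx => (hTPos x hx).comp tendsto_natCast_atTop_atTop) (τ := fun x => x)
          (A := A.carrier ∩ Ioi 0) measurable_id (fun x hx => hx.2) (fun M => ?_)
          (fun x hx => Set.disjoint_left.1 hA hx.1) (g := fun r x => gPos r (x / r))
          (fun r => (hgPos r).comp (measurable_id.div_const _)) ?_ f).congr' ?_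
        · exact (A.finite_inter_Icc 0 M).subset fun x hx => ⟨hx.1.1, hx.1.2.le, hx.2⟩
        · filter_upwards [eventually_ge_atTop 1] with r hr x hx
          have hr0 : (0 : ℝ) < r := Nat.cast_pos.2 hr
          have := isGenInverseAt_of_monotone hTm (fun y hy => (levelQuantile_pos_iff h h0).2 hy)
            hr0 (haPos r hr0) (bPos r) (u := x) hx.2
          rw [map_restrict_Ioi_levelQuantile] at this
          exact this
        · filter_upwards [eventually_ge_atTop 1] with r hr
          have hr0 : (0 : ℝ) < r := Nat.cast_pos.2 hr
          simp only [Θ, s, dif_pos hr]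
          rw [imageMeasure_scale hr0
            (fun x => by simp [div_pos_iff_of_pos_right hr0]) (hgPos r)]
      have hneg : Tendsto (fun r => (Θ r (s r A)).2) atTop (@nhds _ (vagueTopology ℝ)
          (imageMeasure (Iio 0) (fun x => halfLineQuantile SlimNeg (-x)) A)) := by
        refine tendsto_vagueTopology fun f => ?_
        refine (tendsto_lintegral_map_pointMeasure hSNeg
          (fun x hx => (hTNeg x hx).comp tendsto_natCast_atTop_atTop) (τ := fun x => -x)
          (A := A.carrier ∩ Iio 0) measurable_neg (fun x hx => neg_pos.2 hx.2) (fun M => ?_)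
          (fun x hx hx' => Set.disjoint_left.1 hA' hx.1 ⟨-x, hx', neg_neg x⟩)
          (g := fun r x => gNeg r (x / r))
          (fun r => (hgNeg r).comp (measurable_id.div_const _)) ?_ f).congr' ?_
        · exact (A.finite_inter_Icc (-M) 0).subset fun x hx =>
            ⟨hx.1.1, neg_le.1 hx.2, hx.1.2.le⟩
        · filter_upwards [eventually_ge_atTop 1] with r hr x hx
          have hr0 : (0 : ℝ) < r := Nat.cast_pos.2 hr
          have := isGenInverseAt_of_monotone hkm hkpos hr0 (haNeg r hr0) (bNeg r) (u := -x)
            (neg_pos.2 hx.2)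
          rw [hkNeg, neg_div, neg_neg] at this
          exact this
        · filter_upwards [eventually_ge_atTop 1] with r hr
          have hr0 : (0 : ℝ) < r := Nat.cast_pos.2 hr
          simp only [Θ, s, dif_pos hr]
          rw [imageMeasure_scale hr0
            (fun x => by simp [div_lt_iff₀ hr0]) (hgNeg r)]
      exact (@Continuous.tendsto _ _ (vagueTopologyProd ℝ) _ _ hFc _).comp
        (tendsto_vagueTopologyProd hpos hneg)
    refine hlim.congr' ?_
    filter_upwards [eventually_ge_atTop 1] with r hr
    obtain ⟨X, hX, hXQ, hXe⟩ := hcoupling r hr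
    refine (integral_congr_law hX (hs r) ?_ (hΘ r) hXe hF).symm
    rw [hXQ]
    congr 1
    ext1 A
    simp only [s, dif_pos hr]

/-- The limit lives on the canonical space of the unit process: the quantile functions map its two
halves, the left one reflected, to processes with means S∞⁺ and S∞⁻. These are independent since the
half-lines are disjoint. -/
theorem exists_vague_limit (h0 : (0 : ℝ) ∈ window xl xr)
    {Ω : Type*} [MeasurableSpace Ω] {P : Measure Ω} [IsProbabilityMeasure P]
    {N : Ω → Measure (ℝ × ℝ)}
    (hN : IsPoissonRandomMeasure N (((volume : Measure ℝ).restrict (Ici 0)).prod Pi) P)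
    {aPos bPos aNeg bNeg : ℝ → ℝ} {SlimPos SlimNeg : Measure ℝ}
    (haPos : ∀ t : ℝ, 0 < t → 0 < aPos t) (haNeg : ∀ t : ℝ, 0 < t → 0 < aNeg t)
    (hSPos : IsInfiniteRadonOnHalfLine SlimPos) (hSNeg : IsInfiniteRadonOnHalfLine SlimNeg)
    (hTPos : TailCondition (recordMeasurePos h) SlimPos aPos bPos)
    (hTNeg : TailCondition (recordMeasureNeg h) SlimNeg aNeg bNeg) :
    ∃ (Ω' : Type) (_ : MeasurableSpace Ω') (P' : Measure Ω') (_ : IsProbabilityMeasure P')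
      (RlimPos RlimNeg : Ω' → Measure ℝ),
      IsPoissonRandomMeasure RlimPos SlimPos P' ∧ IsPoissonRandomMeasure RlimNeg SlimNeg P' ∧
      IndepFun RlimPos RlimNeg P' ∧
      VagueTendstoInDistribution
        (fun r ω =>
          (pointMeasure ((fun x : ℝ => (x + bPos r) / aPos r) '' extremalRangePos xl xr (N ω) r),
            pointMeasure ((fun x : ℝ => (-x + bNeg r) / aNeg r) ''
              extremalRangeNeg xl xr (N ω) r)))
        P (fun ω' => (RlimPos ω', RlimNeg ω')) P' := by
  obtain ⟨Q, hQ, hQN⟩ := exists_unit_poisson (tailMass_pos h h0)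
    (isPoissonRandomMeasure_levels h h0 hN)
  have hqPos := hSPos.monotone_halfLineQuantile.measurable
  have hqNeg := hSNeg.monotone_halfLineQuantile.measurable
  refine ⟨LocFinSet, inferInstance, Q, hQ, _, _, ?_, ?_, ?_,
    vagueTendstoInDistribution_extremalRange h h0 hN hQN haPos haNeg hSPos hSNeg hTPos hTNeg⟩
  · have := isPoissonRandomMeasure_imageMeasure (X := fun A => A) hQN
      (measurableSet_Ioi (a := (0 : ℝ))) hqPos
    rwa [hSPos.map_halfLineQuantile] at this
  · have := isPoissonRandomMeasure_imageMeasure (X := fun A => A) hQN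
      (measurableSet_Iio (a := (0 : ℝ))) (hqNeg.comp measurable_neg)
    rwa [← Measure.map_map hqNeg measurable_neg, map_neg_restrict_Iio,
      hSNeg.map_halfLineQuantile] at this
  · exact indepFun_imageMeasure (X := fun A => A) aemeasurable_id hQN measurableSet_Ioi
      measurableSet_Iio (Iio_disjoint_Ioi_same.symm) hqPos (hqNeg.comp measurable_neg)

end Convergence

end ExtremalRange

theorem mainTheorem4 {Ω : Type*} [MeasurableSpace Ω] (P : Measure Ω) [IsProbabilityMeasure P]
    (xl xr : EReal) (hxl : xl < 0) (hxr : 0 < xr)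
    (Pi : Measure ℝ) (hPi : ExtremalRange.IsJumpIntensity Pi xl xr)
    (N : Ω → Measure (ℝ × ℝ))
    (hN : ExtremalRange.IsPoissonRandomMeasure N
      (((volume : Measure ℝ).restrict (Ici 0)).prod Pi) P) :
    (∀ r : ℕ, 1 ≤ r →
      (∀ᵐ ω ∂P, ExtremalRange.extremalRange xl xr (N ω) r
        = ExtremalRange.extremalRangePos xl xr (N ω) r
          ∪ ExtremalRange.extremalRangeNeg xl xr (N ω) r) ∧
      ExtremalRange.IsPoissonRandomMeasure
        (fun ω => ExtremalRange.pointMeasure (ExtremalRange.extremalRangePos xl xr (N ω) r))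
        ((r : ℝ≥0∞) • ExtremalRange.recordMeasurePos hPi) P ∧
      ExtremalRange.IsPoissonRandomMeasure
        (fun ω => ExtremalRange.pointMeasure
          ((fun x : ℝ => -x) '' ExtremalRange.extremalRangeNeg xl xr (N ω) r))
        ((r : ℝ≥0∞) • ExtremalRange.recordMeasureNeg hPi) P ∧
      IndepFun
        (fun ω => ExtremalRange.pointMeasure (ExtremalRange.extremalRangePos xl xr (N ω) r))
        (fun ω => ExtremalRange.pointMeasure (ExtremalRange.extremalRangeNeg xl xr (N ω) r))
        P) ∧
    (∀ (aPos bPos aNeg bNeg : ℝ → ℝ) (SlimPos SlimNeg : Measure ℝ),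
      (∀ t : ℝ, 0 < t → 0 < aPos t) → (∀ t : ℝ, 0 < t → 0 < aNeg t) →
      ExtremalRange.IsInfiniteRadonOnHalfLine SlimPos →
      ExtremalRange.IsInfiniteRadonOnHalfLine SlimNeg →
      ExtremalRange.TailCondition (ExtremalRange.recordMeasurePos hPi) SlimPos aPos bPos →
      ExtremalRange.TailCondition (ExtremalRange.recordMeasureNeg hPi) SlimNeg aNeg bNeg →
      ∃ (Ω' : Type) (_ : MeasurableSpace Ω') (P' : Measure Ω') (_ : IsProbabilityMeasure P')
        (RlimPos RlimNeg : Ω' → Measure ℝ),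
        ExtremalRange.IsPoissonRandomMeasure RlimPos SlimPos P' ∧
        ExtremalRange.IsPoissonRandomMeasure RlimNeg SlimNeg P' ∧
        IndepFun RlimPos RlimNeg P' ∧
        ExtremalRange.VagueTendstoInDistribution
          (fun r ω =>
            (ExtremalRange.pointMeasure
              ((fun x : ℝ => (x + bPos r) / aPos r) ''
                ExtremalRange.extremalRangePos xl xr (N ω) r),
             ExtremalRange.pointMeasure
              ((fun x : ℝ => (-x + bNeg r) / aNeg r) ''
                ExtremalRange.extremalRangeNeg xl xr (N ω) r)))
          P (fun ω' => (RlimPos ω', RlimNeg ω')) P') := by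
  have h0 : (0 : ℝ) ∈ ExtremalRange.window xl xr :=
    ⟨by exact_mod_cast hxl, by exact_mod_cast hxr⟩
  refine ⟨fun r hr => ExtremalRange.isPoissonRandomMeasure_extremalRange hPi h0 hN hr, ?_⟩
  intro aPos bPos aNeg bNeg SlimPos SlimNeg haPos haNeg hSPos hSNeg hTPos hTNeg
  exact ExtremalRange.exists_vague_limit hPi h0 hN haPos haNeg hSPos hSNeg hTPos hTNeg
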